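/- Let $M$ be a smooth manifold without boundary with a continuous Riemannian metric, let $f:M\to M$ be a $C^1$ diffeomorphism, and let $\Lambda\subset M$ be a compact connected (non-empty) smooth embedded submanifold without boundary. Suppose that $\Lambda$ is a normally hyperbolic invariant manifold for $f$: $f(\Lambda)=\Lambda$, and there are constants $C>0$, $0<\lambda<\mu^{-1}<1$ and a splitting $T_\Lambda M=T\Lambda\oplus E^u\oplus E^s$ into continuous subbundles, invariant under $df$, such that for all $\theta\in\Lambda$ and all $x,y,w\in T_\theta M$ $$x\in E^u_\theta\iff \|df^i(\theta)x\|\le C\lambda^{|i|}\|x\|\ \text{ for all integers } i\le 0,$$ $$y\in E^s_\theta\iff \|df^i(\theta)y\|\le C\lambda^{i}\|y\|\ \text{ for all integers } i\ge 0,$$ $$w\in T_\theta\Lambda\iff \|df^i(\theta)w\|\le C\mu^{|i|}\|w\|\ \text{ for all } i\in\mathbb Z.$$ Let $k\in\mathbb N$ with $k>\log_\lambda\frac1C$. Then there is a neighbourhood $D$ of $\Lambda$ in $M$, carrying the structure of the disc bundle of $E=E^u\oplus E^s$, such that $D\overset{f^k}{\Longrightarrow}D$. Here points of $E$ are written $(\theta;x,y)$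 with $x\in E^u_\theta$, $y\in E^s_\theta$, and $$D_E=\{\|x\|\le1,\|y\|\le1\},\quad D_E^-=\{\|x\|=1,\|y\|\le1\},\quad D_E^+=\{\|x\|\le1,\|y\|=1\}.$$ That $D$ carries this bundle structure and $D\overset{f^k}{\Longrightarrow}D$ means the following. There is a homeomorphism $e$ from an open set $U\subset M$ containing $D$ (hence $\Lambda$) onto an open subset of $E$, with $e(\theta)=(\theta;0,0)$ for $\theta\in\Lambda$, $e(D)=D_E$ and $f^k(D)\subset U$, such that the map $F=e\circ f^k\circ e^{-1}:D_E\to E$ satisfies $D_E\overset{F}{\Longrightarrow}D_E$, that is: $F$ is continuous, and there is a continuous $h:[0,1]\times D_E\to E$ with $h(0,\cdot)=F$, $h([0,1]\times D_E^-)\cap D_E=\emptyset$ and $h([0,1]\times D_E)\cap D_E^+=\emptyset$, together with a continuous map $\eta:\Lambda\to\Lambda$ of non-zero degree modulo $2$ and linear maps $A_\theta:E^u_\theta\to E^u_{\eta(\theta)}$ $(\theta\in\Lambda)$ with $\|A_\theta x\|>1$ whenever $\|x\|=1$, such that $h(1,(\theta;x,y))=(\eta(\theta);A_\theta x,0)$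 for all $(\theta;x,y)\in D_E$. (If $E^u$ has rank $0$, the last condition reads $h(1,(\theta;y))=(\eta(\theta);0)$.) -/

import Mathlib

open Bundle Set Topology
open scoped Manifold ContDiff

noncomputable section

/-! ### Degree modulo two -/

/-- `y` is a regular value of the map `φ : B → B` of a `c`-dimensional manifold into itself. -/
def IsRegularValue {c : ℕ} {B : Type*} [TopologicalSpace B]
    [ChartedSpace (EuclideanSpace ℝ (Fin c)) B] (φ : B → B) (y : B) : Prop :=
  ∀ x, φ x = y → Function.Surjective (mfderiv (𝓡 c) (𝓡 c) φ x)

open Classical in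
/-- The degree modulo two of a continuous self-map `η` of a compact connected `c`-dimensional
manifold without boundary: the parity of the number of preimages of a regular value of a `C¹` map
homotopic to `η`. (This parity depends neither on the `C¹` map nor on the regular value.) -/
def degTwo (c : ℕ) {B : Type*} [TopologicalSpace B]
    [ChartedSpace (EuclideanSpace ℝ (Fin c)) B] (η : C(B, B)) : ZMod 2 :=
  if ∃ φ : C(B, B), η.Homotopic φ ∧ ContMDiff (𝓡 c) (𝓡 c) 1 φ ∧
      ∃ y, IsRegularValue (c := c) φ y ∧ Odd (φ ⁻¹' {y}).ncard
  then 1 else 0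

/-! ### Covering relation on the disc bundle of a Whitney sum

The bundles `E₁` (unstable directions) and `E₂` (stable directions) over `B` have normed fibres,
and `E₁ ×ᵇ E₂` is their Whitney sum; a point of its total space is a triple `⟨θ, (x, y)⟩`. -/

section Covering

variable {B : Type*}
  (F₁ : Type*) (E₁ : B → Type*) [∀ b, NormedAddCommGroup (E₁ b)]
  (F₂ : Type*) (E₂ : B → Type*) [∀ b, NormedAddCommGroup (E₂ b)]

/-- The set `D = {(θ; x, y) | ‖x‖ ≤ 1, ‖y‖ ≤ 1}`. -/
def discBundle : Set (TotalSpace (F₁ × F₂) (E₁ ×ᵇ E₂)) :=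
  {v | ‖v.2.1‖ ≤ 1 ∧ ‖v.2.2‖ ≤ 1}

/-- The exit set `D⁻ = {(θ; x, y) | ‖x‖ = 1, ‖y‖ ≤ 1}`. -/
def exitSet : Set (TotalSpace (F₁ × F₂) (E₁ ×ᵇ E₂)) :=
  {v | ‖v.2.1‖ = 1 ∧ ‖v.2.2‖ ≤ 1}

/-- The entry set `D⁺ = {(θ; x, y) | ‖x‖ ≤ 1, ‖y‖ = 1}`. -/
def entrySet : Set (TotalSpace (F₁ × F₂) (E₁ ×ᵇ E₂)) :=
  {v | ‖v.2.1‖ ≤ 1 ∧ ‖v.2.2‖ = 1}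

variable [∀ b, NormedSpace ℝ (E₁ b)]
  [TopologicalSpace (TotalSpace F₁ E₁)] [TopologicalSpace (TotalSpace F₂ E₂)]

/-- `D` `F`-covers `D`, for a map `F` from `D` to the total space of the Whitney sum, over a
`c`-dimensional base. If the fibres of `E₁` are trivial, then the condition on `A` is empty and
`h (1, (θ; y)) = (η θ; 0)`. -/
def SelfCovers (c : ℕ) [TopologicalSpace B] [ChartedSpace (EuclideanSpace ℝ (Fin c)) B]
    (F : discBundle F₁ E₁ F₂ E₂ → TotalSpace (F₁ × F₂) (E₁ ×ᵇ E₂)) : Prop :=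
  Continuous F ∧
  ∃ h : unitInterval × discBundle F₁ E₁ F₂ E₂ → TotalSpace (F₁ × F₂) (E₁ ×ᵇ E₂),
    Continuous h ∧
    (∀ v, h (0, v) = F v) ∧
    (∀ t, ∀ v : discBundle F₁ E₁ F₂ E₂, v.1 ∈ exitSet F₁ E₁ F₂ E₂ →
      h (t, v) ∉ discBundle F₁ E₁ F₂ E₂) ∧
    (∀ t v, h (t, v) ∉ entrySet F₁ E₁ F₂ E₂) ∧
    ∃ η : C(B, B), degTwo c η ≠ 0 ∧
      ∃ A : ∀ θ, E₁ θ →ₗ[ℝ] E₁ (η θ),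
        (∀ θ x, ‖x‖ = 1 → 1 < ‖A θ x‖) ∧
        ∀ v : discBundle F₁ E₁ F₂ E₂,
          h (1, v) = ⟨η v.1.1, (A v.1.1 v.1.2.1, (0 : E₂ (η v.1.1)))⟩

end Covering

/-! ### Subbundles of the tangent bundle along a set -/

section Tangent

variable {m : ℕ} {M : Type*} [TopologicalSpace M] [ChartedSpace (EuclideanSpace ℝ (Fin m)) M]
  {Λ : Set M}

/-- The fibre at `θ` of a family of subspaces of the tangent spaces of `M` at points of `Λ`. -/
abbrev SubFiber (V : ∀ θ : Λ, Submodule ℝ (TangentSpace (𝓡 m) (θ : M))) (θ : Λ) : Type :=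
  V θ

variable [IsManifold (𝓡 m) 1 M]

/-- The total space of a family of subspaces has the topology induced from `Λ` and `TM`, that
is, from `TM`. The rank `r` is only a label for the model fibre. -/
instance subFiberTopology (r : ℕ)
    (V : ∀ θ : Λ, Submodule ℝ (TangentSpace (𝓡 m) (θ : M))) :
    TopologicalSpace (TotalSpace (EuclideanSpace ℝ (Fin r)) (SubFiber V)) :=
  TopologicalSpace.induced
    (fun v => (⟨(v.1 : M), (v.2 : TangentSpace (𝓡 m) (v.1 : M))⟩ : TangentBundle (𝓡 m) M))
    inferInstance

/-- The subspaces `V θ` form a continuous rank-`r` subbundle of the restriction of `TM` to `Λ`: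
near each point they are spanned by a continuous frame. -/
def IsSubbundle (r : ℕ) (V : ∀ θ : Λ, Submodule ℝ (TangentSpace (𝓡 m) (θ : M))) : Prop :=
  ∀ θ₀ : Λ, ∃ U ∈ 𝓝 θ₀, ∃ e : Fin r → ∀ θ : Λ, TangentSpace (𝓡 m) (θ : M),
    (∀ i, ContinuousOn (fun θ : Λ => (⟨(θ : M), e i θ⟩ : TangentBundle (𝓡 m) M)) U) ∧
    ∀ θ ∈ U, LinearIndependent ℝ (fun i => e i θ) ∧
      Submodule.span ℝ (range fun i => e i θ) = V θ

end Tangent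

/-! ### Normal hyperbolicity -/

section NormallyHyperbolic

variable {m : ℕ} {M : Type*} [TopologicalSpace M] [ChartedSpace (EuclideanSpace ℝ (Fin m)) M]
  [IsManifold (𝓡 m) 1 M]

/-- The tangent space of the submanifold `Λ ⊆ M` at `θ`, as a subspace of the tangent space
of `M`. -/
def tangentAlong (c : ℕ) (Λ : Set M) [ChartedSpace (EuclideanSpace ℝ (Fin c)) Λ] (θ : Λ) :
    Submodule ℝ (TangentSpace (𝓡 m) (θ : M)) :=
  LinearMap.range (mfderiv (𝓡 c) (𝓡 m) (Subtype.val : Λ → M) θ).toLinearMap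

/-- The iterate `f ^ i` of a diffeomorphism, `i ∈ ℤ`. -/
def diffeoIter (f : M ≃ₘ^1⟮𝓡 m, 𝓡 m⟯ M) (i : ℤ) : M → M :=
  ⇑((f.toEquiv : Equiv.Perm M) ^ i)

variable [RiemannianBundle (fun p : M => TangentSpace (𝓡 m) p)]

/-- `Λ` is a normally hyperbolic invariant manifold of the diffeomorphism `f`, with splitting
`T_Λ M = TΛ ⊕ Eu ⊕ Es` into subbundles (of ranks `c`, `u`, `s`) and constants `C`, `lam`, `mu`;
norms are those of the Riemannian metric of `M`. -/
structure IsNormallyHyperbolic (c : ℕ) (f : M ≃ₘ^1⟮𝓡 m, 𝓡 m⟯ M) (Λ : Set M)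
    [ChartedSpace (EuclideanSpace ℝ (Fin c)) Λ] (u s : ℕ)
    (Eu Es : ∀ θ : Λ, Submodule ℝ (TangentSpace (𝓡 m) (θ : M))) (C lam mu : ℝ) : Prop where
  C_pos : 0 < C
  lam_pos : 0 < lam
  lam_lt : lam < mu⁻¹
  mu_inv_lt : mu⁻¹ < 1
  image_eq : f '' Λ = Λ
  subbundle_u : IsSubbundle u Eu
  subbundle_s : IsSubbundle s Es
  splitting : ∀ θ, DirectSum.IsInternal ![tangentAlong c Λ θ, Eu θ, Es θ]
  map_c : ∀ θ : Λ, (tangentAlong c Λ θ).map (mfderiv (𝓡 m) (𝓡 m) f (θ : M)).toLinearMap =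
    tangentAlong c Λ ⟨f θ, image_eq.subset (mem_image_of_mem f θ.2)⟩
  map_u : ∀ θ : Λ, (Eu θ).map (mfderiv (𝓡 m) (𝓡 m) f (θ : M)).toLinearMap =
    Eu ⟨f θ, image_eq.subset (mem_image_of_mem f θ.2)⟩
  map_s : ∀ θ : Λ, (Es θ).map (mfderiv (𝓡 m) (𝓡 m) f (θ : M)).toLinearMap =
    Es ⟨f θ, image_eq.subset (mem_image_of_mem f θ.2)⟩
  mem_u_iff : ∀ (θ : Λ) (x : TangentSpace (𝓡 m) (θ : M)), x ∈ Eu θ ↔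
    ∀ i : ℤ, i ≤ 0 →
      ‖mfderiv (𝓡 m) (𝓡 m) (diffeoIter f i) (θ : M) x‖ ≤ C * lam ^ i.natAbs * ‖x‖
  mem_s_iff : ∀ (θ : Λ) (y : TangentSpace (𝓡 m) (θ : M)), y ∈ Es θ ↔
    ∀ i : ℤ, 0 ≤ i →
      ‖mfderiv (𝓡 m) (𝓡 m) (diffeoIter f i) (θ : M) y‖ ≤ C * lam ^ i.natAbs * ‖y‖
  mem_c_iff : ∀ (θ : Λ) (w : TangentSpace (𝓡 m) (θ : M)), w ∈ tangentAlong c Λ θ ↔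
    ∀ i : ℤ,
      ‖mfderiv (𝓡 m) (𝓡 m) (diffeoIter f i) (θ : M) w‖ ≤ C * mu ^ i.natAbs * ‖w‖

/-- A neighbourhood `D ⊆ M` of `Λ` `g`-covers itself, for a map `g : M → M` and with respect to
the bundle `Eu ⊕ Es` over `Λ`: there is a homeomorphism `e` from an open neighbourhood of `Λ` in
`M` onto an open subset of the total space of `Eu ⊕ Es` which sends every `θ ∈ Λ` to the zero of
the fibre over `θ` and `D` onto the disc bundle; `g` sends `D` into the domain of `e`; and the
disc bundle covers itself for the map `e ∘ g ∘ e⁻¹`. -/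
def NeighbourhoodCovers (c : ℕ) (Λ : Set M) [ChartedSpace (EuclideanSpace ℝ (Fin c)) Λ] (u s : ℕ)
    (Eu Es : ∀ θ : Λ, Submodule ℝ (TangentSpace (𝓡 m) (θ : M))) (g : M → M) (D : Set M) : Prop :=
  ∃ e : OpenPartialHomeomorph M (TotalSpace
      (EuclideanSpace ℝ (Fin u) × EuclideanSpace ℝ (Fin s)) (SubFiber Eu ×ᵇ SubFiber Es)),
    D ∈ 𝓝ˢ Λ ∧ Λ ⊆ e.source ∧ D ⊆ e.source ∧
    (∀ θ : Λ, e θ = ⟨θ, (0, 0)⟩) ∧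
    e '' D = discBundle (EuclideanSpace ℝ (Fin u)) (SubFiber Eu)
      (EuclideanSpace ℝ (Fin s)) (SubFiber Es) ∧
    MapsTo g D e.source ∧
    SelfCovers (EuclideanSpace ℝ (Fin u)) (SubFiber Eu)
      (EuclideanSpace ℝ (Fin s)) (SubFiber Es) c (fun v => e (g (e.symm v)))

end NormallyHyperbolic

end

/-! On the normal directions of `Λ` the derivative of `f^k` expands `Eu` and contracts `Es`: since
`lam < 1`, the condition on `k` says exactly that `C * lam ^ k < 1`, and the inequalities defining
`Eu` and `Es` become strict expansion and contraction in the given norm. The bundle map induced by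
the derivative therefore covers the unit disc bundle, and the theorem holds because `f^k`, blown up
near `Λ`, is close to this bundle map.

A tubular neighbourhood modelled on `Eu ⊕ Es` has to be built by hand, as these bundles are only
continuous. Map `M` smoothly into a Euclidean space `V` by a map `j` that is injective on `Λ` and
immersive along it (`exists_immersion_along_compact`). Send `p` to the point `θ` of `Λ` whose image
is nearest to `j p`, together with the components of `j p - j θ` in the images of `Eu θ` and `Es θ`.
The displacement is orthogonal to the image of `TΛ`, so these two components determine it to first
order. Since `Λ` is a `C²` manifold, the nearest point is unique near `Λ`. The resulting map is
injective on `Λ`, and near each point of `Λ` it is continuous, injective and open, hence by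
compactness it is a homeomorphism near `Λ` (`exists_tubular_neighbourhood`).

This chart `e` need not be differentiable, yet for `t → 0` and `v → v₀` the points `t⁻¹ e (g (e⁻¹ (t
v)))` converge to the image of `v₀` under the bundle map of the derivative of `g = f^k`
(`AdaptedProjections.tendsto_whitneyScale`). The mechanism is strict differentiability, which
controls differences of two moving points.

The disc bundle is compact, so the rescaled maps extend continuously to `t = 0`, and for all small
`t` the strict inequalities of the linear map persist on the whole disc bundle
(`exists_neighbourhoodCovers`). Shrinking `t` to `0` while damping the stable component gives the
homotopy to `(θ; x, y) ↦ (η θ; A x, 0)`. Here `η` is the restriction of `f^k` to `Λ`, a bijective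
`C¹` map with invertible derivatives, so its degree modulo two is one. -/

noncomputable section

open Filter Asymptotics

/-! ### First-order calculus of vector-valued maps on manifolds -/

section VectorValued

variable {n : ℕ} {N : Type*} [TopologicalSpace N] [ChartedSpace (EuclideanSpace ℝ (Fin n)) N]
  {V : Type*} [NormedAddCommGroup V] [NormedSpace ℝ V]
  {W : Type*} [NormedAddCommGroup W] [NormedSpace ℝ W]

/-- The derivative of a vector-valued map, as a map into the vector space itself. -/
def vderiv (n : ℕ) {N : Type*} [TopologicalSpace N] [ChartedSpace (EuclideanSpace ℝ (Fin n)) N]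
    (h : N → V) (p : N) : TangentSpace (𝓡 n) p →L[ℝ] V :=
  mfderiv (𝓡 n) 𝓘(ℝ, V) h p

theorem vderiv_clm_comp {h : N → V} {p : N} (hh : MDifferentiableAt (𝓡 n) 𝓘(ℝ, V) h p)
    (L : V →L[ℝ] W) : vderiv n (fun q => L (h q)) p = L ∘L vderiv n h p := by
  have := (L.hasMFDerivAt (x := h p)).comp p hh.hasMFDerivAt
  exact this.mfderiv

theorem continuous_vderiv [IsManifold (𝓡 n) 1 N] {h : N → V} (hh : ContMDiff (𝓡 n) 𝓘(ℝ, V) 1 h) :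
    Continuous (fun v : TangentBundle (𝓡 n) N => vderiv n h v.1 v.2) := by
  have h1 := hh.continuous_tangentMap le_rfl
  have h2 := (contMDiff_snd_tangentBundle_modelSpace (n := 0) V 𝓘(ℝ, V)).continuous
  exact h2.comp h1

/-- The manifold derivative at `p` is the Fréchet derivative in the chart at `p`, and `C¹` makes it
strict. Strictness matters because later both points of a difference move. -/
theorem hasStrictFDerivAt_chart [IsManifold (𝓡 n) 1 N] {h : N → V} {p : N}
    (hh : ContMDiffAt (𝓡 n) 𝓘(ℝ, V) 1 h p) :
    HasStrictFDerivAt (h ∘ (extChartAt (𝓡 n) p).symm)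
      (vderiv n h p : EuclideanSpace ℝ (Fin n) →L[ℝ] V) (extChartAt (𝓡 n) p p) := by
  have h1 : ContDiffAt ℝ 1 (h ∘ (extChartAt (𝓡 n) p).symm) (extChartAt (𝓡 n) p p) := by
    have := (contMDiffAt_iff.1 hh).2
    simp only [contDiffWithinAt_univ, mfld_simps] at this
    exact this
  have h2 : vderiv n h p = fderiv ℝ (h ∘ (extChartAt (𝓡 n) p).symm) (extChartAt (𝓡 n) p p) := by
    have := hh.mdifferentiableAt (by simp)
    have h3 := this.mfderiv
    simp only [writtenInExtChartAt, mfld_simps, fderivWithin_univ] at h3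
    exact h3
  rw [h2]
  exact h1.hasStrictFDerivAt (by simp)

/-- Strict differentiability of a `C¹` map, read in a chart of the source. -/
theorem vderiv_isLittleO [IsManifold (𝓡 n) 1 N] {h : N → V} {p : N}
    (hh : ContMDiffAt (𝓡 n) 𝓘(ℝ, V) 1 h p) :
    (fun q : N × N => h q.1 - h q.2 -
      (vderiv n h p : EuclideanSpace ℝ (Fin n) →L[ℝ] V)
        (extChartAt (𝓡 n) p q.1 - extChartAt (𝓡 n) p q.2)) =o[𝓝 (p, p)]
      fun q => extChartAt (𝓡 n) p q.1 - extChartAt (𝓡 n) p q.2 := by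
  have h1 := (hasStrictFDerivAt_chart hh).isLittleO
  have hc : ContinuousAt (extChartAt (𝓡 n) p) p := continuousAt_extChartAt p
  have h2 : Tendsto (fun q : N × N => (extChartAt (𝓡 n) p q.1, extChartAt (𝓡 n) p q.2))
      (𝓝 (p, p)) (𝓝 (extChartAt (𝓡 n) p p, extChartAt (𝓡 n) p p)) :=
    (hc.comp continuousAt_fst).prodMk_nhds (hc.comp continuousAt_snd)
  have h3 := h1.comp_tendsto h2
  refine h3.congr' ?_ EventuallyEq.rfl
  have hs : (extChartAt (𝓡 n) p).source ∈ 𝓝 p := extChartAt_source_mem_nhds p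
  filter_upwards [prod_mem_nhds hs hs] with q hq
  simp only [Function.comp_apply, (extChartAt (𝓡 n) p).left_inv hq.1,
    (extChartAt (𝓡 n) p).left_inv hq.2]
  rfl

/-- An injective linear map on a finite-dimensional space is bounded below, and the strict
differentiability error is absorbed by this bound. Chart distances can thus be measured in `V`. -/
theorem isBigO_sub_of_injective_vderiv [IsManifold (𝓡 n) 1 N] {h : N → V} {p : N}
    (hh : ContMDiffAt (𝓡 n) 𝓘(ℝ, V) 1 h p) (hi : Function.Injective (vderiv n h p)) :
    (fun q : N × N => extChartAt (𝓡 n) p q.1 - extChartAt (𝓡 n) p q.2) =O[𝓝 (p, p)]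
      fun q => h q.1 - h q.2 := by
  obtain ⟨K, hK, hL⟩ := (LinearMap.injective_iff_antilipschitz
    (𝕜 := ℝ) (E := EuclideanSpace ℝ (Fin n)) (F := V) (vderiv n h p).toLinearMap).1 hi
  have h1 := vderiv_isLittleO hh
  have h2 : (fun q : N × N => extChartAt (𝓡 n) p q.1 - extChartAt (𝓡 n) p q.2) =O[𝓝 (p, p)]
      fun q => (vderiv n h p : EuclideanSpace ℝ (Fin n) →L[ℝ] V)
        (extChartAt (𝓡 n) p q.1 - extChartAt (𝓡 n) p q.2) := by
    refine IsBigO.of_bound K (Eventually.of_forall fun q => ?_)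
    exact hL.le_mul_norm (map_zero _) _
  refine h2.trans ?_
  have h3 := (h1.trans_isBigO h2).right_isBigO_add
  refine h3.congr_right fun q => ?_
  simp

/-- A chart-free form of strict differentiability: increments of `g` are a linear function of
increments of `h` up to a negligible error. It serves both to differentiate the dynamics and, with
`g = 0`, to show that projections vanishing on `TΛ` nearly annihilate increments along `Λ`. -/
theorem isLittleO_sub_of_comp_vderiv_eq [IsManifold (𝓡 n) 1 N] {h : N → V} {g : N → W} {p : N}
    (hh : ContMDiffAt (𝓡 n) 𝓘(ℝ, V) 1 h p) (hg : ContMDiffAt (𝓡 n) 𝓘(ℝ, W) 1 g p)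
    (hi : Function.Injective (vderiv n h p)) (D : V →L[ℝ] W)
    (hD : ∀ ξ, D (vderiv n h p ξ) = vderiv n g p ξ) :
    (fun q : N × N => g q.1 - g q.2 - D (h q.1 - h q.2)) =o[𝓝 (p, p)]
      fun q => h q.1 - h q.2 := by
  have h1 := D.isBigO_comp (fun q : N × N => h q.1 - h q.2 -
      (vderiv n h p : EuclideanSpace ℝ (Fin n) →L[ℝ] V)
        (extChartAt (𝓡 n) p q.1 - extChartAt (𝓡 n) p q.2)) (𝓝 (p, p))
  have h2 := (vderiv_isLittleO hg).sub (h1.trans_isLittleO (vderiv_isLittleO hh))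
  refine (h2.trans_isBigO (isBigO_sub_of_injective_vderiv hh hi)).congr_left fun q => ?_
  rw [map_sub, ← hD (extChartAt (𝓡 n) p q.1 - extChartAt (𝓡 n) p q.2)]
  abel

end VectorValued

/-! ### The tangent bundle read through an immersion -/

section Continuity

variable {n : ℕ} {N : Type*} [TopologicalSpace N] [ChartedSpace (EuclideanSpace ℝ (Fin n)) N]
  [IsManifold (𝓡 n) 1 N]
  {V : Type*} [NormedAddCommGroup V] [NormedSpace ℝ V]

/-- The local extension of a tangent vector that is constant in the trivialization at its base
point. -/
def localExtend (n : ℕ) {N : Type*} [TopologicalSpace N]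
    [ChartedSpace (EuclideanSpace ℝ (Fin n)) N] [IsManifold (𝓡 n) 1 N] (p : N)
    (x : EuclideanSpace ℝ (Fin n)) (q : N) : TangentSpace (𝓡 n) q :=
  (trivializationAt (EuclideanSpace ℝ (Fin n)) (TangentSpace (𝓡 n)) p).symmL ℝ q x

theorem continuousAt_symm_trivializationAt (p : N) (y : N × EuclideanSpace ℝ (Fin n))
    (hy : y.1 = p) :
    ContinuousAt (fun y : N × EuclideanSpace ℝ (Fin n) =>
      (⟨y.1, localExtend n p y.2 y.1⟩ : TangentBundle (𝓡 n) N)) y := by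
  set e := trivializationAt (EuclideanSpace ℝ (Fin n)) (TangentSpace (𝓡 n) : N → Type _) p
  have hb : y.1 ∈ e.baseSet := by
    rw [hy]; exact FiberBundle.mem_baseSet_trivializationAt' p
  have h1 := e.continuousOn_symm
  have h3 : e.baseSet ×ˢ univ ∈ 𝓝 y := prod_mem_nhds (e.open_baseSet.mem_nhds hb) univ_mem
  refine (h1.continuousAt h3).congr ?_
  filter_upwards [h3] with z hz
  have h2 : localExtend n p z.2 z.1 = e.symm z.1 z.2 := e.symmL_apply hz.1 z.2
  rw [h2]

theorem continuousAt_localExtend (p : N) (x : EuclideanSpace ℝ (Fin n)) :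
    ContinuousAt (fun q : N => (⟨q, localExtend n p x q⟩ : TangentBundle (𝓡 n) N)) p :=
  (continuousAt_symm_trivializationAt p (p, x) rfl).comp
    (f := fun q : N => (q, x)) (continuousAt_id.prodMk continuousAt_const)

theorem exists_localExtend_eq (p q : N)
    (hq : q ∈ (trivializationAt (EuclideanSpace ℝ (Fin n)) (TangentSpace (𝓡 n)) p).baseSet)
    (ξ : TangentSpace (𝓡 n) q) :
    ∃ x, localExtend n p x q = ξ := by
  set e := trivializationAt (EuclideanSpace ℝ (Fin n)) (TangentSpace (𝓡 n) : N → Type _) p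
  exact ⟨e.continuousLinearMapAt ℝ q ξ, e.symmL_continuousLinearMapAt hq ξ⟩

theorem localExtend_injective (p q : N)
    (hq : q ∈ (trivializationAt (EuclideanSpace ℝ (Fin n)) (TangentSpace (𝓡 n)) p).baseSet) :
    Function.Injective (fun x => localExtend n p x q) := by
  set e := trivializationAt (EuclideanSpace ℝ (Fin n)) (TangentSpace (𝓡 n) : N → Type _) p
  intro x y hxy
  have h1 := e.continuousLinearMapAt_symmL (R := ℝ) hq x
  have h2 := e.continuousLinearMapAt_symmL (R := ℝ) hq y
  rw [← h1, ← h2]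
  exact congrArg _ hxy

/-- The derivative at `q`, read in the trivialization of the tangent bundle at `p`. -/
def trivDeriv (n : ℕ) {N : Type*} [TopologicalSpace N]
    [ChartedSpace (EuclideanSpace ℝ (Fin n)) N] [IsManifold (𝓡 n) 1 N] (h : N → V) (p q : N) :
    EuclideanSpace ℝ (Fin n) →L[ℝ] V :=
  (vderiv n h q) ∘L
    (trivializationAt (EuclideanSpace ℝ (Fin n)) (TangentSpace (𝓡 n)) p).symmL ℝ q

theorem trivDeriv_apply (h : N → V) (p q : N) (x : EuclideanSpace ℝ (Fin n)) :
    trivDeriv n h p q x = vderiv n h q (localExtend n p x q) := rfl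

theorem continuousAt_trivDeriv {h : N → V} (hh : ContMDiff (𝓡 n) 𝓘(ℝ, V) 1 h) (p : N) :
    ContinuousAt (trivDeriv n h p) p := by
  rw [continuousAt_clm_apply]
  intro x
  exact (continuous_vderiv hh).continuousAt.comp (continuousAt_localExtend p x)

theorem exists_leftInverse_trivDeriv [FiniteDimensional ℝ V] {h : N → V} (p : N)
    (hi : Function.Injective (vderiv n h p)) :
    ∃ L : V →L[ℝ] EuclideanSpace ℝ (Fin n), ∀ x, L (trivDeriv n h p p x) = x := by
  have h1 : Function.Injective (trivDeriv n h p p) := by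
    intro x y hxy
    exact localExtend_injective p p (FiberBundle.mem_baseSet_trivializationAt' p) (hi hxy)
  obtain ⟨g, hg⟩ := (trivDeriv n h p p).toLinearMap.exists_leftInverse_of_injective
    (LinearMap.ker_eq_bot.2 h1)
  exact ⟨g.toContinuousLinearMap, fun x => LinearMap.congr_fun hg x⟩

/-- If `L` is a left inverse of the derivative at `p₀`, then `L` composed with the nearby
derivatives is close to the identity, hence invertible with continuous inverse. Tangent vectors are
thereby recovered continuously from their images, so convergence in `TM` can be tested in `V`. -/
theorem tendsto_mk_of_tendsto_vderiv [FiniteDimensional ℝ V] {h : N → V}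
    (hh : ContMDiff (𝓡 n) 𝓘(ℝ, V) 1 h) {p₀ : N}
    (hi : Function.Injective (vderiv n h p₀)) {α : Type*} {l : Filter α} {p : α → N}
    (hp : Tendsto p l (𝓝 p₀)) (ξ : ∀ a, TangentSpace (𝓡 n) (p a)) {X : V}
    (hX : Tendsto (fun a => vderiv n h (p a) (ξ a)) l (𝓝 X)) :
    ∃ ξ₀ : TangentSpace (𝓡 n) p₀,
      Tendsto (fun a => (⟨p a, ξ a⟩ : TangentBundle (𝓡 n) N)) l (𝓝 ⟨p₀, ξ₀⟩) := by
  obtain ⟨L, hL⟩ := exists_leftInverse_trivDeriv p₀ hi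
  set e := trivializationAt (EuclideanSpace ℝ (Fin n)) (TangentSpace (𝓡 n) : N → Type _) p₀
  have hb : ∀ᶠ a in l, p a ∈ e.baseSet :=
    hp (e.open_baseSet.mem_nhds (FiberBundle.mem_baseSet_trivializationAt' p₀))
  have h0 : L ∘L trivDeriv n h p₀ p₀ = 1 := by ext1 x; exact hL x
  have h1 : ContinuousAt (fun q => Ring.inverse (L ∘L trivDeriv n h p₀ q)) p₀ := by
    have h2 : ContinuousAt (fun q => L ∘L trivDeriv n h p₀ q) p₀ :=
      continuousAt_const.clm_comp (continuousAt_trivDeriv hh p₀)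
    refine ContinuousAt.comp (g := Ring.inverse) ?_ h2
    rw [h0]
    exact NormedRing.inverse_continuousAt 1
  have hu : ∀ᶠ a in l, IsUnit (L ∘L trivDeriv n h p₀ (p a)) := by
    have h2 : ContinuousAt (fun q => L ∘L trivDeriv n h p₀ q) p₀ :=
      continuousAt_const.clm_comp (continuousAt_trivDeriv hh p₀)
    refine (h2.tendsto.comp hp) (Units.isOpen.mem_nhds ?_)
    change IsUnit _
    rw [h0]
    exact isUnit_one
  have h3 : Tendsto (fun a => Ring.inverse (L ∘L trivDeriv n h p₀ (p a))
      (L (vderiv n h (p a) (ξ a)))) l (𝓝 (L X)) := by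
    have h4 := (isBoundedBilinearMap_apply (𝕜 := ℝ) (E := EuclideanSpace ℝ (Fin n))
      (F := EuclideanSpace ℝ (Fin n))).continuous.tendsto (_, _) |>.comp
      ((h1.tendsto.comp hp).prodMk_nhds ((L.continuous.tendsto X).comp hX))
    have h5 : Ring.inverse (L ∘L trivDeriv n h p₀ p₀) (L X) = L X := by
      rw [h0, Ring.inverse_one]; rfl
    dsimp only at h4
    rw [h5] at h4
    exact h4
  refine ⟨localExtend n p₀ (L X) p₀, ?_⟩
  have h6 := (continuousAt_symm_trivializationAt (n := n) p₀ (p₀, L X) rfl).tendsto.comp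
    (hp.prodMk_nhds h3)
  refine h6.congr' ?_
  filter_upwards [hb, hu] with a ha hau
  obtain ⟨x, hx⟩ := exists_localExtend_eq p₀ (p a) ha (ξ a)
  have h7 : Ring.inverse (L ∘L trivDeriv n h p₀ (p a)) (L (vderiv n h (p a) (ξ a))) = x := by
    rw [← hx, ← trivDeriv_apply]
    have := Ring.inverse_mul_cancel _ hau
    exact congrArg (fun T : EuclideanSpace ℝ (Fin n) →L[ℝ] EuclideanSpace ℝ (Fin n) => T x) this
  simp only [Function.comp_apply, h7, hx]

theorem eventually_injective_vderiv [FiniteDimensional ℝ V] {h : N → V}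
    (hh : ContMDiff (𝓡 n) 𝓘(ℝ, V) 1 h) {p₀ : N}
    (hi : Function.Injective (vderiv n h p₀)) :
    ∀ᶠ q in 𝓝 p₀, Function.Injective (vderiv n h q) := by
  obtain ⟨L, hL⟩ := exists_leftInverse_trivDeriv p₀ hi
  set e := trivializationAt (EuclideanSpace ℝ (Fin n)) (TangentSpace (𝓡 n) : N → Type _) p₀
  have h0 : L ∘L trivDeriv n h p₀ p₀ = 1 := by ext1 x; exact hL x
  have h2 : ContinuousAt (fun q => L ∘L trivDeriv n h p₀ q) p₀ :=
    continuousAt_const.clm_comp (continuousAt_trivDeriv hh p₀)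
  have hu : ∀ᶠ q in 𝓝 p₀, IsUnit (L ∘L trivDeriv n h p₀ q) := by
    refine h2 (Units.isOpen.mem_nhds ?_)
    change IsUnit (L ∘L trivDeriv n h p₀ p₀)
    rw [h0]
    exact isUnit_one
  filter_upwards [hu, e.open_baseSet.mem_nhds (FiberBundle.mem_baseSet_trivializationAt' p₀)]
    with q hq hqb
  intro ξ ζ hξζ
  obtain ⟨x, rfl⟩ := exists_localExtend_eq p₀ q hqb ξ
  obtain ⟨y, rfl⟩ := exists_localExtend_eq p₀ q hqb ζ
  have h3 : (L ∘L trivDeriv n h p₀ q) x = (L ∘L trivDeriv n h p₀ q) y := congrArg L hξζ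
  have h4 := congrArg (⇑(Ring.inverse (L ∘L trivDeriv n h p₀ q))) h3
  have h5 := Ring.inverse_mul_cancel _ hq
  have h6 : ∀ z, Ring.inverse (L ∘L trivDeriv n h p₀ q) ((L ∘L trivDeriv n h p₀ q) z) = z :=
    fun z => congrArg (fun T : EuclideanSpace ℝ (Fin n) →L[ℝ] EuclideanSpace ℝ (Fin n) => T z) h5
  rw [h6, h6] at h4
  rw [h4]

end Continuity

/-! ### Quadratic contact of a submanifold with its tangent spaces -/

section SecondOrder

variable {n : ℕ} {N : Type*} [TopologicalSpace N] [ChartedSpace (EuclideanSpace ℝ (Fin n)) N]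
  [IsManifold (𝓡 n) 2 N]
  {V : Type*} [NormedAddCommGroup V] [InnerProductSpace ℝ V]

/-- The deviation of an immersed `C²` submanifold from its tangent spaces is quadratic. -/
theorem exists_abs_inner_sub_le {h : N → V} (hh : ContMDiff (𝓡 n) 𝓘(ℝ, V) 2 h) {p₀ : N}
    (hi : Function.Injective (vderiv n h p₀)) :
    ∃ K : ℝ, 0 ≤ K ∧ ∀ᶠ q : N × N in 𝓝 (p₀, p₀), ∀ w : V, (∀ ξ, inner ℝ w (vderiv n h q.1 ξ) = 0) →
      |inner ℝ w (h q.2 - h q.1)| ≤ K * ‖w‖ * ‖h q.2 - h q.1‖ ^ 2 := by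
  have : IsManifold (𝓡 n) 1 N := IsManifold.of_le (n := 2) (by norm_num)
  have hh1 : ContMDiff (𝓡 n) 𝓘(ℝ, V) 1 h := hh.of_le (by norm_num)
  set φ := extChartAt (𝓡 n) p₀ with hφ
  set γ : EuclideanSpace ℝ (Fin n) → V := h ∘ φ.symm with hγ
  have hγ2 : ContDiffAt ℝ 2 γ (φ p₀) := by
    have := (contMDiffAt_iff.1 (hh.contMDiffAt (x := p₀))).2
    simp only [contDiffWithinAt_univ, mfld_simps] at this
    exact this
  have hd : ContDiffAt ℝ 1 (fderiv ℝ γ) (φ p₀) := hγ2.fderiv_right (by norm_num)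
  obtain ⟨K, s, hs, hK⟩ := hd.exists_lipschitzOnWith
  have hdiff : ∀ᶠ x in 𝓝 (φ p₀), DifferentiableAt ℝ γ x :=
    (hγ2.eventually (by simp)).mono fun x hx => hx.differentiableAt (by simp)
  obtain ⟨r, hr, hball⟩ := Metric.mem_nhds_iff.1 (inter_mem hs hdiff)
  -- The derivative is Lipschitz near the point, so the mean value inequality along a segment bounds
  -- the remainder quadratically.
  have taylor : ∀ x ∈ Metric.ball (φ p₀) r, ∀ y ∈ Metric.ball (φ p₀) r,
      ‖γ y - γ x - fderiv ℝ γ x (y - x)‖ ≤ K * ‖y - x‖ ^ 2 := by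
    intro x hx y hy
    have hseg : segment ℝ x y ⊆ Metric.ball (φ p₀) r :=
      (convex_ball _ _).segment_subset hx hy
    have := Convex.norm_image_sub_le_of_norm_fderiv_le' (𝕜 := ℝ) (f := γ) (s := segment ℝ x y)
      (φ := fderiv ℝ γ x) (C := K * ‖y - x‖) (x := x) (y := y)
      (fun z hz => (hball (hseg hz)).2) ?_ (convex_segment x y)
      (left_mem_segment ℝ x y) (right_mem_segment ℝ x y)
    · calc _ ≤ _ := this
        _ = _ := by ring
    · intro z hz
      have h1 := hK.dist_le_mul z (hball (hseg hz)).1 x (hball hx).1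
      rw [dist_eq_norm] at h1
      refine h1.trans ?_
      gcongr
      obtain ⟨a, b, ha, hb, hab, rfl⟩ := hz
      rw [dist_eq_norm]
      have h2 : a • x + b • y - x = b • (y - x) := by
        have : a = 1 - b := by linarith
        rw [this]; module
      rw [h2, norm_smul, Real.norm_of_nonneg hb]
      have : b ≤ 1 := by linarith
      exact mul_le_of_le_one_left (norm_nonneg _) this
  obtain ⟨C, hC0, hC⟩ := (isBigO_sub_of_injective_vderiv hh1.contMDiffAt hi).exists_nonneg
  refine ⟨K * C ^ 2, by positivity, ?_⟩
  have hc : ContinuousAt φ p₀ := continuousAt_extChartAt p₀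
  have hb : ∀ᶠ q in 𝓝 p₀, φ q ∈ Metric.ball (φ p₀) r := hc (Metric.ball_mem_nhds _ hr)
  have hsrc : ∀ᶠ q in 𝓝 p₀, q ∈ φ.source := extChartAt_source_mem_nhds p₀
  filter_upwards [hC.bound, prod_mem_nhds (inter_mem hb hsrc) (inter_mem hb hsrc)] with q hq hqb w hw
  obtain ⟨⟨h1, h1s⟩, h2, h2s⟩ := hqb
  have hg1 : γ (φ q.1) = h q.1 := congrArg h (φ.left_inv h1s)
  have hg2 : γ (φ q.2) = h q.2 := congrArg h (φ.left_inv h2s)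
  -- The linear term is tangent at `q.1`, hence invisible to `w`; only the quadratic remainder
  -- survives.
  have hort : inner ℝ w (fderiv ℝ γ (φ q.1) (φ q.2 - φ q.1)) = 0 := by
    have hm : HasMFDerivAt (𝓡 n) (𝓡 n) φ.symm (φ q.1) (mfderiv (𝓡 n) (𝓡 n) φ.symm (φ q.1)) := by
      have := mdifferentiableOn_extChartAt_symm (I := 𝓡 n) (x := p₀) (φ q.1) (φ.map_source h1s)
      have h4 := this.mdifferentiableAt (by
        rw [← hφ]; exact (isOpen_extChartAt_target p₀).mem_nhds (φ.map_source h1s))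
      exact h4.hasMFDerivAt
    have hm2 : HasMFDerivAt (𝓡 n) 𝓘(ℝ, V) h (φ.symm (φ q.1)) (vderiv n h (φ.symm (φ q.1))) :=
      (hh1.mdifferentiable (by simp) _).hasMFDerivAt
    have h5' := HasMFDerivAt.comp (φ q.1) hm2 hm
    have h5 := (mfderiv_eq_fderiv (𝕜 := ℝ) (f := γ) (x := φ q.1)).symm.trans h5'.mfderiv
    have h6 : fderiv ℝ γ (φ q.1) (φ q.2 - φ q.1) =
      vderiv n h (φ.symm (φ q.1)) (mfderiv (𝓡 n) (𝓡 n) φ.symm (φ q.1) (φ q.2 - φ q.1)) :=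
      congrArg (fun T : EuclideanSpace ℝ (Fin n) →L[ℝ] V => T (φ q.2 - φ q.1)) h5
    rw [h6]
    have h7 : ∀ q' : N, q' = q.1 → ∀ ξ, inner ℝ w (vderiv n h q' ξ) = 0 := by
      rintro _ rfl; exact hw
    exact h7 _ (φ.left_inv h1s) _
  have ht := taylor _ h1 _ h2
  rw [hg1, hg2] at ht
  have h8 : inner ℝ w (h q.2 - h q.1) =
      inner ℝ w (h q.2 - h q.1 - fderiv ℝ γ (φ q.1) (φ q.2 - φ q.1)) := by
    rw [inner_sub_right w (h q.2 - h q.1), hort, sub_zero]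
  rw [h8]
  have h9 : ‖φ q.2 - φ q.1‖ ≤ C * ‖h q.2 - h q.1‖ := by
    rw [norm_sub_rev, norm_sub_rev (h q.2)]; exact hq
  calc _ ≤ ‖w‖ * ‖h q.2 - h q.1 - fderiv ℝ γ (φ q.1) (φ q.2 - φ q.1)‖ := abs_real_inner_le_norm _ _
    _ ≤ ‖w‖ * (K * ‖φ q.2 - φ q.1‖ ^ 2) := by gcongr
    _ ≤ ‖w‖ * (K * (C * ‖h q.2 - h q.1‖) ^ 2) := by gcongr
    _ = _ := by ring

end SecondOrder

/-- The closed graph principle: for functions with values in a compact set, continuity follows once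
the closed condition has a unique solution. It yields continuity of projections and of the nearest
point. -/
theorem mem_of_mapClusterPt {X Y α : Type*} [TopologicalSpace X] [TopologicalSpace Y]
    {l : Filter α} {g : α → X} {f : α → Y} {x : X} {y : Y} {G : Set (X × Y)} (hG : IsClosed G)
    (hg : Tendsto g l (𝓝 x)) (hf : ∀ᶠ a in l, (g a, f a) ∈ G) (hy : MapClusterPt y l f) :
    (x, y) ∈ G := by
  obtain ⟨u, hu, hfu⟩ := mapClusterPt_iff_ultrafilter.1 hy
  exact hG.mem_of_tendsto ((hg.mono_left hu).prodMk_nhds hfu) (hf.filter_mono hu)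

/-! ### Continuity of projections from closedness of the summands -/

section Projections

variable {B : Type*} [TopologicalSpace B] [CompactSpace B]
  {V : Type*} [NormedAddCommGroup V] [NormedSpace ℝ V] [FiniteDimensional ℝ V]
  {ι : Type*} [Fintype ι]

/-- The unit vectors of the families form a compact set on which the norm of the sum does not
vanish: the angles between the summands are bounded below uniformly over the base. -/
theorem exists_pos_le_norm_sum (W : ι → B → Submodule ℝ V)
    (hW : ∀ i, IsClosed {q : B × V | q.2 ∈ W i q.1})
    (hind : ∀ b (w : ι → V), (∀ i, w i ∈ W i b) → ∑ i, w i = 0 → w = 0) :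
    ∃ c > 0, ∀ b (w : ι → V), (∀ i, w i ∈ W i b) → c * ‖w‖ ≤ ‖∑ i, w i‖ := by
  set S : Set (B × (ι → V)) := {q | (∀ i, q.2 i ∈ W i q.1) ∧ ‖q.2‖ = 1} with hS
  have hScl : IsClosed {q : B × (ι → V) | ∀ i, q.2 i ∈ W i q.1} := by
    simp only [ofPred_forall]
    refine isClosed_iInter fun i => (hW i).preimage (f := fun q : B × (ι → V) => (q.1, q.2 i)) ?_
    fun_prop
  have hSc : IsCompact S := by
    have h1 : IsCompact ((univ : Set B) ×ˢ Metric.sphere (0 : ι → V) 1) :=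
      isCompact_univ.prod (isCompact_sphere _ _)
    refine (h1.inter_left hScl).of_isClosed_subset
      (hScl.inter (isClosed_eq (by fun_prop) continuous_const)) ?_
    rintro q ⟨h1, h2⟩
    exact ⟨h1, mem_univ _, by simpa using h2⟩
  have hcont : ContinuousOn (fun q : B × (ι → V) => ‖∑ i, q.2 i‖) S := by fun_prop
  have key : ∀ c > 0, (∀ q ∈ S, c ≤ ‖∑ i, q.2 i‖) →
      ∀ b (w : ι → V), (∀ i, w i ∈ W i b) → c * ‖w‖ ≤ ‖∑ i, w i‖ := by
    intro c hc h b w hw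
    rcases eq_or_ne w 0 with rfl | h0
    · simp
    have hn : 0 < ‖w‖ := norm_pos_iff.2 h0
    have h1 := h (b, ‖w‖⁻¹ • w) ⟨fun i => (W i b).smul_mem _ (hw i), by
      simp [norm_smul, hn.ne']⟩
    simp only [Pi.smul_apply, ← Finset.smul_sum, norm_smul, norm_inv, norm_norm] at h1
    rwa [inv_mul_eq_div, le_div_iff₀ hn] at h1
  rcases S.eq_empty_or_nonempty with he | hne
  · exact ⟨1, one_pos, key 1 one_pos (by simp [he])⟩
  · obtain ⟨q, hq, hmin⟩ := hSc.exists_isMinOn hne hcont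
    refine ⟨‖∑ i, q.2 i‖, norm_pos_iff.2 fun h0 => ?_, key _ ?_ fun q' hq' => hmin hq'⟩
    · have := hind q.1 q.2 hq.1 h0
      have h2 := hq.2
      simp [this] at h2
    · refine norm_pos_iff.2 fun h0 => ?_
      have := hind q.1 q.2 hq.1 h0
      have h2 := hq.2
      simp [this] at h2

/-- The projections of a splitting of a trivial bundle over a compact space into closed families
of subspaces are continuous. -/
theorem exists_continuous_projections (W : ι → B → Submodule ℝ V)
    (hW : ∀ i, IsClosed {q : B × V | q.2 ∈ W i q.1})
    (hind : ∀ b (w : ι → V), (∀ i, w i ∈ W i b) → ∑ i, w i = 0 → w = 0)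
    (hex : ∀ b (v : V), ∃ w : ι → V, (∀ i, w i ∈ W i b) ∧ ∑ i, w i = v) :
    ∃ P : ι → B → V →L[ℝ] V, (∀ i, Continuous (P i)) ∧ (∀ i b v, P i b v ∈ W i b) ∧
      ∀ b (w : ι → V), (∀ i, w i ∈ W i b) → ∀ i, P i b (∑ i, w i) = w i := by
  choose d hd hsum using hex
  have huniq : ∀ b v (w : ι → V), (∀ i, w i ∈ W i b) → ∑ i, w i = v → d b v = w := by
    intro b v w hw hv
    refine sub_eq_zero.1 (hind b (d b v - w) (fun i => (W i b).sub_mem (hd b v i) (hw i)) ?_)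
    simp [Finset.sum_sub_distrib, hsum, hv]
  let P : ι → B → V →L[ℝ] V := fun i b => LinearMap.toContinuousLinearMap
    { toFun := fun v => d b v i
      map_add' := fun v v' => by
        rw [huniq b (v + v') (d b v + d b v') (fun i => (W i b).add_mem (hd b v i) (hd b v' i))
          (by simp [Finset.sum_add_distrib, hsum])]
        rfl
      map_smul' := fun a v => by
        rw [huniq b (a • v) (a • d b v) (fun i => (W i b).smul_mem _ (hd b v i))
          (by simp [← Finset.smul_sum, hsum])]
        rfl }
  have hP : ∀ i b v, P i b v = d b v i := fun _ _ _ => rfl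
  refine ⟨P, fun i => ?_, fun i b v => hd b v i, fun b w hw i => ?_⟩
  · rw [continuous_clm_apply]
    intro v
    obtain ⟨c, hc, hle⟩ := exists_pos_le_norm_sum W hW hind
    -- The components of a fixed vector stay in a compact ball, their graph is closed and they are
    -- unique, so they depend continuously on the base point.
    have hb : ∀ b, d b v ∈ Metric.closedBall (0 : ι → V) (‖v‖ / c) := by
      intro b
      have := hle b (d b v) (hd b v)
      rw [hsum] at this
      rw [mem_closedBall_zero_iff, le_div_iff₀ hc, mul_comm]
      exact this
    have hG : IsClosed {q : B × (ι → V) | (∀ i, q.2 i ∈ W i q.1) ∧ ∑ i, q.2 i = v} := by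
      refine IsClosed.inter (s₁ := {q : B × (ι → V) | ∀ i, q.2 i ∈ W i q.1}) ?_
        (isClosed_eq (by fun_prop) continuous_const)
      simp only [ofPred_forall]
      refine isClosed_iInter fun i =>
        (hW i).preimage (f := fun q : B × (ι → V) => (q.1, q.2 i)) ?_
      fun_prop
    have hcont : Continuous (fun b => d b v) := by
      refine continuous_iff_continuousAt.2 fun b => ?_
      refine (isCompact_closedBall (0 : ι → V) (‖v‖ / c)).tendsto_nhds_of_unique_mapClusterPt
        (Eventually.of_forall hb) fun y _ hy => ?_
      have := mem_of_mapClusterPt hG tendsto_id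
        (Eventually.of_forall fun b' => ⟨hd b' v, hsum b' v⟩) hy
      exact (huniq b v y this.1 this.2).symm
    exact (continuous_apply i).comp hcont
  · rw [hP, huniq b _ w hw rfl]

end Projections

theorem exists_add_of_isInternal {T : Type*} [AddCommGroup T] [Module ℝ T]
    {A B C : Submodule ℝ T} (h : DirectSum.IsInternal ![A, B, C]) (x : T) :
    ∃ a ∈ A, ∃ b ∈ B, ∃ c ∈ C, x = a + b + c := by
  have h1 := h.submodule_iSup_eq_top
  have h2 : (⨆ i, ![A, B, C] i) = A ⊔ B ⊔ C := by
    refine le_antisymm (iSup_le fun i => ?_) (sup_le (sup_le ?_ ?_) ?_)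
    · fin_cases i
      · exact le_sup_of_le_left le_sup_left
      · exact le_sup_of_le_left le_sup_right
      · exact le_sup_right
    · exact le_iSup ![A, B, C] 0
    · exact le_iSup ![A, B, C] 1
    · exact le_iSup ![A, B, C] 2
  have hx : x ∈ A ⊔ B ⊔ C := by rw [← h2, h1]; trivial
  obtain ⟨y, hy, c, hc, rfl⟩ := Submodule.mem_sup.1 hx
  obtain ⟨a, ha, b, hb, rfl⟩ := Submodule.mem_sup.1 hy
  exact ⟨a, ha, b, hb, c, hc, rfl⟩

theorem eq_zero_of_isInternal {T : Type*} [AddCommGroup T] [Module ℝ T]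
    {A B C : Submodule ℝ T} (h : DirectSum.IsInternal ![A, B, C]) {a b c : T} (ha : a ∈ A)
    (hb : b ∈ B) (hc : c ∈ C) (h0 : a + b + c = 0) : a = 0 ∧ b = 0 ∧ c = 0 := by
  have h1 := (iSupIndep_iff_finsetSum_eq_zero_imp_eq_zero _).1 h.submodule_iSupIndep Finset.univ
    ![a, b, c] (fun i _ => by fin_cases i <;> assumption)
    (by simpa [Fin.sum_univ_three] using h0)
  exact ⟨h1 0 (Finset.mem_univ _), h1 1 (Finset.mem_univ _), h1 2 (Finset.mem_univ _)⟩

/-! ### Closed families of subspaces in `V` -/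

section ClosedFamilies

variable {n : ℕ} {N : Type*} [TopologicalSpace N] [ChartedSpace (EuclideanSpace ℝ (Fin n)) N]
  [IsManifold (𝓡 n) 1 N]
  {V : Type*} [NormedAddCommGroup V] [InnerProductSpace ℝ V] [FiniteDimensional ℝ V]

/-- Immersivity makes preimages of convergent image vectors converge in `TM`, and their limit stays
in the closed family. -/
theorem isClosed_map_vderiv {h : N → V} (hh : ContMDiff (𝓡 n) 𝓘(ℝ, V) 1 h) {Λ : Set N}
    (hi : ∀ θ : Λ, Function.Injective (vderiv n h (θ : N)))
    {E : ∀ θ : Λ, Submodule ℝ (TangentSpace (𝓡 n) (θ : N))}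
    (hE : IsClosed {v : TangentBundle (𝓡 n) N | ∃ hv : v.1 ∈ Λ, v.2 ∈ E ⟨v.1, hv⟩}) :
    IsClosed {q : Λ × V | q.2 ∈ (E q.1).map (vderiv n h (q.1 : N)).toLinearMap} := by
  rw [isClosed_iff_ultrafilter]
  rintro ⟨θ₀, X⟩ U hU hmem
  have hex : ∀ q : Λ × V, ∃ ξ : TangentSpace (𝓡 n) (q.1 : N),
      q.2 ∈ (E q.1).map (vderiv n h (q.1 : N)).toLinearMap →
        ξ ∈ E q.1 ∧ vderiv n h (q.1 : N) ξ = q.2 := by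
    intro q
    by_cases hq : q.2 ∈ (E q.1).map (vderiv n h (q.1 : N)).toLinearMap
    · obtain ⟨ξ, h1, h2⟩ := hq
      exact ⟨ξ, fun _ => ⟨h1, h2⟩⟩
    · exact ⟨0, fun h => (hq h).elim⟩
  choose ξ hξ using hex
  have h1 : Tendsto (fun q : Λ × V => (q.1 : N)) U (𝓝 (θ₀ : N)) :=
    (continuous_subtype_val.comp continuous_fst).continuousAt.mono_left hU
  have h2 : Tendsto (fun q : Λ × V => q.2) U (𝓝 X) := continuous_snd.continuousAt.mono_left hU
  have h3 : Tendsto (fun q : Λ × V => vderiv n h (q.1 : N) (ξ q)) U (𝓝 X) := by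
    refine h2.congr' ?_
    filter_upwards [hmem] with q hq using ((hξ q hq).2).symm
  obtain ⟨ξ₀, h4⟩ := tendsto_mk_of_tendsto_vderiv hh (hi θ₀) h1 ξ h3
  have h5 := hE.mem_of_tendsto h4 (by
    filter_upwards [hmem] with q hq
    exact ⟨q.1.2, (hξ q hq).1⟩)
  have h6 := ((continuous_vderiv hh).tendsto _).comp h4
  exact ⟨ξ₀, h5.2, tendsto_nhds_unique h6 h3⟩

/-- Each tangent vector at the limit extends to a family of tangent vectors continuous at that
point, against which orthogonality passes to the limit. -/
theorem isClosed_orthogonal_vderiv {h : N → V} (hh : ContMDiff (𝓡 n) 𝓘(ℝ, V) 1 h) :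
    IsClosed {q : N × V | ∀ ξ, inner ℝ q.2 (vderiv n h q.1 ξ) = 0} := by
  rw [isClosed_iff_ultrafilter]
  rintro ⟨p, X⟩ U hU hmem ξ
  obtain ⟨x, rfl⟩ := exists_localExtend_eq p p (FiberBundle.mem_baseSet_trivializationAt' p) ξ
  have h1 : Tendsto (fun q : N × V => q.1) U (𝓝 p) := continuous_fst.continuousAt.mono_left hU
  have h2 : Tendsto (fun q : N × V => q.2) U (𝓝 X) := continuous_snd.continuousAt.mono_left hU
  have h3 : Tendsto (fun q : N × V => vderiv n h q.1 (localExtend n p x q.1)) U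
      (𝓝 (vderiv n h p (localExtend n p x p))) :=
    ((continuous_vderiv hh).tendsto _).comp ((continuousAt_localExtend p x).tendsto.comp h1)
  refine tendsto_nhds_unique (h2.inner h3) (tendsto_const_nhds.congr' ?_)
  filter_upwards [hmem] with q hq using (hq _).symm

end ClosedFamilies

/-! ### Projections adapted to the splitting along `Λ` -/

section Adapted

variable {m c : ℕ} {M : Type*} [TopologicalSpace M] [ChartedSpace (EuclideanSpace ℝ (Fin m)) M]
  {Λ : Set M} [ChartedSpace (EuclideanSpace ℝ (Fin c)) Λ]
  {V : Type*} [NormedAddCommGroup V] [InnerProductSpace ℝ V]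

theorem vderiv_comp_val {j : M → V} (hj : MDifferentiable (𝓡 m) 𝓘(ℝ, V) j)
    (hv : MDifferentiable (𝓡 c) (𝓡 m) (Subtype.val : Λ → M)) (θ : Λ)
    (ξ : TangentSpace (𝓡 c) θ) :
    vderiv c (fun θ : Λ => j θ) θ ξ =
      vderiv m j (θ : M) (mfderiv (𝓡 c) (𝓡 m) (Subtype.val : Λ → M) θ ξ) :=
  congrArg (fun T => T ξ) (mfderiv_comp θ (hj (θ : M)) (hv θ))

/-- For a map `j : M → V` immersive along `Λ`: `Pu θ`, `Ps θ` are continuous families of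
projections onto the images of `Eu θ`, `Es θ` along those of the other summands of
`T_θ M = T_θ Λ ⊕ Eu θ ⊕ Es θ`, and `Oc θ` is the orthogonal projection onto the image
of `T_θ Λ`. -/
structure AdaptedProjections (c : ℕ) [ChartedSpace (EuclideanSpace ℝ (Fin c)) Λ] (j : M → V)
    (Eu Es : ∀ θ : Λ, Submodule ℝ (TangentSpace (𝓡 m) (θ : M)))
    (Pu Ps Oc : Λ → V →L[ℝ] V) : Prop where
  injective : ∀ θ : Λ, Function.Injective (vderiv m j (θ : M))
  splitting : ∀ θ, DirectSum.IsInternal ![tangentAlong c Λ θ, Eu θ, Es θ]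
  continuous_u : Continuous Pu
  continuous_s : Continuous Ps
  continuous_c : Continuous Oc
  u_mem : ∀ θ v, ∃ x ∈ Eu θ, vderiv m j (θ : M) x = Pu θ v
  s_mem : ∀ θ v, ∃ y ∈ Es θ, vderiv m j (θ : M) y = Ps θ v
  c_mem : ∀ θ v, ∃ w ∈ tangentAlong (m := m) c Λ θ, vderiv m j (θ : M) w = Oc θ v
  u_apply : ∀ θ, ∀ w ∈ tangentAlong (m := m) c Λ θ, ∀ x ∈ Eu θ, ∀ y ∈ Es θ,
    Pu θ (vderiv m j (θ : M) (w + x + y)) = vderiv m j (θ : M) x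
  s_apply : ∀ θ, ∀ w ∈ tangentAlong (m := m) c Λ θ, ∀ x ∈ Eu θ, ∀ y ∈ Es θ,
    Ps θ (vderiv m j (θ : M) (w + x + y)) = vderiv m j (θ : M) y
  c_apply : ∀ θ, ∀ w ∈ tangentAlong (m := m) c Λ θ,
    Oc θ (vderiv m j (θ : M) w) = vderiv m j (θ : M) w
  c_eq_zero_iff : ∀ θ v, Oc θ v = 0 ↔
    ∀ w ∈ tangentAlong (m := m) c Λ θ, inner ℝ v (vderiv m j (θ : M) w) = 0

theorem AdaptedProjections.c_eq_zero_iff_vderiv {j : M → V}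
    {Eu Es : ∀ θ : Λ, Submodule ℝ (TangentSpace (𝓡 m) (θ : M))} {Pu Ps Oc : Λ → V →L[ℝ] V}
    (hP : AdaptedProjections c j Eu Es Pu Ps Oc)
    (hj : MDifferentiable (𝓡 m) 𝓘(ℝ, V) j)
    (hv : MDifferentiable (𝓡 c) (𝓡 m) (Subtype.val : Λ → M)) (θ : Λ) (z : V) :
    Oc θ z = 0 ↔ ∀ ξ, inner ℝ z (vderiv c (fun θ : Λ => j θ) θ ξ) = 0 := by
  rw [hP.c_eq_zero_iff]
  simp only [tangentAlong, LinearMap.mem_range, forall_exists_index, forall_apply_eq_imp_iff]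
  refine forall_congr' fun ξ => ?_
  rw [vderiv_comp_val hj hv]
  rfl

variable [FiniteDimensional ℝ V] [IsManifold (𝓡 m) 1 M] [IsManifold (𝓡 c) 1 Λ] [CompactSpace Λ]

/-- Adding the orthogonal complement of the image of `TM` turns the invariant splitting into a
splitting of `V` into four closed families, whose projections are continuous and provide `Pu` and
`Ps`. The map `Oc` comes from a different splitting, the image of `TΛ` and its orthogonal
complement, because its kernel has to be the critical-point condition for the distance to `Λ`. -/
theorem exists_adaptedProjections {j : M → V} (hj : ContMDiff (𝓡 m) 𝓘(ℝ, V) 1 j)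
    (hi : ∀ θ : Λ, Function.Injective (vderiv m j (θ : M)))
    (hv : ContMDiff (𝓡 c) (𝓡 m) 1 (Subtype.val : Λ → M))
    {Eu Es : ∀ θ : Λ, Submodule ℝ (TangentSpace (𝓡 m) (θ : M))}
    (hs : ∀ θ, DirectSum.IsInternal ![tangentAlong c Λ θ, Eu θ, Es θ])
    (hCc : IsClosed {v : TangentBundle (𝓡 m) M | ∃ hv : v.1 ∈ Λ, v.2 ∈ tangentAlong c Λ ⟨v.1, hv⟩})
    (hEu : IsClosed {v : TangentBundle (𝓡 m) M | ∃ hv : v.1 ∈ Λ, v.2 ∈ Eu ⟨v.1, hv⟩})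
    (hEs : IsClosed {v : TangentBundle (𝓡 m) M | ∃ hv : v.1 ∈ Λ, v.2 ∈ Es ⟨v.1, hv⟩}) :
    ∃ Pu Ps Oc : Λ → V →L[ℝ] V, AdaptedProjections c j Eu Es Pu Ps Oc := by
  set C : Λ → Submodule ℝ V := fun θ => (tangentAlong c Λ θ).map (vderiv m j (θ : M)).toLinearMap
  set A : Λ → Submodule ℝ V := fun θ => (Eu θ).map (vderiv m j (θ : M)).toLinearMap
  set B : Λ → Submodule ℝ V := fun θ => (Es θ).map (vderiv m j (θ : M)).toLinearMap
  set T : Λ → Submodule ℝ V := fun θ => LinearMap.range (vderiv m j (θ : M)).toLinearMap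
  have hC := isClosed_map_vderiv hj hi hCc
  have hA := isClosed_map_vderiv hj hi hEu
  have hB := isClosed_map_vderiv hj hi hEs
  have hTo : IsClosed {q : Λ × V | q.2 ∈ (T q.1)ᗮ} := by
    have h1 := (isClosed_orthogonal_vderiv hj).preimage
      (f := fun q : Λ × V => ((q.1 : M), q.2)) (by fun_prop)
    convert h1 using 1
    ext q
    simp only [Submodule.mem_orthogonal', T, LinearMap.mem_range, forall_exists_index,
      forall_apply_eq_imp_iff, mem_preimage]
    rfl
  have hCo : IsClosed {q : Λ × V | q.2 ∈ (C q.1)ᗮ} := by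
    have h1 := isClosed_orthogonal_vderiv (n := c) (h := fun θ : Λ => j θ) (hj.comp hv)
    convert h1 using 1
    ext q
    simp only [Submodule.mem_orthogonal', C, Submodule.mem_map, tangentAlong,
      LinearMap.mem_range, forall_exists_index, and_imp, forall_apply_eq_imp_iff]
    refine forall_congr' fun ξ => ?_
    rw [vderiv_comp_val (hj.mdifferentiable (by simp)) (hv.mdifferentiable (by simp))]
    rfl
  obtain ⟨P, hPc, hPm, hPa⟩ := exists_continuous_projections
    (![C, A, B, fun θ => (T θ)ᗮ] : Fin 4 → Λ → Submodule ℝ V)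
    (fun i => by fin_cases i; exacts [hC, hA, hB, hTo])
    (by
      intro θ w hw h0
      rw [Fin.sum_univ_four] at h0
      obtain ⟨a, ha, ha'⟩ : w 0 ∈ C θ := hw 0
      obtain ⟨x, hx, hx'⟩ : w 1 ∈ A θ := hw 1
      obtain ⟨y, hy, hy'⟩ : w 2 ∈ B θ := hw 2
      have h3 : w 3 ∈ (T θ)ᗮ := hw 3
      have hsum : w 0 + w 1 + w 2 = vderiv m j (θ : M) (a + x + y) := by
        rw [map_add, map_add]; exact congrArg₂ _ (congrArg₂ _ ha'.symm hx'.symm) hy'.symm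
      have h4 : w 3 = 0 := by
        have : w 3 ∈ T θ := by
          have h5 : w 3 = -(w 0 + w 1 + w 2) := by rw [eq_neg_iff_add_eq_zero, ← h0]; abel
          rw [h5, hsum]
          exact (T θ).neg_mem ⟨_, rfl⟩
        exact Submodule.disjoint_def.1 (Submodule.orthogonal_disjoint _) _ this h3
      rw [hsum, h4, add_zero] at h0
      obtain ⟨r0, r1, r2⟩ := eq_zero_of_isInternal (hs θ) ha hx hy
        (hi θ (h0.trans (map_zero _).symm))
      ext1 i
      fin_cases i
      · change w 0 = 0
        rw [← ha', r0]; exact map_zero _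
      · change w 1 = 0
        rw [← hx', r1]; exact map_zero _
      · change w 2 = 0
        rw [← hy', r2]; exact map_zero _
      · exact h4)
    (by
      intro θ v
      obtain ⟨t, ⟨ξ, hξ⟩, o, ho, rfl⟩ := (T θ).exists_add_mem_mem_orthogonal v
      obtain ⟨a, ha, x, hx, y, hy, rfl⟩ := exists_add_of_isInternal (hs θ) ξ
      refine ⟨![vderiv m j (θ : M) a, vderiv m j (θ : M) x, vderiv m j (θ : M) y, o], ?_, ?_⟩
      · intro i
        fin_cases i
        exacts [⟨a, ha, rfl⟩, ⟨x, hx, rfl⟩, ⟨y, hy, rfl⟩, ho]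
      · rw [Fin.sum_univ_four, ← hξ]
        change _ = vderiv m j (θ : M) (a + x + y) + o
        rw [map_add, map_add]
        rfl)
  obtain ⟨Q, hQc, hQm, hQa⟩ := exists_continuous_projections
    (![C, fun θ => (C θ)ᗮ] : Fin 2 → Λ → Submodule ℝ V)
    (fun i => by fin_cases i; exacts [hC, hCo])
    (by
      intro θ w hw h0
      rw [Fin.sum_univ_two] at h0
      have h1 : w 0 ∈ C θ := hw 0
      have h2 : w 1 ∈ (C θ)ᗮ := hw 1
      have h3 : w 0 = -w 1 := eq_neg_of_add_eq_zero_left h0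
      have h4 : w 0 = 0 := Submodule.disjoint_def.1 (Submodule.orthogonal_disjoint _) _ h1
        (by rw [h3]; exact Submodule.neg_mem _ h2)
      have h5 : w 1 = 0 := by rw [h4, zero_add] at h0; exact h0
      ext1 i
      fin_cases i
      exacts [h4, h5])
    (by
      intro θ v
      obtain ⟨t, ht, o, ho, rfl⟩ := (C θ).exists_add_mem_mem_orthogonal v
      refine ⟨![t, o], ?_, by simp⟩
      intro i
      fin_cases i
      exacts [ht, ho])
  have hPa' : ∀ θ, ∀ w ∈ tangentAlong (m := m) c Λ θ, ∀ x ∈ Eu θ, ∀ y ∈ Es θ, ∀ i,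
      P i θ (vderiv m j (θ : M) (w + x + y)) =
        (![vderiv m j (θ : M) w, vderiv m j (θ : M) x, vderiv m j (θ : M) y, 0] : Fin 4 → V) i := by
    intro θ w hw x hx y hy i
    rw [← hPa θ ![vderiv m j (θ : M) w, vderiv m j (θ : M) x, vderiv m j (θ : M) y, 0] ?_ i]
    · congr 1
      rw [Fin.sum_univ_four, map_add, map_add]
      simp
    · intro i
      fin_cases i
      exacts [⟨w, hw, rfl⟩, ⟨x, hx, rfl⟩, ⟨y, hy, rfl⟩, Submodule.zero_mem _]
  have hQ0 : ∀ θ, ∀ v ∈ C θ, Q 0 θ v = v := by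
    intro θ v hv
    have := hQa θ ![v, 0] (fun i => by fin_cases i; exacts [hv, Submodule.zero_mem _]) 0
    simpa using this
  have hQo : ∀ θ, ∀ v ∈ (C θ)ᗮ, Q 0 θ v = 0 := by
    intro θ v hv
    have := hQa θ ![0, v] (fun i => by fin_cases i; exacts [Submodule.zero_mem _, hv]) 0
    simpa using this
  refine ⟨P 1, P 2, Q 0, hi, hs, hPc 1, hPc 2, hQc 0, fun θ v => hPm 1 θ v, fun θ v => hPm 2 θ v,
    fun θ v => hQm 0 θ v, fun θ w hw x hx y hy => hPa' θ w hw x hx y hy 1,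
    fun θ w hw x hx y hy => hPa' θ w hw x hx y hy 2, fun θ w hw => hQ0 θ _ ⟨w, hw, rfl⟩,
    fun θ v => ?_⟩
  have hiff : (∀ w ∈ tangentAlong (m := m) c Λ θ, inner ℝ v (vderiv m j (θ : M) w) = 0) ↔
      v ∈ (C θ)ᗮ := by
    simp only [Submodule.mem_orthogonal', C, Submodule.mem_map, forall_exists_index, and_imp,
      forall_apply_eq_imp_iff₂]
    rfl
  rw [hiff]
  refine ⟨fun h0 => ?_, hQo θ v⟩
  obtain ⟨t, ht, o, ho, rfl⟩ := (C θ).exists_add_mem_mem_orthogonal v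
  rw [map_add, hQ0 θ t ht, hQo θ o ho, add_zero] at h0
  rwa [h0, zero_add]

end Adapted

/-! ### Nearest points on `Λ` -/

section Nearest

variable {c : ℕ} {M : Type*} [TopologicalSpace M]
  {Λ : Set M} [ChartedSpace (EuclideanSpace ℝ (Fin c)) Λ]
  {V : Type*} [NormedAddCommGroup V] [InnerProductSpace ℝ V]

/-- `j θ` is a point of `j '' Λ` nearest to `j p`. -/
def IsNearest (j : M → V) (Λ : Set M) (p : M) (θ : Λ) : Prop :=
  ∀ θ' : Λ, ‖j p - j θ‖ ≤ ‖j p - j θ'‖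

theorem exists_isNearest [CompactSpace Λ] [Nonempty Λ] {j : M → V}
    (hj : Continuous (fun θ : Λ => j θ)) (p : M) : ∃ θ, IsNearest j Λ p θ := by
  obtain ⟨θ, -, hθ⟩ := (isCompact_univ (X := Λ)).exists_isMinOn univ_nonempty
    (f := fun θ : Λ => ‖j p - j θ‖) (continuous_const.sub hj).norm.continuousOn
  exact ⟨θ, fun θ' => hθ (mem_univ θ')⟩

theorem IsNearest.norm_sub_le {j : M → V} {p : M} {θ : Λ} (h : IsNearest j Λ p θ) (θ' : Λ) :
    ‖j θ' - j θ‖ ≤ 2 * ‖j p - j θ'‖ := by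
  have h1 := h θ'
  calc ‖j θ' - j θ‖ = ‖(j p - j θ) - (j p - j θ')‖ := by congr 1; abel
    _ ≤ ‖j p - j θ‖ + ‖j p - j θ'‖ := _root_.norm_sub_le _ _
    _ ≤ _ := by linarith

theorem IsNearest.eq_of_mem {j : M → V} (hinj : InjOn j Λ) {θ₀ θ : Λ}
    (h : IsNearest j Λ θ₀ θ) : θ = θ₀ := by
  have h1 := h θ₀
  rw [sub_self, norm_zero, norm_le_zero_iff, sub_eq_zero] at h1
  exact (Subtype.ext (hinj θ₀.2 θ.2 h1)).symm

/-- This is the vanishing of the first derivative of the squared distance at its minimum, computed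
in a chart of `Λ`. -/
theorem IsNearest.inner_eq_zero [IsManifold (𝓡 c) 1 Λ] {j : M → V}
    (hj : ContMDiff (𝓡 c) 𝓘(ℝ, V) 1 (fun θ : Λ => j θ)) {p : M} {θ : Λ}
    (h : IsNearest j Λ p θ) (ξ : TangentSpace (𝓡 c) θ) :
    inner ℝ (j p - j θ) (vderiv c (fun θ : Λ => j θ) θ ξ) = 0 := by
  set φ := extChartAt (𝓡 c) θ
  set γ : EuclideanSpace ℝ (Fin c) → V := (fun θ : Λ => j θ) ∘ φ.symm
  have h1 := (hasStrictFDerivAt_chart (hj.contMDiffAt (x := θ))).hasFDerivAt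
  have h2 := (h1.const_sub (j p)).norm_sq
  have hγ : γ (φ θ) = j θ := congrArg (fun θ : Λ => j θ) (extChartAt_to_inv (I := 𝓡 c) θ)
  have h3 : IsLocalMin (fun x => ‖j p - γ x‖ ^ 2) (φ θ) := by
    refine Eventually.of_forall fun x => ?_
    simp only [hγ]
    gcongr
    exact h _
  have h4 := h3.hasFDerivAt_eq_zero h2
  have h5 := congrArg (fun T : EuclideanSpace ℝ (Fin c) →L[ℝ] ℝ => T ξ) h4
  have h6 : (2 : ℕ) • inner ℝ (j p - γ (φ θ)) (-(vderiv c (fun θ : Λ => j θ) θ ξ)) = 0 := h5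
  rw [hγ, inner_neg_right, two_smul] at h6
  linarith

theorem isEmbedding_restrict [CompactSpace Λ] {j : M → V}
    (hj : Continuous (fun θ : Λ => j θ)) (hinj : InjOn j Λ) :
    IsEmbedding (fun θ : Λ => j θ) :=
  (hj.isClosedEmbedding fun _ _ h => Subtype.ext (hinj (Subtype.prop _) (Subtype.prop _) h)).isEmbedding

/-- Critical points of the distance to `j '' Λ` are locally unique. -/
theorem eventually_eq_of_inner_eq_zero [IsManifold (𝓡 c) 2 Λ] {j : M → V} (hjc : Continuous j)
    (hj : ContMDiff (𝓡 c) 𝓘(ℝ, V) 2 (fun θ : Λ => j θ)) (hinj : InjOn j Λ) {θ₀ : Λ}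
    (hi : Function.Injective (vderiv c (fun θ : Λ => j θ) θ₀)) :
    ∀ᶠ q : M × Λ × Λ in 𝓝 ((θ₀ : M), θ₀, θ₀),
      (∀ ξ, inner ℝ (j q.1 - j q.2.1) (vderiv c (fun θ : Λ => j θ) q.2.1 ξ) = 0) →
      (∀ ξ, inner ℝ (j q.1 - j q.2.2) (vderiv c (fun θ : Λ => j θ) q.2.2 ξ) = 0) →
      q.2.1 = q.2.2 := by
  obtain ⟨K, hK0, hK⟩ := exists_abs_inner_sub_le hj hi
  have t1 : Tendsto (fun q : M × Λ × Λ => q.2) (𝓝 ((θ₀ : M), θ₀, θ₀)) (𝓝 (θ₀, θ₀)) :=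
    continuous_snd.continuousAt
  have t2 : Tendsto (fun q : M × Λ × Λ => (q.2.2, q.2.1)) (𝓝 ((θ₀ : M), θ₀, θ₀))
      (𝓝 (θ₀, θ₀)) :=
    (by fun_prop : Continuous (fun q : M × Λ × Λ => (q.2.2, q.2.1))).continuousAt
  have t3 : ∀ᶠ q : M × Λ × Λ in 𝓝 ((θ₀ : M), θ₀, θ₀),
      K * (‖j q.1 - j q.2.1‖ + ‖j q.1 - j q.2.2‖) < 1 := by
    have hc : Continuous (fun q : M × Λ × Λ => K * (‖j q.1 - j q.2.1‖ + ‖j q.1 - j q.2.2‖)) := by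
      fun_prop
    refine hc.continuousAt.eventually_lt continuousAt_const ?_
    simp
  filter_upwards [t1 hK, t2 hK, t3] with q h1 h2 h3 hq1 hq2
  have h4 := h1 _ hq1
  have h5 := h2 _ hq2
  simp only at h4 h5
  set a := j q.2.2 - j q.2.1 with ha
  have ha' : j q.2.1 - j q.2.2 = -a := by rw [ha]; abel
  rw [ha', inner_neg_right, abs_neg, norm_neg] at h5
  -- The two critical displacements differ by `a`, so `‖a‖ ^ 2` is a difference of two inner
  -- products, each at most a small multiple of `‖a‖ ^ 2` by quadratic contact.
  have h6 : ‖a‖ ^ 2 = inner ℝ (j q.1 - j q.2.1) a - inner ℝ (j q.1 - j q.2.2) a := by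
    rw [← inner_sub_left, ← real_inner_self_eq_norm_sq]
    congr 1
    rw [ha]; abel
  have h7 : ‖a‖ ^ 2 ≤ K * (‖j q.1 - j q.2.1‖ + ‖j q.1 - j q.2.2‖) * ‖a‖ ^ 2 := by
    have := (abs_le.1 h4).2
    have := (abs_le.1 h5).1
    nlinarith
  have h8 : ‖a‖ ^ 2 = 0 := by nlinarith [sq_nonneg ‖a‖]
  have h9 : a = 0 := by simpa using h8
  exact Subtype.ext (hinj q.2.1.2 q.2.2.2 (sub_eq_zero.1 h9).symm)

/-- The image of a nearest point is within twice the distance from `j p` to `j θ₀`, and on the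
compact set `Λ` the injective continuous map `j` is an embedding. -/
theorem tendsto_of_isNearest [CompactSpace Λ] {j : M → V} (hjc : Continuous j)
    (hinj : InjOn j Λ) (θ₀ : Λ) {α : Type*} {l : Filter α} {p : α → M} {θ : α → Λ}
    (hp : Tendsto p l (𝓝 (θ₀ : M))) (h : ∀ a, IsNearest j Λ (p a) (θ a)) :
    Tendsto θ l (𝓝 θ₀) := by
  rw [(isEmbedding_restrict (hjc.comp continuous_subtype_val) hinj).tendsto_nhds_iff,
    tendsto_iff_norm_sub_tendsto_zero]
  have h1 : Tendsto (fun a => 2 * ‖j (p a) - j θ₀‖) l (𝓝 0) := by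
    have := (((hjc.tendsto _).comp hp).sub_const (j θ₀)).norm.const_mul 2
    simpa using this
  refine squeeze_zero (fun _ => norm_nonneg _) (fun a => ?_) h1
  rw [Function.comp_apply, norm_sub_rev]
  exact (h a).norm_sub_le θ₀

theorem eventually_forall_isNearest [CompactSpace Λ] {j : M → V} (hjc : Continuous j)
    (hinj : InjOn j Λ) (θ₀ : Λ) {s : Set Λ} (hs : s ∈ 𝓝 θ₀) :
    ∀ᶠ p in 𝓝 (θ₀ : M), ∀ θ, IsNearest j Λ p θ → θ ∈ s := by
  have h1 : Tendsto (fun q : {q : M × Λ // IsNearest j Λ q.1 q.2} => q.1.2)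
      (comap (fun q : {q : M × Λ // IsNearest j Λ q.1 q.2} => q.1.1) (𝓝 (θ₀ : M))) (𝓝 θ₀) :=
    tendsto_of_isNearest hjc hinj θ₀ tendsto_comap fun q => q.2
  have h2 := h1 hs
  rw [mem_map, mem_comap] at h2
  obtain ⟨t, ht, hts⟩ := h2
  filter_upwards [ht] with p hp θ hθ
  exact hts (a := (⟨(p, θ), hθ⟩ : {q : M × Λ // IsNearest j Λ q.1 q.2})) hp

/-- Nearest points are critical and lie close to `θ₀`, where critical points are unique. This
recognizes a critical point found by other means as the nearest one. -/
theorem eventually_eq_of_isNearest [CompactSpace Λ] [IsManifold (𝓡 c) 2 Λ] {j : M → V}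
    (hjc : Continuous j)
    (hj : ContMDiff (𝓡 c) 𝓘(ℝ, V) 2 (fun θ : Λ => j θ)) (hinj : InjOn j Λ) {θ₀ : Λ}
    (hi : Function.Injective (vderiv c (fun θ : Λ => j θ) θ₀)) :
    ∀ᶠ q : M × Λ in 𝓝 ((θ₀ : M), θ₀), ∀ θ, IsNearest j Λ q.1 θ →
      (∀ ξ, inner ℝ (j q.1 - j q.2) (vderiv c (fun θ : Λ => j θ) q.2 ξ) = 0) → θ = q.2 := by
  have : IsManifold (𝓡 c) 1 Λ := IsManifold.of_le (n := 2) (by norm_num)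
  have hj1 : ContMDiff (𝓡 c) 𝓘(ℝ, V) 1 (fun θ : Λ => j θ) := hj.of_le (by norm_num)
  have h1 := eventually_eq_of_inner_eq_zero hjc hj hinj hi
  rw [nhds_prod_eq, nhds_prod_eq] at h1
  obtain ⟨s, hs, t, ht, hst⟩ := mem_prod_iff.1 h1
  obtain ⟨t1, ht1, t2, ht2, htt⟩ := mem_prod_iff.1 ht
  have h3 := eventually_forall_isNearest hjc hinj θ₀ ht1
  filter_upwards [prod_mem_nhds (inter_mem hs h3) ht2] with q hq θ hθ hc
  exact @hst (q.1, θ, q.2) ⟨hq.1.1, htt ⟨hq.1.2 θ hθ, hq.2⟩⟩ (hθ.inner_eq_zero hj1) hc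

/-- Being nearest is a closed condition and `Λ` is compact, so uniqueness near `Λ` forces continuity
of any choice of nearest point. -/
theorem eventually_continuousAt_of_isNearest [CompactSpace Λ] [IsManifold (𝓡 c) 2 Λ]
    {j : M → V} (hjc : Continuous j)
    (hj : ContMDiff (𝓡 c) 𝓘(ℝ, V) 2 (fun θ : Λ => j θ)) (hinj : InjOn j Λ) {θ₀ : Λ}
    (hi : Function.Injective (vderiv c (fun θ : Λ => j θ) θ₀)) {r : M → Λ}
    (hr : ∀ p, IsNearest j Λ p (r p)) : ∀ᶠ p in 𝓝 (θ₀ : M), ContinuousAt r p := by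
  have : IsManifold (𝓡 c) 1 Λ := IsManifold.of_le (n := 2) (by norm_num)
  have hj1 : ContMDiff (𝓡 c) 𝓘(ℝ, V) 1 (fun θ : Λ => j θ) := hj.of_le (by norm_num)
  have h1 := eventually_eq_of_isNearest hjc hj hinj hi
  rw [nhds_prod_eq] at h1
  obtain ⟨s, hs, t, ht, hst⟩ := mem_prod_iff.1 h1
  have h3 := eventually_forall_isNearest hjc hinj θ₀ ht
  filter_upwards [hs, h3] with p hp hpt
  refine le_nhds_of_unique_clusterPt fun θ hθ => ?_
  have hG : IsClosed {q : M × Λ | ∀ θ' : Λ, ‖j q.1 - j q.2‖ ≤ ‖j q.1 - j θ'‖} := by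
    simp only [ofPred_forall]
    exact isClosed_iInter fun θ' => isClosed_le (by fun_prop) (by fun_prop)
  have h4 : IsNearest j Λ p θ :=
    mem_of_mapClusterPt hG tendsto_id (Eventually.of_forall fun p' => hr p') hθ
  exact (@hst (p, θ) ⟨hp, hpt θ h4⟩ (r p) (hr p) (h4.inner_eq_zero hj1)).symm

end Nearest

/-! ### Coordinates on the Whitney sum -/

section WhitneyCoordinates

variable {m : ℕ} {M : Type*} [TopologicalSpace M] [ChartedSpace (EuclideanSpace ℝ (Fin m)) M]
  {Λ : Set M} {V : Type*} [NormedAddCommGroup V] [NormedSpace ℝ V]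

/-- The total space of the Whitney sum of two families of subspaces of the tangent spaces. -/
abbrev WhitneySum (u s : ℕ) (Eu Es : ∀ θ : Λ, Submodule ℝ (TangentSpace (𝓡 m) (θ : M))) : Type _ :=
  TotalSpace (EuclideanSpace ℝ (Fin u) × EuclideanSpace ℝ (Fin s)) (SubFiber Eu ×ᵇ SubFiber Es)

/-- The map of the Whitney sum into `Λ × V × V` induced by a map `j : M → V`. -/
def whitneyCoord (j : M → V) {u s : ℕ}
    {Eu Es : ∀ θ : Λ, Submodule ℝ (TangentSpace (𝓡 m) (θ : M))} (v : WhitneySum u s Eu Es) :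
    Λ × V × V :=
  (v.1, vderiv m j (v.1 : M) (v.2.1 : TangentSpace (𝓡 m) (v.1 : M)),
    vderiv m j (v.1 : M) (v.2.2 : TangentSpace (𝓡 m) (v.1 : M)))

/-- The two components of a point of the Whitney sum. -/
def whitneyPair {u s : ℕ} {Eu Es : ∀ θ : Λ, Submodule ℝ (TangentSpace (𝓡 m) (θ : M))}
    (v : WhitneySum u s Eu Es) : TangentBundle (𝓡 m) M × TangentBundle (𝓡 m) M :=
  (⟨(v.1 : M), (v.2.1 : TangentSpace (𝓡 m) (v.1 : M))⟩,
    ⟨(v.1 : M), (v.2.2 : TangentSpace (𝓡 m) (v.1 : M))⟩)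

variable {u s : ℕ} {Eu Es : ∀ θ : Λ, Submodule ℝ (TangentSpace (𝓡 m) (θ : M))}

theorem isInducing_whitneyPair [IsManifold (𝓡 m) 1 M] :
    IsInducing (whitneyPair : WhitneySum u s Eu Es → _) := by
  have h1 := FiberBundle.Prod.isInducing_diag (EuclideanSpace ℝ (Fin u)) (SubFiber Eu)
    (EuclideanSpace ℝ (Fin s)) (SubFiber Es)
  have h2 : IsInducing (fun v : TotalSpace (EuclideanSpace ℝ (Fin u)) (SubFiber Eu) =>
      (⟨(v.1 : M), (v.2 : TangentSpace (𝓡 m) (v.1 : M))⟩ : TangentBundle (𝓡 m) M)) := ⟨rfl⟩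
  have h3 : IsInducing (fun v : TotalSpace (EuclideanSpace ℝ (Fin s)) (SubFiber Es) =>
      (⟨(v.1 : M), (v.2 : TangentSpace (𝓡 m) (v.1 : M))⟩ : TangentBundle (𝓡 m) M)) := ⟨rfl⟩
  exact (h2.prodMap h3).comp h1

theorem whitneyCoord_injective {j : M → V}
    (hi : ∀ θ : Λ, Function.Injective (vderiv m j (θ : M))) :
    Function.Injective (whitneyCoord j : WhitneySum u s Eu Es → _) := by
  rintro ⟨θ, x, y⟩ ⟨θ', x', y'⟩ h
  obtain rfl : θ = θ' := congrArg Prod.fst h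
  have h3 : (x : TangentSpace (𝓡 m) (θ : M)) = x' := hi θ (congrArg (fun z => z.2.1) h)
  have h4 : (y : TangentSpace (𝓡 m) (θ : M)) = y' := hi θ (congrArg (fun z => z.2.2) h)
  rw [Subtype.ext h3, Subtype.ext h4]

variable [IsManifold (𝓡 m) 1 M] [FiniteDimensional ℝ V]

theorem continuous_proj_whitneySum : Continuous (fun v : WhitneySum u s Eu Es => v.1) := by
  rw [continuous_induced_rng]
  exact (FiberBundle.continuous_proj (EuclideanSpace ℝ (Fin m))
    (TangentSpace (𝓡 m) : M → Type _)).comp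
    (continuous_fst.comp (isInducing_whitneyPair (Eu := Eu) (Es := Es)).continuous)

/-- Convergence of the images in `V` lifts to convergence in `TM` by immersivity, so all topological
questions on the Whitney sum can be settled in `Λ × V × V`. -/
theorem isInducing_whitneyCoord {j : M → V} (hj : ContMDiff (𝓡 m) 𝓘(ℝ, V) 1 j)
    (hi : ∀ θ : Λ, Function.Injective (vderiv m j (θ : M))) :
    IsInducing (whitneyCoord j : WhitneySum u s Eu Es → _) := by
  have hc : Continuous (whitneyCoord j : WhitneySum u s Eu Es → _) := by
    refine continuous_proj_whitneySum.prodMk (Continuous.prodMk ?_ ?_)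
    · exact (continuous_vderiv hj).comp (continuous_fst.comp isInducing_whitneyPair.continuous)
    · exact (continuous_vderiv hj).comp (continuous_snd.comp isInducing_whitneyPair.continuous)
  refine isInducing_iff_nhds.2 fun v => le_antisymm (hc.tendsto v).le_comap ?_
  set l : Filter (WhitneySum u s Eu Es) := comap (whitneyCoord j) (𝓝 (whitneyCoord j v))
  have hl : Tendsto (whitneyCoord j : WhitneySum u s Eu Es → _) l
      (𝓝 (whitneyCoord j v)) := tendsto_comap
  suffices Tendsto id l (𝓝 v) from this
  have h0 : Tendsto (fun a : WhitneySum u s Eu Es => (a.1 : M)) l (𝓝 (v.1 : M)) :=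
    (continuous_subtype_val.tendsto _).comp ((continuous_fst.tendsto _).comp hl)
  rw [isInducing_whitneyPair.tendsto_nhds_iff]
  refine Tendsto.prodMk_nhds ?_ ?_
  · have h1 : Tendsto (fun a : WhitneySum u s Eu Es =>
        vderiv m j (a.1 : M) (a.2.1 : TangentSpace (𝓡 m) (a.1 : M))) l (𝓝 (whitneyCoord j v).2.1) :=
      (continuous_snd.fst.tendsto _).comp hl
    obtain ⟨ξ, hξ⟩ := tendsto_mk_of_tendsto_vderiv hj (hi v.1) h0 _ h1
    by_cases hne : l.NeBot
    · have h2 := tendsto_nhds_unique (((continuous_vderiv hj).tendsto _).comp hξ) h1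
      have h3 : ξ = (v.2.1 : TangentSpace (𝓡 m) (v.1 : M)) := hi v.1 h2
      rw [h3] at hξ
      exact hξ
    · rw [not_neBot.1 hne]; exact tendsto_bot
  · have h1 : Tendsto (fun a : WhitneySum u s Eu Es =>
        vderiv m j (a.1 : M) (a.2.2 : TangentSpace (𝓡 m) (a.1 : M))) l (𝓝 (whitneyCoord j v).2.2) :=
      (continuous_snd.snd.tendsto _).comp hl
    obtain ⟨ξ, hξ⟩ := tendsto_mk_of_tendsto_vderiv hj (hi v.1) h0 _ h1
    by_cases hne : l.NeBot
    · have h2 := tendsto_nhds_unique (((continuous_vderiv hj).tendsto _).comp hξ) h1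
      have h3 : ξ = (v.2.2 : TangentSpace (𝓡 m) (v.1 : M)) := hi v.1 h2
      rw [h3] at hξ
      exact hξ
    · rw [not_neBot.1 hne]; exact tendsto_bot

end WhitneyCoordinates

/-! ### From local to global homeomorphism near a compact set -/

section LocalTopology

/-- Injectivity on `K` and local injectivity at its points give injectivity on a compact
neighbourhood `L` of `K`. The inverse is continuous because its values stay in `L`, where every
cluster point over `y` is mapped to `y`. -/
theorem exists_openPartialHomeomorph_of_compact {X Y : Type*} [TopologicalSpace X] [T2Space X]
    [Nonempty X] [LocallyCompactSpace X] [TopologicalSpace Y] [T2Space Y] {e : X → Y} {K : Set X}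
    (hK : IsCompact K) (hinj : InjOn e K) (hcont : ∀ x ∈ K, ∀ᶠ y in 𝓝 x, ContinuousAt e y)
    (hloc : ∀ x ∈ K, ∃ U ∈ 𝓝 x, InjOn e U) (hopen : ∀ x ∈ K, ∀ U ∈ 𝓝 x, e '' U ∈ 𝓝 (e x)) :
    ∃ f : OpenPartialHomeomorph X Y, K ⊆ f.source ∧ ⇑f = e := by
  obtain ⟨t, ht, htinj⟩ := hinj.exists_mem_nhdsSet hK (fun x hx => (hcont x hx).self_of_nhds) hloc
  have hc : ∀ᶠ y in 𝓝ˢ K, ContinuousAt e y := by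
    rw [eventually_nhdsSet_iff_forall]; exact hcont
  obtain ⟨W, hWo, hKW, hWt⟩ := mem_nhdsSet_iff_exists.1 (inter_mem ht hc)
  obtain ⟨L, hL, hKL, hLW⟩ := exists_compact_between hK hWo hKW
  have hLc : ContinuousOn e L := fun x hx => (hWt (hLW hx)).2.continuousWithinAt
  have hLi : InjOn e L := htinj.mono fun x hx => (hWt (hLW hx)).1
  set O : Set Y := interior (e '' interior L)
  set S : Set X := interior L ∩ e ⁻¹' O
  have hint : ∀ y ∈ O, ∃ x ∈ S, e x = y := by
    intro y hy
    obtain ⟨x, hx, rfl⟩ := interior_subset hy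
    exact ⟨x, ⟨hx, hy⟩, rfl⟩
  have hSo : IsOpen S :=
    (hLc.mono interior_subset).isOpen_inter_preimage isOpen_interior isOpen_interior
  have hKS : K ⊆ S := fun x hx =>
    ⟨hKL hx, mem_interior_iff_mem_nhds.2 (hopen x hx _ (isOpen_interior.mem_nhds (hKL hx)))⟩
  have hSL : S ⊆ L := fun x hx => interior_subset hx.1
  choose! g hgS hge using hint
  refine ⟨{ toFun := e, invFun := g, source := S, target := O
            map_source' := fun x hx => hx.2
            map_target' := fun y hy => hgS y hy
            left_inv' := fun x hx => hLi (hSL (hgS _ hx.2)) (hSL hx) (hge _ hx.2)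
            right_inv' := fun y hy => hge y hy
            open_source := hSo
            open_target := isOpen_interior
            continuousOn_toFun := hLc.mono hSL
            continuousOn_invFun := ?_ }, hKS, rfl⟩
  intro y hy
  refine ContinuousAt.continuousWithinAt ?_
  refine hL.tendsto_nhds_of_unique_mapClusterPt (l := 𝓝 y) ?_ ?_
  · filter_upwards [isOpen_interior.mem_nhds hy] with z hz using hSL (hgS z hz)
  · intro x hx hcl
    obtain ⟨U, hU, hgU⟩ := mapClusterPt_iff_ultrafilter.1 hcl
    have h1 : Tendsto (fun z => e (g z)) U (𝓝 (e x)) := ((hWt (hLW hx)).2.tendsto).comp hgU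
    have h2 : Tendsto (fun z => e (g z)) U (𝓝 y) := by
      have h3 : Tendsto id (U : Filter Y) (𝓝 y) := hU
      refine h3.congr' ?_
      filter_upwards [hU (isOpen_interior.mem_nhds hy)] with z hz using (hge z hz).symm
    refine hLi hx (hSL (hgS y hy)) ?_
    rw [hge y hy]
    exact tendsto_nhds_unique h1 h2

end LocalTopology

theorem isBigO_sub_chart {n : ℕ} {N : Type*} [TopologicalSpace N]
    [ChartedSpace (EuclideanSpace ℝ (Fin n)) N] [IsManifold (𝓡 n) 1 N]
    {V : Type*} [NormedAddCommGroup V] [NormedSpace ℝ V] {h : N → V} {p : N}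
    (hh : ContMDiffAt (𝓡 n) 𝓘(ℝ, V) 1 h p) :
    (fun q : N × N => h q.1 - h q.2) =O[𝓝 (p, p)]
      fun q => extChartAt (𝓡 n) p q.1 - extChartAt (𝓡 n) p q.2 := by
  have h1 := (vderiv_isLittleO hh).isBigO
  have h2 := (vderiv n h p : EuclideanSpace ℝ (Fin n) →L[ℝ] V).isBigO_comp
    (fun q : N × N => extChartAt (𝓡 n) p q.1 - extChartAt (𝓡 n) p q.2) (𝓝 (p, p))
  exact (h1.add h2).congr_left fun q => sub_add_cancel _ _

/-! ### The sum of the adapted projections as a local coordinate -/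

namespace AdaptedProjections

variable {m c : ℕ} {M : Type*} [TopologicalSpace M] [ChartedSpace (EuclideanSpace ℝ (Fin m)) M]
  {Λ : Set M} [ChartedSpace (EuclideanSpace ℝ (Fin c)) Λ]
  {V : Type*} [NormedAddCommGroup V] [InnerProductSpace ℝ V]
  {j : M → V} {Eu Es : ∀ θ : Λ, Submodule ℝ (TangentSpace (𝓡 m) (θ : M))}
  {Pu Ps Oc : Λ → V →L[ℝ] V}

/-- The three projections take values in independent subspaces, so their sum determines each of
them. This permits working with one operator. -/
theorem components_eq (hP : AdaptedProjections c j Eu Es Pu Ps Oc) {θ : Λ} {z : V}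
    {x y : TangentSpace (𝓡 m) (θ : M)} (hx : x ∈ Eu θ) (hy : y ∈ Es θ)
    (h : (Oc θ + Pu θ + Ps θ) z = vderiv m j (θ : M) (x + y)) :
    Oc θ z = 0 ∧ Pu θ z = vderiv m j (θ : M) x ∧ Ps θ z = vderiv m j (θ : M) y := by
  obtain ⟨w, hw, hw'⟩ := hP.c_mem θ z
  obtain ⟨x', hx', hx''⟩ := hP.u_mem θ z
  obtain ⟨y', hy', hy''⟩ := hP.s_mem θ z
  have h1 : vderiv m j (θ : M) (w + x' + y') = vderiv m j (θ : M) (x + y) := by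
    rw [← h, map_add, map_add, hw', hx'', hy'']; rfl
  have h2 : w + (x' - x) + (y' - y) = 0 := by
    have := hP.injective θ h1
    rw [← sub_eq_zero] at this
    rw [← this]; abel
  obtain ⟨r0, r1, r2⟩ := eq_zero_of_isInternal (hP.splitting θ) hw ((Eu θ).sub_mem hx' hx)
    ((Es θ).sub_mem hy' hy) h2
  refine ⟨?_, ?_, ?_⟩
  · rw [← hw', r0, map_zero]
  · rw [← hx'', sub_eq_zero.1 r1]
  · rw [← hy'', sub_eq_zero.1 r2]

/-- On the image of `TM` the sum sends `w + x + y` to `(w + Oc (x + y)) + x + y`: it is triangular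
with identity diagonal, although `Oc` need not vanish on the normal summands. -/
theorem eq_zero_of_sum_eq_zero (hP : AdaptedProjections c j Eu Es Pu Ps Oc) {θ : Λ}
    {ξ : TangentSpace (𝓡 m) (θ : M)}
    (h : (Oc θ + Pu θ + Ps θ) (vderiv m j (θ : M) ξ) = 0) : ξ = 0 := by
  obtain ⟨w, hw, x, hx, y, hy, rfl⟩ := exists_add_of_isInternal (hP.splitting θ) ξ
  obtain ⟨h1, h2, h3⟩ := hP.components_eq (Eu θ).zero_mem (Es θ).zero_mem
    (h.trans (by rw [add_zero, map_zero]))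
  rw [hP.u_apply θ w hw x hx y hy, (vderiv m j (θ : M)).map_zero] at h2
  rw [hP.s_apply θ w hw x hx y hy, (vderiv m j (θ : M)).map_zero] at h3
  have hx0 := hP.injective θ (h2.trans (map_zero _).symm)
  have hy0 := hP.injective θ (h3.trans (map_zero _).symm)
  rw [hx0, hy0, add_zero, add_zero] at h1 ⊢
  rw [hP.c_apply θ w hw] at h1
  exact hP.injective θ (h1.trans (map_zero _).symm)

theorem exists_sum_eq (hP : AdaptedProjections c j Eu Es Pu Ps Oc) (θ : Λ)
    (ξ : TangentSpace (𝓡 m) (θ : M)) :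
    ∃ ζ, (Oc θ + Pu θ + Ps θ) (vderiv m j (θ : M) ζ) = vderiv m j (θ : M) ξ := by
  obtain ⟨w, hw, x, hx, y, hy, rfl⟩ := exists_add_of_isInternal (hP.splitting θ) ξ
  obtain ⟨w₁, hw₁, h₁⟩ := hP.c_mem θ (vderiv m j (θ : M) (x + y))
  refine ⟨(w - w₁) + x + y, ?_⟩
  rw [add_apply, add_apply,
    hP.u_apply θ _ (Submodule.sub_mem _ hw hw₁) x hx y hy,
    hP.s_apply θ _ (Submodule.sub_mem _ hw hw₁) x hx y hy, add_assoc (w - w₁),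
    (vderiv m j (θ : M)).map_add (w - w₁), (Oc θ).map_add,
    hP.c_apply θ _ (Submodule.sub_mem _ hw hw₁), ← h₁, (vderiv m j (θ : M)).map_sub,
    (vderiv m j (θ : M)).map_add (w + x), (vderiv m j (θ : M)).map_add w]
  abel

theorem exists_sum_vderiv (hP : AdaptedProjections c j Eu Es Pu Ps Oc) (θ : Λ) (z : V) :
    ∃ ζ, (Oc θ + Pu θ + Ps θ) z = vderiv m j (θ : M) ζ := by
  obtain ⟨w, -, hw'⟩ := hP.c_mem θ z
  obtain ⟨x', -, hx''⟩ := hP.u_mem θ z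
  obtain ⟨y', -, hy''⟩ := hP.s_mem θ z
  exact ⟨w + x' + y', by rw [map_add, map_add, hw', hx'', hy'']; rfl⟩

theorem continuous_sum (hP : AdaptedProjections c j Eu Es Pu Ps Oc) :
    Continuous (fun θ => Oc θ + Pu θ + Ps θ) :=
  (hP.continuous_c.add hP.continuous_u).add hP.continuous_s

variable [IsManifold (𝓡 m) 1 M]

/-- Along `Λ`, differences of points of `M` are controlled by the adapted projections. -/
theorem exists_norm_sub_le (hP : AdaptedProjections c j Eu Es Pu Ps Oc)
    (hj : ContMDiff (𝓡 m) 𝓘(ℝ, V) 1 j) (θ₀ : Λ) :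
    ∃ K : ℝ, ∀ᶠ q : (M × M) × Λ in 𝓝 (((θ₀ : M), (θ₀ : M)), θ₀),
      ‖extChartAt (𝓡 m) (θ₀ : M) q.1.1 - extChartAt (𝓡 m) (θ₀ : M) q.1.2‖ ≤
        K * ‖(Oc q.2 + Pu q.2 + Ps q.2) (j q.1.1 - j q.1.2)‖ ∧
      ‖j q.1.1 - j q.1.2‖ ≤ K * ‖(Oc q.2 + Pu q.2 + Ps q.2) (j q.1.1 - j q.1.2)‖ := by
  set B : Λ → V →L[ℝ] V := fun θ => Oc θ + Pu θ + Ps θ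
  have hBj : ContMDiff (𝓡 m) 𝓘(ℝ, V) 1 (fun p => B θ₀ (j p)) :=
    (B θ₀).contMDiff.comp hj
  have hinj : Function.Injective (vderiv m (fun p => B θ₀ (j p)) (θ₀ : M)) := by
    rw [vderiv_clm_comp (hj.mdifferentiable (by simp) _)]
    refine (injective_iff_map_eq_zero _).2 fun ξ hξ => hP.eq_zero_of_sum_eq_zero hξ
  obtain ⟨C, hC0, hC⟩ := (isBigO_sub_of_injective_vderiv hBj.contMDiffAt hinj).exists_pos
  obtain ⟨D, hD0, hD⟩ := (isBigO_sub_chart (hj.contMDiffAt (x := (θ₀ : M)))).exists_pos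
  -- The threshold makes the error from replacing `θ₀` by `θ` at most half of the chart distance, so
  -- it can be absorbed.
  have hB : ∀ᶠ θ in 𝓝 θ₀, ‖B θ₀ - B θ‖ < (2 * C * D)⁻¹ := by
    have : ContinuousAt (fun θ => ‖B θ₀ - B θ‖) θ₀ :=
      (continuousAt_const.sub hP.continuous_sum.continuousAt).norm
    refine this.eventually_lt continuousAt_const ?_
    simp only [sub_self, norm_zero]
    positivity
  refine ⟨max (2 * C) (D * (2 * C)), ?_⟩
  rw [nhds_prod_eq]
  filter_upwards [(hC.bound.and hD.bound).prod_mk hB] with q hq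
  obtain ⟨⟨h1, h2⟩, h3⟩ := hq
  set δ := extChartAt (𝓡 m) (θ₀ : M) q.1.1 - extChartAt (𝓡 m) (θ₀ : M) q.1.2
  set d := j q.1.1 - j q.1.2
  have h4 : B θ₀ (j q.1.1) - B θ₀ (j q.1.2) = B q.2 d + (B θ₀ - B q.2) d := by
    simp [d]
  rw [h4] at h1
  have h5 : ‖(B θ₀ - B q.2) d‖ ≤ (2 * C * D)⁻¹ * (D * ‖δ‖) :=
    ((B θ₀ - B q.2).le_opNorm d).trans (by gcongr)
  have h6 : ‖δ‖ ≤ C * (‖B q.2 d‖ + (2 * C * D)⁻¹ * (D * ‖δ‖)) :=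
    h1.trans (mul_le_mul_of_nonneg_left ((norm_add_le _ _).trans (by gcongr)) hC0.le)
  have h7 : C * ((2 * C * D)⁻¹ * (D * ‖δ‖)) = ‖δ‖ / 2 := by
    field_simp
  have h8 : ‖δ‖ ≤ 2 * C * ‖B q.2 d‖ := by
    rw [mul_add, h7] at h6
    linarith
  refine ⟨h8.trans ?_, h2.trans ?_⟩
  · gcongr; exact le_max_left _ _
  · calc D * ‖δ‖ ≤ D * (2 * C * ‖B q.2 d‖) := by gcongr
      _ = D * (2 * C) * ‖B q.2 d‖ := by ring
      _ ≤ _ := by gcongr; exact le_max_right _ _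

/-- Near the zero section, every vector is attained by a point of the manifold. -/
theorem eventually_exists_sum_eq [FiniteDimensional ℝ V]
    (hP : AdaptedProjections c j Eu Es Pu Ps Oc)
    (hj : ContMDiff (𝓡 m) 𝓘(ℝ, V) 1 j) (θ₀ : Λ) {N : Set M} (hN : N ∈ 𝓝 (θ₀ : M)) :
    ∀ᶠ q : Λ × V in 𝓝 (θ₀, 0), ∀ ξ : TangentSpace (𝓡 m) (q.1 : M),
      vderiv m j (q.1 : M) ξ = q.2 →
        ∃ p ∈ N, (Oc q.1 + Pu q.1 + Ps q.1) (j p - j q.1) = q.2 := by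
  set B : Λ → V →L[ℝ] V := fun θ => Oc θ + Pu θ + Ps θ with hB
  set E := EuclideanSpace ℝ (Fin m)
  set φ := extChartAt (𝓡 m) (θ₀ : M)
  set x₀ : E := φ θ₀
  set J : E →L[ℝ] V := vderiv m j (θ₀ : M)
  have hJ : HasStrictFDerivAt (j ∘ φ.symm) J x₀ := hasStrictFDerivAt_chart hj.contMDiffAt
  have hinj : Function.Injective (B θ₀ ∘L J) :=
    (injective_iff_map_eq_zero _).2 fun ξ hξ => hP.eq_zero_of_sum_eq_zero hξ
  -- Composing with a left inverse `A` turns the equation in `V` into one between spaces of equal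
  -- dimension, whose linearization at `θ₀` is the identity.
  obtain ⟨A', hA'⟩ := (B θ₀ ∘L J).toLinearMap.exists_leftInverse_of_injective
    (LinearMap.ker_eq_bot.2 hinj)
  set A : V →L[ℝ] E := A'.toContinuousLinearMap
  have hA : ∀ x, A (B θ₀ (J x)) = x := fun x => LinearMap.congr_fun hA' x
  -- `A` is injective on the tangent spaces near `θ₀`
  have hAj : ContMDiff (𝓡 m) 𝓘(ℝ, E) 1 (fun p => A (j p)) := A.contMDiff.comp hj
  have hAi : Function.Injective (vderiv m (fun p => A (j p)) (θ₀ : M)) := by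
    rw [vderiv_clm_comp (hj.mdifferentiable (by simp) _)]
    refine (injective_iff_map_eq_zero _).2 fun ξ hξ => ?_
    obtain ⟨ζ, hζ⟩ := hP.exists_sum_eq θ₀ ξ
    have h1 : A (B θ₀ (J ζ)) = 0 := (congrArg A hζ).trans hξ
    have h2 : ζ = 0 := (hA ζ).symm.trans h1
    rw [h2, map_zero, map_zero] at hζ
    exact hP.injective θ₀ (hζ.symm.trans (map_zero _).symm)
  have hAinj : ∀ᶠ θ : Λ in 𝓝 θ₀, Function.Injective (A ∘L vderiv m j (θ : M)) := by
    have h1 := (continuous_subtype_val (p := (· ∈ Λ))).continuousAt.eventually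
      (eventually_injective_vderiv hAj hAi)
    filter_upwards [h1] with θ hθ
    rwa [vderiv_clm_comp (hj.mdifferentiable (by simp) _)] at hθ
  set ψ : Λ → E → E := fun θ x => A (B θ ((j ∘ φ.symm) x - j θ)) with hψ
  -- the maps `ψ θ` are uniformly close to the identity
  set a : ℝ := ‖A‖ * (‖B θ₀‖ + 1) + 1
  have ha : 0 < a := by positivity
  -- The nonlinearity of `j` and the variation of `B` each contribute a Lipschitz constant of at
  -- most `1 / 4`, so `ψ θ` is within `1 / 2` of the identity.
  have hstrict := hJ.isLittleO.bound (c := (4 * a)⁻¹) (by positivity)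
  have hBc : ContinuousAt B θ₀ := hP.continuous_sum.continuousAt
  have hB1 : ∀ᶠ θ in 𝓝 θ₀, ‖B θ‖ < ‖B θ₀‖ + 1 :=
    hBc.norm.eventually_lt continuousAt_const (by simp)
  have hB2 : ∀ᶠ θ in 𝓝 θ₀, ‖A‖ * ‖B θ - B θ₀‖ * ‖J‖ < 1 / 4 := by
    have : ContinuousAt (fun θ => ‖A‖ * ‖B θ - B θ₀‖ * ‖J‖) θ₀ :=
      (continuousAt_const.mul (hBc.sub continuousAt_const).norm).mul continuousAt_const
    refine this.eventually_lt continuousAt_const ?_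
    simp
  have hN' : φ.symm ⁻¹' N ∈ 𝓝 x₀ := by
    have h1 : ContinuousAt φ.symm x₀ := continuousAt_extChartAt_symm (θ₀ : M)
    refine h1 ?_
    rwa [extChartAt_to_inv (I := 𝓡 m) (θ₀ : M)]
  rw [nhds_prod_eq] at hstrict
  obtain ⟨s, hs, hst⟩ := eventually_prod_self_iff'.1 hstrict
  obtain ⟨ρ, hρ, hball⟩ := Metric.nhds_basis_closedBall.mem_iff.1 (inter_mem hs hN')
  have happrox : ∀ᶠ θ in 𝓝 θ₀, ApproximatesLinearOn (ψ θ) (ContinuousLinearMap.id ℝ E)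
      (Metric.closedBall x₀ ρ) (1 / 2) := by
    filter_upwards [hB1, hB2] with θ h1 h2
    intro x hx y hy
    have h3 := hst x (hball hx).1 y (hball hy).1
    simp only at h3
    set R := (j ∘ φ.symm) x - (j ∘ φ.symm) y - J (x - y) with hR
    have h4 : ψ θ x - ψ θ y - (ContinuousLinearMap.id ℝ E) (x - y) =
        A (B θ R) + A ((B θ - B θ₀) (J (x - y))) := by
      have h5 := hA (x - y)
      simp only [hψ, hR, ContinuousLinearMap.id_apply, map_sub,
        sub_apply] at h5 ⊢
      rw [← sub_eq_zero] at h5 ⊢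
      rw [← h5]
      abel
    rw [h4]
    have h6 : ‖A (B θ R)‖ ≤ 1 / 4 * ‖x - y‖ := by
      calc ‖A (B θ R)‖ ≤ ‖A‖ * (‖B θ‖ * ‖R‖) :=
            (A.le_opNorm _).trans (by gcongr; exact (B θ).le_opNorm _)
        _ ≤ ‖A‖ * ((‖B θ₀‖ + 1) * ((4 * a)⁻¹ * ‖x - y‖)) := by gcongr
        _ = ‖A‖ * (‖B θ₀‖ + 1) * (4 * a)⁻¹ * ‖x - y‖ := by ring
        _ ≤ a * (4 * a)⁻¹ * ‖x - y‖ := by gcongr; simp [a]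
        _ = _ := by field_simp
    have h7 : ‖A ((B θ - B θ₀) (J (x - y)))‖ ≤ 1 / 4 * ‖x - y‖ := by
      calc ‖A ((B θ - B θ₀) (J (x - y)))‖ ≤ ‖A‖ * (‖B θ - B θ₀‖ * (‖J‖ * ‖x - y‖)) :=
            (A.le_opNorm _).trans (by
              gcongr
              exact ((B θ - B θ₀).le_opNorm _).trans (by gcongr; exact J.le_opNorm _))
        _ = ‖A‖ * ‖B θ - B θ₀‖ * ‖J‖ * ‖x - y‖ := by ring
        _ ≤ _ := by gcongr
    refine (norm_add_le _ _).trans ?_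
    have h8 : ((1 / 2 : NNReal) : ℝ) = 1 / 2 := by simp
    rw [h8]
    linarith
  have hsmall : ∀ᶠ q : Λ × V in 𝓝 (θ₀, 0), A q.2 ∈ Metric.closedBall (ψ q.1 x₀) (ρ / 2) := by
    have h1 : ContinuousAt (fun q : Λ × V => dist (A q.2) (ψ q.1 x₀)) (θ₀, 0) := by
      have h2 : ContinuousAt (fun q : Λ × V => B q.1) (θ₀, 0) :=
        ContinuousAt.comp (g := B) (f := Prod.fst) hBc continuousAt_fst
      have h3 : Continuous (fun q : Λ × V => (j ∘ φ.symm) x₀ - j q.1) :=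
        continuous_const.sub (hj.continuous.comp (continuous_subtype_val.comp continuous_fst))
      refine Filter.Tendsto.dist ?_ ?_
      · exact (A.continuous.comp continuous_snd).continuousAt
      · exact A.continuous.continuousAt.comp (h2.clm_apply h3.continuousAt)
    have h2 := h1.eventually_lt continuousAt_const (g := fun _ => ρ / 2) (by
      have : (j ∘ φ.symm) x₀ = j θ₀ := congrArg j (extChartAt_to_inv (I := 𝓡 m) (θ₀ : M))
      simp only [hψ, this, sub_self, map_zero, dist_self]
      positivity)
    filter_upwards [h2] with q hq using hq.le
  have hfst : Tendsto (fun q : Λ × V => q.1) (𝓝 (θ₀, 0)) (𝓝 θ₀) := continuousAt_fst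
  filter_upwards [hfst happrox, hfst hAinj, hsmall] with q h1 h2 h3 ξ hξ
  -- The inverse function estimate then covers a ball of radius `(1 - 1 / 2) * ρ` about `ψ θ x₀`.
  let inv : (ContinuousLinearMap.id ℝ E).NonlinearRightInverse :=
    { toFun := id, nnnorm := 1, bound' := fun y => by simp, right_inv' := fun y => rfl }
  have h4 := h1.surjOn_closedBall_of_nonlinearRightInverse inv hρ.le Subset.rfl
  have h5 : (((inv.nnnorm : NNReal) : ℝ)⁻¹ - ((1 / 2 : NNReal) : ℝ)) * ρ = ρ / 2 := by
    simp only [inv, NNReal.coe_one, NNReal.coe_div, NNReal.coe_ofNat]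
    ring
  rw [h5] at h4
  obtain ⟨x, hx, hxe⟩ := h4 h3
  refine ⟨φ.symm x, (hball hx).2, ?_⟩
  -- Both sides lie in the image of the tangent space at `q.1`, on which `A` is injective, so
  -- equality after applying `A` is enough.
  obtain ⟨ζ, hζ⟩ := hP.exists_sum_vderiv q.1 (j (φ.symm x) - j q.1)
  rw [hζ, ← hξ]
  congr 1
  refine h2 ?_
  have h6 : A (vderiv m j (q.1 : M) ζ) = A q.2 := by rw [← hζ]; exact hxe
  rw [← hξ] at h6
  exact h6

end AdaptedProjections

/-! ### The tubular neighbourhood -/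

section Tubular

variable {m c u s : ℕ} {M : Type*} [TopologicalSpace M] [T2Space M]
  [ChartedSpace (EuclideanSpace ℝ (Fin m)) M] [IsManifold (𝓡 m) 1 M]
  {Λ : Set M} [CompactSpace Λ] [Nonempty Λ] [ChartedSpace (EuclideanSpace ℝ (Fin c)) Λ]
  [IsManifold (𝓡 c) 2 Λ]
  {V : Type*} [NormedAddCommGroup V] [InnerProductSpace ℝ V] [FiniteDimensional ℝ V]
  {j : M → V} {Eu Es : ∀ θ : Λ, Submodule ℝ (TangentSpace (𝓡 m) (θ : M))}
  {Pu Ps Oc : Λ → V →L[ℝ] V}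

/-- A tubular neighbourhood of `Λ`, modelled on the Whitney sum of two continuous bundles that
complement `TΛ`. -/
theorem exists_tubular_neighbourhood (hP : AdaptedProjections c j Eu Es Pu Ps Oc)
    (hj : ContMDiff (𝓡 m) 𝓘(ℝ, V) 1 j)
    (hjΛ : ContMDiff (𝓡 c) 𝓘(ℝ, V) 2 (fun θ : Λ => j θ)) (hinj : InjOn j Λ)
    (hv : MDifferentiable (𝓡 c) (𝓡 m) (Subtype.val : Λ → M))
    (hvi : ∀ θ, Function.Injective (mfderiv (𝓡 c) (𝓡 m) (Subtype.val : Λ → M) θ)) :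
    ∃ e : OpenPartialHomeomorph M (WhitneySum u s Eu Es), Λ ⊆ e.source ∧
      (∀ p, IsNearest j Λ p (e p).1) ∧
      ∀ p, whitneyCoord j (e p) = ((e p).1, Pu (e p).1 (j p - j (e p).1),
        Ps (e p).1 (j p - j (e p).1)) := by
  have : IsManifold (𝓡 c) 1 Λ := IsManifold.of_le (n := 2) (by norm_num)
  have hjΛ1 : ContMDiff (𝓡 c) 𝓘(ℝ, V) 1 (fun θ : Λ => j θ) := hjΛ.of_le (by norm_num)
  have hjd : MDifferentiable (𝓡 m) 𝓘(ℝ, V) j := hj.mdifferentiable (by simp)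
  have hjc := hj.continuous
  have hiΛ : ∀ θ, Function.Injective (vderiv c (fun θ : Λ => j θ) θ) := by
    intro θ ξ ζ h
    rw [vderiv_comp_val hjd hv, vderiv_comp_val hjd hv] at h
    exact hvi θ (hP.injective θ h)
  choose r hr using exists_isNearest (Λ := Λ) (hjc.comp continuous_subtype_val)
  choose x hx hxe using hP.u_mem
  choose y hy hye using hP.s_mem
  -- Defined on all of `M` through an arbitrary choice of nearest points; it is well behaved only
  -- near `Λ`.
  set e₀ : M → WhitneySum u s Eu Es := fun p =>
    ⟨r p, (⟨x (r p) (j p - j (r p)), hx _ _⟩, ⟨y (r p) (j p - j (r p)), hy _ _⟩)⟩ with he₀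
  have hκ : ∀ p, whitneyCoord j (e₀ p) = (r p, Pu (r p) (j p - j (r p)),
      Ps (r p) (j p - j (r p))) := fun p => by
    rw [← hxe, ← hye]; rfl
  have hrθ : ∀ θ : Λ, r θ = θ := fun θ => (hr θ).eq_of_mem hinj
  have hcr : ∀ p, Oc (r p) (j p - j (r p)) = 0 := fun p =>
    (hP.c_eq_zero_iff_vderiv hjd hv _ _).2 ((hr p).inner_eq_zero hjΛ1)
  have hind := isInducing_whitneyCoord (u := u) (s := s) (Eu := Eu) (Es := Es) hj hP.injective
  have hκi := whitneyCoord_injective (u := u) (s := s) (Eu := Eu) (Es := Es) hP.injective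
  have hT2 : T2Space (WhitneySum u s Eu Es) := T2Space.of_injective_continuous hκi hind.continuous
  have hLC : LocallyCompactSpace M :=
    ChartedSpace.locallyCompactSpace (EuclideanSpace ℝ (Fin m)) M
  have hne : Nonempty M := ⟨(Classical.arbitrary Λ : Λ)⟩
  have hr0 : ∀ θ₀ : Λ, Tendsto r (𝓝 (θ₀ : M)) (𝓝 θ₀) := fun θ₀ =>
    tendsto_of_isNearest hjc hinj θ₀ tendsto_id hr
  suffices ∃ e : OpenPartialHomeomorph M (WhitneySum u s Eu Es), Λ ⊆ e.source ∧ ⇑e = e₀ by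
    obtain ⟨e, hes, hee⟩ := this
    refine ⟨e, hes, fun p => ?_, fun p => ?_⟩
    · rw [hee]; exact hr p
    · rw [hee]; exact hκ p
  refine exists_openPartialHomeomorph_of_compact (isCompact_iff_compactSpace.2 ‹CompactSpace Λ›)
    ?_ ?_ ?_ ?_
  · intro p hp q hq hpq
    have h1 : r p = r q := congrArg TotalSpace.proj hpq
    rw [hrθ ⟨p, hp⟩, hrθ ⟨q, hq⟩] at h1
    exact congrArg Subtype.val h1
  · intro p hp
    filter_upwards [eventually_continuousAt_of_isNearest hjc hjΛ hinj (hiΛ ⟨p, hp⟩) hr] with q hq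
    rw [hind.continuousAt_iff]
    have h1 : ContinuousAt (fun q => j q - j (r q)) q :=
      hjc.continuousAt.sub ((hjc.comp continuous_subtype_val).continuousAt.comp hq)
    have h2 : ContinuousAt (fun q => Pu (r q)) q :=
      ContinuousAt.comp (g := Pu) hP.continuous_u.continuousAt hq
    have h3 : ContinuousAt (fun q => Ps (r q)) q :=
      ContinuousAt.comp (g := Ps) hP.continuous_s.continuousAt hq
    have h4 := hq.prodMk ((h2.clm_apply h1).prodMk (h3.clm_apply h1))
    exact h4.congr (Eventually.of_forall fun p => (hκ p).symm)
  · intro p hp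
    obtain ⟨K, hK⟩ := hP.exists_norm_sub_le hj ⟨p, hp⟩
    have h1 : Tendsto (fun q : M × M => (q, r q.1)) (𝓝 (p, p)) (𝓝 ((p, p), ⟨p, hp⟩)) :=
      tendsto_id.prodMk_nhds ((hr0 ⟨p, hp⟩).comp continuousAt_fst)
    have h2 := h1 hK
    rw [mem_map, nhds_prod_eq] at h2
    obtain ⟨U, hU, hUU⟩ := eventually_prod_self_iff'.1 h2
    refine ⟨U ∩ (extChartAt (𝓡 m) p).source, inter_mem hU (extChartAt_source_mem_nhds p), ?_⟩
    intro q hq q' hq' h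
    have h3 := (hUU q hq.1 q' hq'.1).1
    have h4 : r q = r q' := congrArg TotalSpace.proj h
    have h5 := congrArg (whitneyCoord j) h
    rw [hκ, hκ, Prod.mk_inj, Prod.mk_inj, ← h4] at h5
    -- Points with the same image share the nearest point and both normal components, and `Oc`
    -- vanishes on both displacements. The sum of projections then separates them.
    have h6 : (Oc (r q) + Pu (r q) + Ps (r q)) (j q - j q') = 0 := by
      have h7 : j q - j q' = (j q - j (r q)) - (j q' - j (r q)) := by abel
      have h8 := hcr q'
      rw [← h4] at h8
      rw [h7, map_sub, add_apply, add_apply,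
        add_apply, add_apply, h5.2.1, h5.2.2, hcr, h8]
      simp
    rw [h6, norm_zero, mul_zero, norm_le_zero_iff, sub_eq_zero] at h3
    exact (extChartAt (𝓡 m) p).injOn hq.2 hq'.2 h3
  · intro p hp U hU
    set θ₀ : Λ := ⟨p, hp⟩
    have h1 := eventually_eq_of_isNearest hjc hjΛ hinj (hiΛ θ₀)
    rw [nhds_prod_eq] at h1
    obtain ⟨a, ha, b, hb, hab⟩ := mem_prod_iff.1 h1
    have h2 := hP.eventually_exists_sum_eq hj θ₀ (inter_mem hU ha)
    have hp0 : whitneyCoord j (e₀ p) = (θ₀, 0, 0) := by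
      rw [hκ, show r p = θ₀ from hrθ θ₀, sub_self, map_zero, map_zero]
    have h3 : Tendsto (whitneyCoord j : WhitneySum u s Eu Es → _) (𝓝 (e₀ p)) (𝓝 (θ₀, 0, 0)) := by
      rw [← hp0]; exact hind.continuous.tendsto _
    have h4 : Tendsto (fun v : WhitneySum u s Eu Es =>
        ((whitneyCoord j v).1, (whitneyCoord j v).2.1 + (whitneyCoord j v).2.2)) (𝓝 (e₀ p))
        (𝓝 (θ₀, 0)) := by
      have h5 : Continuous (fun z : Λ × V × V => (z.1, z.2.1 + z.2.2)) := by fun_prop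
      have h6 := (h5.tendsto (θ₀, 0, 0)).comp h3
      simp only [add_zero] at h6
      exact h6
    have h5 : ∀ᶠ v : WhitneySum u s Eu Es in 𝓝 (e₀ p), v.1 ∈ b :=
      ((continuous_fst.tendsto _).comp h3) hb
    filter_upwards [h4 h2, h5] with v hv1 hv2
    obtain ⟨q, hq, hqe⟩ := hv1 ((v.2.1 : TangentSpace (𝓡 m) (v.1 : M)) +
      (v.2.2 : TangentSpace (𝓡 m) (v.1 : M)))
      (map_add _ _ _)
    obtain ⟨g0, g1, g2⟩ := hP.components_eq v.2.1.2 v.2.2.2 (hqe.trans (map_add _ _ _).symm)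
    -- The point `q` was found with vanishing `Oc` component relative to `v.1`. This makes `v.1` a
    -- critical point of the distance, hence the nearest point.
    have h6 : r q = v.1 := @hab (q, v.1) ⟨hq.2, hv2⟩ (r q) (hr q)
      ((hP.c_eq_zero_iff_vderiv hjd hv _ _).1 g0)
    refine ⟨q, hq.1, hκi ?_⟩
    rw [hκ, h6]
    exact Prod.ext rfl (Prod.ext g1 g2)

end Tubular

/-- A manifold can be mapped smoothly into a Euclidean space so that the map is injective on a
given compact set and immersive along it. -/
theorem exists_immersion_along_compact {m : ℕ} {M : Type*} [TopologicalSpace M] [T2Space M]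
    [ChartedSpace (EuclideanSpace ℝ (Fin m)) M] [IsManifold (𝓡 m) ∞ M] {K : Set M}
    (hK : IsCompact K) :
    ∃ (N : ℕ) (j : M → EuclideanSpace ℝ (Fin N)),
      ContMDiff (𝓡 m) 𝓘(ℝ, EuclideanSpace ℝ (Fin N)) ∞ j ∧ InjOn j K ∧
        ∀ p ∈ K, Function.Injective (vderiv m j p) := by
  let b : ∀ x : M, SmoothBumpFunction (𝓡 m) x := fun x => Classical.arbitrary _
  obtain ⟨t, -, ht⟩ := hK.elim_nhds_subcover (fun x => {y | ∀ᶠ z in 𝓝 y, b x z = 1})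
    (fun x _ => eventually_eventually_nhds.2 (b x).eventuallyEq_one)
  set F := EuclideanSpace ℝ (Fin m)
  set W := EuclideanSpace ℝ (Fin (Module.finrank ℝ (t → F × ℝ)))
  set L : (t → F × ℝ) ≃L[ℝ] W :=
    ContinuousLinearEquiv.ofFinrankEq finrank_euclideanSpace_fin.symm
  -- The cut-off charts make the map immersive, and recording the cut-offs themselves prevents
  -- points outside a chart from being confused with points inside it.
  set g : M → t → F × ℝ := fun p x => (b x p • extChartAt (𝓡 m) (x : M) p, b x p)
  have hg : ContMDiff (𝓡 m) 𝓘(ℝ, t → F × ℝ) ∞ g :=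
    contMDiff_pi_space.2 fun x =>
      ((b x).contMDiff_smul contMDiffOn_extChartAt).prodMk_space (b x).contMDiff
  have hcov : ∀ p ∈ K, ∃ x : t, ∀ᶠ z in 𝓝 p, b x z = 1 := by
    intro p hp
    obtain ⟨y, hy, hxy⟩ := mem_iUnion₂.1 (ht hp)
    exact ⟨⟨y, hy⟩, hxy⟩
  have hsrc : ∀ (x : M) p, b x p = 1 → p ∈ (extChartAt (𝓡 m) x).source := by
    intro x p hp
    rw [extChartAt_source]
    exact (b x).support_subset_source (by rw [Function.mem_support, hp]; exact one_ne_zero)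
  refine ⟨_, L ∘ g, L.toDiffeomorph.contMDiff.comp hg, L.injective.comp_injOn ?_, fun p hp => ?_⟩
  · intro p hp q _ hpq
    obtain ⟨x, hx⟩ := hcov p hp
    have h1 : b x p = 1 := hx.self_of_nhds
    have h2 : g p x = g q x := congrFun hpq x
    have h3 : b x q = 1 := by rw [← h1]; exact (congrArg Prod.snd h2).symm
    have h4 : b x p • extChartAt (𝓡 m) (x : M) p = b x q • extChartAt (𝓡 m) (x : M) q :=
      congrArg Prod.fst h2
    rw [h1, h3, one_smul, one_smul] at h4
    exact (extChartAt (𝓡 m) (x : M)).injOn (hsrc x p h1) (hsrc x q h3) h4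
  · obtain ⟨x, hx⟩ := hcov p hp
    set T : W →L[ℝ] F := (ContinuousLinearMap.fst ℝ F ℝ ∘L
      ContinuousLinearMap.proj (R := ℝ) (φ := fun _ : t => F × ℝ) x) ∘L
        (L.symm : W →L[ℝ] (t → F × ℝ))
    have h1 : vderiv m (fun q => T ((L ∘ g) q)) p = T ∘L vderiv m (L ∘ g) p :=
      vderiv_clm_comp ((L.toDiffeomorph.contMDiff.comp hg).mdifferentiableAt (by simp)) T
    have h2 : (fun q => T ((L ∘ g) q)) =ᶠ[𝓝 p] extChartAt (𝓡 m) (x : M) := by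
      filter_upwards [hx] with q hq
      simp [T, g, hq]
    have h3 : vderiv m (fun q => T ((L ∘ g) q)) p =
        mfderiv (𝓡 m) 𝓘(ℝ, F) (extChartAt (𝓡 m) (x : M)) p := h2.mfderiv_eq
    have h4 : Function.Injective (T ∘L vderiv m (L ∘ g) p) := by
      rw [← h1, h3]
      have : IsManifold (𝓡 m) 1 M := IsManifold.of_le (n := ∞) (by norm_num)
      exact (isInvertible_mfderiv_extChartAt (hsrc x p hx.self_of_nhds)).injective
    exact fun ξ ζ h => h4 (congrArg T h)

/-- Only boundedness of the vectors is required, because the difference quotients below are first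
known to be bounded. -/
theorem tendsto_clm_apply_sub {ι V W : Type*} [NormedAddCommGroup V] [NormedSpace ℝ V]
    [NormedAddCommGroup W] [NormedSpace ℝ W] {l : Filter ι} {L : ι → V →L[ℝ] W} {L₀ : V →L[ℝ] W}
    (hL : Tendsto L l (𝓝 L₀)) {z : ι → V} (hz : z =O[l] (fun _ => (1 : ℝ))) :
    Tendsto (fun a => L a (z a) - L₀ (z a)) l (𝓝 0) := by
  have h1 : (fun a => L a - L₀) =o[l] (fun _ => (1 : ℝ)) :=
    (isLittleO_one_iff ℝ).2 (by simpa using hL.sub_const L₀)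
  have h2 : (fun a => L a (z a) - L₀ (z a)) =O[l] fun a => ‖L a - L₀‖ * ‖z a‖ :=
    IsBigO.of_bound 1 (Eventually.of_forall fun a => by
      simpa using (L a - L₀).le_opNorm (z a))
  have h3 := h2.trans_isLittleO (h1.norm_left.mul_isBigO hz.norm_left)
  simpa using (isLittleO_one_iff ℝ).1 (h3.congr_right fun _ => mul_one (1 : ℝ))

/-! ### Blow-up of the dynamics along `Λ` -/

section Scaling

variable {m c u s : ℕ} {M : Type*} [TopologicalSpace M]
  [ChartedSpace (EuclideanSpace ℝ (Fin m)) M]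
  {Λ : Set M} {Eu Es : ∀ θ : Λ, Submodule ℝ (TangentSpace (𝓡 m) (θ : M))}

/-- Fibrewise scaling of the two summands of a Whitney sum. -/
def whitneyScale (a b : ℝ) (v : WhitneySum u s Eu Es) : WhitneySum u s Eu Es :=
  ⟨v.1, (⟨a • (v.2.1 : TangentSpace (𝓡 m) (v.1 : M)), (Eu v.1).smul_mem a v.2.1.2⟩,
    ⟨b • (v.2.2 : TangentSpace (𝓡 m) (v.1 : M)), (Es v.1).smul_mem b v.2.2.2⟩)⟩

theorem whitneyScale_whitneyScale (a b a' b' : ℝ) (v : WhitneySum u s Eu Es) :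
    whitneyScale a b (whitneyScale a' b' v) = whitneyScale (a * a') (b * b') v := by
  simp only [whitneyScale, mul_smul]
  rfl

theorem whitneyScale_one (v : WhitneySum u s Eu Es) : whitneyScale 1 1 v = v := by
  simp only [whitneyScale, one_smul]

theorem whitneyScale_zero (v : WhitneySum u s Eu Es) :
    whitneyScale 0 0 v = ⟨v.1, (0, 0)⟩ := by
  simp only [whitneyScale, zero_smul]
  rfl

/-- The map of the Whitney sum induced by the derivative of a map `g` of the manifold. -/
def whitneyMap (g : M → M) (hg : MapsTo g Λ Λ)
    (hu : ∀ θ : Λ, ∀ x ∈ Eu θ, mfderiv (𝓡 m) (𝓡 m) g (θ : M) x ∈ Eu ⟨g θ, hg θ.2⟩)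
    (hs : ∀ θ : Λ, ∀ y ∈ Es θ, mfderiv (𝓡 m) (𝓡 m) g (θ : M) y ∈ Es ⟨g θ, hg θ.2⟩)
    (v : WhitneySum u s Eu Es) : WhitneySum u s Eu Es :=
  ⟨⟨g v.1, hg v.1.2⟩, (⟨mfderiv (𝓡 m) (𝓡 m) g (v.1 : M) v.2.1, hu _ _ v.2.1.2⟩,
    ⟨mfderiv (𝓡 m) (𝓡 m) g (v.1 : M) v.2.2, hs _ _ v.2.2.2⟩)⟩

variable {V : Type*} [NormedAddCommGroup V]

theorem whitneyCoord_whitneyScale [NormedSpace ℝ V] {j : M → V}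
    (a b : ℝ) (v : WhitneySum u s Eu Es) :
    whitneyCoord j (whitneyScale a b v) =
      (v.1, a • (whitneyCoord j v).2.1, b • (whitneyCoord j v).2.2) :=
  Prod.ext rfl (Prod.ext (map_smul (vderiv m j (v.1 : M)) _ _)
    (map_smul (vderiv m j (v.1 : M)) _ _))

theorem whitneyCoord_zero [NormedSpace ℝ V] {j : M → V} (θ : Λ) :
    whitneyCoord j (⟨θ, (0, 0)⟩ : WhitneySum u s Eu Es) = (θ, 0, 0) :=
  Prod.ext rfl (Prod.ext (map_zero (vderiv m j (θ : M))) (map_zero (vderiv m j (θ : M))))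

variable [IsManifold (𝓡 m) 1 M]

theorem continuous_whitneyScale [NormedSpace ℝ V] [FiniteDimensional ℝ V] {j : M → V}
    (hj : ContMDiff (𝓡 m) 𝓘(ℝ, V) 1 j)
    (hi : ∀ θ : Λ, Function.Injective (vderiv m j (θ : M))) :
    Continuous fun q : ℝ × ℝ × WhitneySum u s Eu Es => whitneyScale q.1 q.2.1 q.2.2 := by
  have hI := isInducing_whitneyCoord (u := u) (s := s) (Eu := Eu) (Es := Es) hj hi
  rw [hI.continuous_iff]
  have h1 := hI.continuous
  have h2 : Continuous fun q : ℝ × ℝ × WhitneySum u s Eu Es =>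
      ((whitneyCoord j q.2.2).1, q.1 • (whitneyCoord j q.2.2).2.1,
        q.2.1 • (whitneyCoord j q.2.2).2.2) := by
    have h3 := h1.comp (continuous_snd.snd : Continuous fun q : ℝ × ℝ × WhitneySum u s Eu Es => q.2.2)
    exact h3.fst.prodMk ((continuous_fst.smul h3.snd.fst).prodMk
      (continuous_snd.fst.smul h3.snd.snd))
  exact h2.congr fun q => (whitneyCoord_whitneyScale _ _ _).symm

variable [InnerProductSpace ℝ V] [FiniteDimensional ℝ V] {j : M → V}
  [CompactSpace Λ] [ChartedSpace (EuclideanSpace ℝ (Fin c)) Λ] [IsManifold (𝓡 c) 1 Λ]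
  {Pu Ps Oc : Λ → V →L[ℝ] V}

/-- In a tubular neighbourhood, the rescalings of a map that preserves `Λ` and its splitting
converge to the map induced by the derivative. -/
theorem AdaptedProjections.tendsto_whitneyScale (hP : AdaptedProjections c j Eu Es Pu Ps Oc)
    (hj : ContMDiff (𝓡 m) 𝓘(ℝ, V) 1 j) (hinj : InjOn j Λ)
    (hv : ContMDiff (𝓡 c) (𝓡 m) 1 (Subtype.val : Λ → M))
    (hvi : ∀ θ, Function.Injective (mfderiv (𝓡 c) (𝓡 m) (Subtype.val : Λ → M) θ))
    {e : OpenPartialHomeomorph M (WhitneySum u s Eu Es)} (heΛ : Λ ⊆ e.source)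
    (hen : ∀ p, IsNearest j Λ p (e p).1)
    (hec : ∀ p, whitneyCoord j (e p) = ((e p).1, Pu (e p).1 (j p - j (e p).1),
        Ps (e p).1 (j p - j (e p).1)))
    (he0 : ∀ θ : Λ, e θ = ⟨θ, (0, 0)⟩)
    {g : M → M} (hg1 : ContMDiff (𝓡 m) (𝓡 m) 1 g) (hg : MapsTo g Λ Λ)
    (hc : ∀ θ : Λ, ∀ w ∈ tangentAlong c Λ θ,
      mfderiv (𝓡 m) (𝓡 m) g (θ : M) w ∈ tangentAlong c Λ ⟨g θ, hg θ.2⟩)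
    (hu : ∀ θ : Λ, ∀ x ∈ Eu θ, mfderiv (𝓡 m) (𝓡 m) g (θ : M) x ∈ Eu ⟨g θ, hg θ.2⟩)
    (hs : ∀ θ : Λ, ∀ y ∈ Es θ, mfderiv (𝓡 m) (𝓡 m) g (θ : M) y ∈ Es ⟨g θ, hg θ.2⟩)
    {ι : Type*} {l : Filter ι} {t : ι → ℝ} (ht : Tendsto t l (𝓝 0)) (ht0 : ∀ᶠ a in l, t a ≠ 0)
    {v : ι → WhitneySum u s Eu Es} {v₀ : WhitneySum u s Eu Es} (hv₀ : Tendsto v l (𝓝 v₀)) :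
    Tendsto (fun a => whitneyScale (t a)⁻¹ (t a)⁻¹
      (e (g (e.symm (whitneyScale (t a) (t a) (v a)))))) l (𝓝 (whitneyMap g hg hu hs v₀)) := by
  have hi := hP.injective
  have hjd : MDifferentiable (𝓡 m) 𝓘(ℝ, V) j := hj.mdifferentiable (by simp)
  have hvd : MDifferentiable (𝓡 c) (𝓡 m) (Subtype.val : Λ → M) := hv.mdifferentiable (by simp)
  have hI := isInducing_whitneyCoord (u := u) (s := s) (Eu := Eu) (Es := Es) hj hi
  set θ₀ : Λ := v₀.1 with hθ₀
  set B : Λ → V →L[ℝ] V := fun θ => Oc θ + Pu θ + Ps θ with hB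
  -- the points `p = e⁻¹ (t v)` converge to `θ₀`
  set sv : ι → WhitneySum u s Eu Es := fun a => whitneyScale (t a) (t a) (v a) with hsv
  have hsv0 : Tendsto sv l (𝓝 (e θ₀)) := by
    have h1 := ((continuous_whitneyScale hj hi).tendsto (0, 0, v₀)).comp
      (ht.prodMk_nhds (ht.prodMk_nhds hv₀))
    rwa [whitneyScale_zero, ← he0] at h1
  set p : ι → M := fun a => e.symm (sv a) with hp
  have hθ₀s : (θ₀ : M) ∈ e.source := heΛ θ₀.2
  have hp0 : Tendsto p l (𝓝 (θ₀ : M)) := by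
    have h1 := (e.continuousAt_symm (e.map_source hθ₀s)).tendsto.comp hsv0
    rwa [e.left_inv hθ₀s] at h1
  have hep : ∀ᶠ a in l, e (p a) = sv a := by
    filter_upwards [hsv0 (e.open_target.mem_nhds (e.map_source hθ₀s))] with a ha
      using e.right_inv ha
  set θ : ι → Λ := fun a => (v a).1 with hθ
  have hvc := (hI.tendsto_nhds_iff (f := v) (y := v₀)).1 hv₀
  have hθ0 : Tendsto θ l (𝓝 θ₀) := (continuous_fst.tendsto _).comp hvc
  have hθ0' : Tendsto (fun a => (θ a : M)) l (𝓝 (θ₀ : M)) :=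
    (continuous_subtype_val.tendsto _).comp hθ0
  set X : ι → V := fun a => (whitneyCoord j (v a)).2.1 with hX
  set Y : ι → V := fun a => (whitneyCoord j (v a)).2.2 with hY
  set X₀ : V := vderiv m j (θ₀ : M) (v₀.2.1 : TangentSpace (𝓡 m) (v₀.1 : M)) with hX₀
  set Y₀ : V := vderiv m j (θ₀ : M) (v₀.2.2 : TangentSpace (𝓡 m) (v₀.1 : M)) with hY₀
  have hX0 : Tendsto X l (𝓝 X₀) := (continuous_snd.fst.tendsto _).comp hvc
  have hY0 : Tendsto Y l (𝓝 Y₀) := (continuous_snd.snd.tendsto _).comp hvc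
  -- The rescaled displacement of `p` from its foot point. Its image under the sum of projections is
  -- `X + Y`, which converges; that bounds `ζ` itself.
  set ζ : ι → V := fun a => (t a)⁻¹ • (j (p a) - j (θ a)) with hζ
  have hBz : ∀ᶠ a in l, B (θ a) (j (p a) - j (θ a)) = t a • (X a + Y a) := by
    filter_upwards [hep] with a ha
    have h1 := hec (p a)
    have h2 := hen (p a)
    rw [ha] at h1 h2
    have h3 : Oc (θ a) (j (p a) - j (θ a)) = 0 :=
      (hP.c_eq_zero_iff_vderiv hjd hvd _ _).2 fun ξ => h2.inner_eq_zero (hj.comp hv) ξ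
    rw [whitneyCoord_whitneyScale] at h1
    have h4 : t a • X a = Pu (θ a) (j (p a) - j (θ a)) := congrArg (fun z => z.2.1) h1
    have h5 : t a • Y a = Ps (θ a) (j (p a) - j (θ a)) := congrArg (fun z => z.2.2) h1
    rw [smul_add, h4, h5]
    simp only [hB, add_apply]
    rw [h3, zero_add]
  have hBζ : ∀ᶠ a in l, B (θ a) (ζ a) = X a + Y a := by
    filter_upwards [hBz, ht0] with a h1 h2
    rw [hζ, map_smul, h1, inv_smul_smul₀ h2]
  obtain ⟨K, hK⟩ := hP.exists_norm_sub_le hj θ₀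
  have hζO : ζ =O[l] (fun _ => (1 : ℝ)) := by
    have h1 : ζ =O[l] fun a => X a + Y a := by
      refine IsBigO.of_bound K ?_
      filter_upwards [((hp0.prodMk_nhds hθ0').prodMk_nhds hθ0).eventually hK, hBζ] with a h1 h2
      rw [← h2, hζ, map_smul, norm_smul, norm_smul, mul_left_comm]
      exact mul_le_mul_of_nonneg_left h1.2 (norm_nonneg _)
    exact h1.trans ((hX0.add hY0).isBigO_one ℝ)
  have hB0ζ : Tendsto (fun a => B θ₀ (ζ a)) l (𝓝 (X₀ + Y₀)) := by
    have h1 := tendsto_clm_apply_sub ((hP.continuous_sum.tendsto θ₀).comp hθ0) hζO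
    have h2 : Tendsto (fun a => B (θ a) (ζ a)) l (𝓝 (X₀ + Y₀)) :=
      (hX0.add hY0).congr' (by filter_upwards [hBζ] with a ha using ha.symm)
    have h3 := h2.sub h1
    rw [sub_zero] at h3
    exact h3.congr fun a => sub_sub_cancel _ _
  -- the difference quotients of `g`
  set η : Λ → Λ := fun θ => ⟨g θ, hg θ.2⟩ with hη
  have hηc : Continuous η :=
    (hg1.continuous.comp continuous_subtype_val).subtype_mk _
  set G : M → V := fun p => j (g p) with hG
  have hG1 : ContMDiff (𝓡 m) 𝓘(ℝ, V) 1 G := hj.comp hg1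
  have hGd : ∀ ξ, vderiv m G (θ₀ : M) ξ =
      vderiv m j (η θ₀ : M) (mfderiv (𝓡 m) (𝓡 m) g (θ₀ : M) ξ) := fun ξ =>
    congrArg (fun T => T ξ) (mfderiv_comp (θ₀ : M) (hjd _) (hg1.mdifferentiable (by simp) _))
  -- `A` expresses the derivative of `j ∘ g` through the operator `B θ₀` whose values on `ζ` have a
  -- known limit, so no limit of `ζ` is needed.
  obtain ⟨A, hA⟩ : ∃ A : V →L[ℝ] V, ∀ ξ, A (B θ₀ (vderiv m j (θ₀ : M) ξ)) =
      vderiv m G (θ₀ : M) ξ := by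
    set J : EuclideanSpace ℝ (Fin m) →L[ℝ] V := vderiv m j (θ₀ : M)
    have hBi : Function.Injective (B θ₀ ∘L J) :=
      (injective_iff_map_eq_zero _).2 fun ξ hξ => hP.eq_zero_of_sum_eq_zero hξ
    obtain ⟨R, hR⟩ := (B θ₀ ∘L J).toLinearMap.exists_leftInverse_of_injective
      (LinearMap.ker_eq_bot.2 hBi)
    refine ⟨(vderiv m G (θ₀ : M) : EuclideanSpace ℝ (Fin m) →L[ℝ] V) ∘L
      R.toContinuousLinearMap, fun ξ => ?_⟩
    exact congrArg (vderiv m G (θ₀ : M)) (LinearMap.congr_fun hR ξ)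
  set τ : ι → V := fun a => (t a)⁻¹ • (j (g (p a)) - j (η (θ a))) with hτ
  set Ω : V := A (X₀ + Y₀) with hΩ
  have hτ0 : Tendsto τ l (𝓝 Ω) := by
    have h1 := (isLittleO_sub_of_comp_vderiv_eq (hj.contMDiffAt (x := (θ₀ : M)))
      (hG1.contMDiffAt (x := (θ₀ : M))) (hi θ₀) (A ∘L B θ₀) hA).comp_tendsto
      (hp0.prodMk_nhds hθ0')
    have h2 := (isBigO_refl (fun a => (t a)⁻¹) l).smul_isLittleO h1
    have h3 := (isLittleO_one_iff ℝ).1 (h2.trans_isBigO hζO)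
    have h4 := h3.add ((A.continuous.tendsto _).comp hB0ζ)
    rw [zero_add] at h4
    refine h4.congr fun a => ?_
    simp only [Function.comp_apply, hG, hτ, hζ, hη, map_smul, smul_sub,
      ContinuousLinearMap.comp_apply, map_sub]
    abel
  obtain ⟨hPuΩ, hPsΩ⟩ : Pu (η θ₀) Ω = vderiv m j (η θ₀ : M)
        (mfderiv (𝓡 m) (𝓡 m) g (θ₀ : M) (v₀.2.1 : TangentSpace (𝓡 m) (v₀.1 : M))) ∧
      Ps (η θ₀) Ω = vderiv m j (η θ₀ : M)
        (mfderiv (𝓡 m) (𝓡 m) g (θ₀ : M) (v₀.2.2 : TangentSpace (𝓡 m) (v₀.1 : M))) := by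
    -- `ξ` may have a component along `Λ`, but its `Eu` and `Es` components are those of `v₀`. The
    -- derivative preserves the splitting, so `Pu` and `Ps` discard the tangential part of the
    -- image.
    obtain ⟨ξ, hξ⟩ := hP.exists_sum_eq θ₀
      ((v₀.2.1 : TangentSpace (𝓡 m) (v₀.1 : M)) + (v₀.2.2 : TangentSpace (𝓡 m) (v₀.1 : M)))
    have hΩξ : Ω = vderiv m j (η θ₀ : M) (mfderiv (𝓡 m) (𝓡 m) g (θ₀ : M) ξ) := by
      rw [← hGd, ← hA, hξ, (vderiv m j (θ₀ : M)).map_add]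
    obtain ⟨-, h1, h2⟩ := hP.components_eq v₀.2.1.2 v₀.2.2.2 hξ
    obtain ⟨w, hw, x, hx, y, hy, rfl⟩ := exists_add_of_isInternal (hP.splitting θ₀) ξ
    rw [hP.u_apply θ₀ w hw x hx y hy] at h1
    rw [hP.s_apply θ₀ w hw x hx y hy] at h2
    have hx' := hi θ₀ h1
    have hy' := hi θ₀ h2
    have h3 : mfderiv (𝓡 m) (𝓡 m) g (θ₀ : M) (w + x + y) = mfderiv (𝓡 m) (𝓡 m) g (θ₀ : M) w +
        mfderiv (𝓡 m) (𝓡 m) g (θ₀ : M) x + mfderiv (𝓡 m) (𝓡 m) g (θ₀ : M) y := by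
      rw [map_add, map_add]
    rw [hΩξ, h3]
    refine ⟨(hP.u_apply (η θ₀) _ (hc _ _ hw) _ (hu _ _ hx) _ (hs _ _ hy)).trans ?_,
      (hP.s_apply (η θ₀) _ (hc _ _ hw) _ (hu _ _ hx) _ (hs _ _ hy)).trans ?_⟩
    · rw [hx']
    · rw [hy']
  -- the distance of `η θ` from the nearest point of `g p` is negligible in the normal directions
  set ρ : ι → Λ := fun a => (e (g (p a))).1 with hρ
  have hgp : Tendsto (fun a => g (p a)) l (𝓝 (η θ₀ : M)) := (hg1.continuous.tendsto _).comp hp0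
  have hρ0 : Tendsto ρ l (𝓝 (η θ₀)) :=
    tendsto_of_isNearest hj.continuous hinj (η θ₀) hgp fun a => hen _
  have hηθ : Tendsto (fun a => η (θ a)) l (𝓝 (η θ₀)) := (hηc.tendsto _).comp hθ0
  set σ : ι → V := fun a => (t a)⁻¹ • (j (η (θ a)) - j (ρ a)) with hσ
  have hσO : σ =O[l] (fun _ => (1 : ℝ)) := by
    have h1 : σ =O[l] τ := by
      refine IsBigO.of_bound 2 (Eventually.of_forall fun a => ?_)
      rw [hσ, hτ, norm_smul, norm_smul, mul_left_comm]
      exact mul_le_mul_of_nonneg_left ((hen (g (p a))).norm_sub_le (η (θ a))) (norm_nonneg _)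
    exact h1.trans (hτ0.isBigO_one ℝ)
  -- The displacement of `g p` from its nearest point is `t (τ + σ)`. A projection vanishing on `TΛ`
  -- sends `σ`, a bounded multiple of an increment along `Λ`, to zero in the limit, so only `τ`
  -- contributes.
  have key : ∀ P : Λ → V →L[ℝ] V, Continuous P →
      (∀ θ, ∀ w ∈ tangentAlong (m := m) c Λ θ, P θ (vderiv m j (θ : M) w) = 0) →
      Tendsto (fun a => (t a)⁻¹ • P (ρ a) (j (g (p a)) - j (ρ a))) l (𝓝 (P (η θ₀) Ω)) := by
    intro P hPc hP0
    have hPρ : Tendsto (fun a => P (ρ a)) l (𝓝 (P (η θ₀))) := (hPc.tendsto _).comp hρ0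
    have h1 := isLittleO_sub_of_comp_vderiv_eq (n := c) (h := fun θ : Λ => j θ)
      (g := fun _ : Λ => (0 : V)) (p := η θ₀) (hj.comp hv).contMDiffAt contMDiffAt_const
      (by
        intro ξ ξ' h
        rw [vderiv_comp_val hjd hvd, vderiv_comp_val hjd hvd] at h
        exact hvi _ (hi _ h)) (P (η θ₀)) (by
        intro ξ
        rw [vderiv_comp_val hjd hvd]
        refine (hP0 _ _ ⟨ξ, rfl⟩).trans ?_
        have : vderiv c (fun _ : Λ => (0 : V)) (η θ₀) = 0 := mfderiv_const
        rw [this]; rfl)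
    have h2 := (isBigO_refl (fun a => (t a)⁻¹) l).smul_isLittleO
      (h1.comp_tendsto (hηθ.prodMk_nhds hρ0))
    have h3 := (isLittleO_one_iff ℝ).1 (h2.trans_isBigO hσO)
    have h4 := tendsto_clm_apply_sub hPρ hσO
    have h5 : Tendsto (fun a => P (ρ a) (τ a)) l (𝓝 (P (η θ₀) Ω)) :=
      (isBoundedBilinearMap_apply.continuous.tendsto (P (η θ₀), Ω)).comp (hPρ.prodMk_nhds hτ0)
    have h6 := h5.add (h4.sub h3)
    rw [sub_zero, add_zero] at h6
    refine h6.congr fun a => ?_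
    simp only [Function.comp_apply, hτ, hσ, map_smul, smul_sub, map_sub, zero_sub,
      smul_neg]
    abel
  have hku := key Pu hP.continuous_u fun θ w hw => by
    have := hP.u_apply θ w hw 0 (Eu θ).zero_mem 0 (Es θ).zero_mem
    rwa [add_zero, add_zero, map_zero] at this
  have hks := key Ps hP.continuous_s fun θ w hw => by
    have := hP.s_apply θ w hw 0 (Eu θ).zero_mem 0 (Es θ).zero_mem
    rwa [add_zero, add_zero, map_zero] at this
  rw [hI.tendsto_nhds_iff]
  rw [hPuΩ] at hku
  rw [hPsΩ] at hks
  refine (hρ0.prodMk_nhds (hku.prodMk_nhds hks)).congr fun a => ?_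
  simp only [Function.comp_apply]
  rw [whitneyCoord_whitneyScale, hec]

end Scaling

/-! ### Immersions and the degree of the restriction -/

section Immersion

variable {m c : ℕ} {M : Type*} [TopologicalSpace M] [ChartedSpace (EuclideanSpace ℝ (Fin m)) M]
  {N : Type*} [TopologicalSpace N] [ChartedSpace (EuclideanSpace ℝ (Fin c)) N]

/-- In suitable charts an immersion is the inclusion of a factor; projecting back onto that factor
gives the left inverse. -/
theorem Manifold.IsImmersionAt.exists_leftInverse {n : WithTop ℕ∞} {h : N → M} {x : N}
    (hh : Manifold.IsImmersionAt (𝓡 c) (𝓡 m) n h x) :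
    ∃ r : M → N, ContMDiffAt (𝓡 m) (𝓡 c) n r (h x) ∧ ∀ᶠ y in 𝓝 x, r (h y) = y := by
  set φ := hh.domChart.extend (𝓡 c)
  set ψ := hh.codChart.extend (𝓡 m)
  have key : ∀ y ∈ hh.domChart.source, (hh.equiv.symm (ψ (h y))).1 = φ y := by
    intro y hy
    have hy' : y ∈ φ.source := by rwa [OpenPartialHomeomorph.extend_source]
    have h1 := hh.writtenInCharts (φ.map_source hy')
    simp only [Function.comp_apply] at h1
    rw [φ.left_inv hy'] at h1
    change ψ (h y) = _ at h1
    rw [h1, ContinuousLinearEquiv.symm_apply_apply]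
  refine ⟨fun q => φ.symm (hh.equiv.symm (ψ q)).1, ?_, ?_⟩
  · have h1 : ContMDiffAt (𝓡 m) 𝓘(ℝ, EuclideanSpace ℝ (Fin m)) n ψ (h x) :=
      hh.codChart.contMDiffAt_extend hh.codChart_mem_maximalAtlas hh.mem_codChart_source
    let L : EuclideanSpace ℝ (Fin m) →L[ℝ] EuclideanSpace ℝ (Fin c) :=
      (ContinuousLinearMap.fst ℝ (EuclideanSpace ℝ (Fin c)) hh.complement).comp
        (hh.equiv.symm : EuclideanSpace ℝ (Fin m) →L[ℝ] EuclideanSpace ℝ (Fin c) × hh.complement)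
    have h2 : ContMDiffAt (𝓡 m) 𝓘(ℝ, EuclideanSpace ℝ (Fin c)) n
        (fun q => (hh.equiv.symm (ψ q)).1) (h x) :=
      ContMDiffAt.comp (g := L) (f := ψ) (h x) L.contMDiff.contMDiffAt h1
    have h3 : ContMDiffAt 𝓘(ℝ, EuclideanSpace ℝ (Fin c)) (𝓡 c) n φ.symm (φ x) := by
      refine (contMDiffOn_extend_symm hh.domChart_mem_maximalAtlas).contMDiffAt ?_
      have h4 : (𝓡 c) '' hh.domChart.target = hh.domChart.target := by simp
      rw [h4]
      exact hh.domChart.open_target.mem_nhds (hh.domChart.map_source hh.mem_domChart_source)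
    rw [← key x hh.mem_domChart_source] at h3
    exact ContMDiffAt.comp (g := φ.symm) (h x) h3 h2
  · filter_upwards [hh.domChart.open_source.mem_nhds hh.mem_domChart_source] with y hy
    rw [key y hy]
    exact φ.left_inv (by rwa [OpenPartialHomeomorph.extend_source])

theorem mfderiv_injective_of_leftInverse {h : N → M} {r : M → N} {x : N}
    (hh : MDifferentiableAt (𝓡 c) (𝓡 m) h x) (hr : MDifferentiableAt (𝓡 m) (𝓡 c) r (h x))
    (hrh : ∀ᶠ y in 𝓝 x, r (h y) = y) : Function.Injective (mfderiv (𝓡 c) (𝓡 m) h x) := by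
  have h1 := mfderiv_comp x hr hh
  have h2 : mfderiv (𝓡 c) (𝓡 c) (r ∘ h) x = mfderiv (𝓡 c) (𝓡 c) id x :=
    Filter.EventuallyEq.mfderiv_eq hrh
  intro ξ ζ h3
  have h4 : ∀ ξ : TangentSpace (𝓡 c) x, mfderiv (𝓡 m) (𝓡 c) r (h x)
      (mfderiv (𝓡 c) (𝓡 m) h x ξ) = ξ := fun ξ => by
    have h5 := (congrArg (fun T : EuclideanSpace ℝ (Fin c) →L[ℝ] EuclideanSpace ℝ (Fin c) => T ξ)
      (h1.symm.trans h2))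
    rw [mfderiv_id] at h5
    exact h5
  rw [← h4 ξ, h3, h4]

theorem Manifold.IsImmersionAt.mfderiv_injective {n : WithTop ℕ∞} (hn : n ≠ 0) {h : N → M} {x : N}
    (hh : Manifold.IsImmersionAt (𝓡 c) (𝓡 m) n h x) :
    Function.Injective (mfderiv (𝓡 c) (𝓡 m) h x) := by
  obtain ⟨r, hr, hrh⟩ := hh.exists_leftInverse
  exact mfderiv_injective_of_leftInverse (hh.contMDiffAt.mdifferentiableAt hn)
    (hr.mdifferentiableAt hn) hrh

/-- Locally `φ` is a smooth left inverse of `h` composed with `h ∘ φ`, so regularity seen in the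
ambient manifold is regularity in `N`. -/
theorem Manifold.IsImmersion.contMDiff_of_comp {n : WithTop ℕ∞} {k : WithTop ℕ∞} (hk : k ≤ n)
    {h : N → M} (hh : Manifold.IsImmersion (𝓡 c) (𝓡 m) n h) {φ : N → N} (hφ : Continuous φ)
    (hhφ : ContMDiff (𝓡 c) (𝓡 m) k (h ∘ φ)) : ContMDiff (𝓡 c) (𝓡 c) k φ := by
  intro x
  obtain ⟨r, hr, hrh⟩ := (hh.isImmersionAt (φ x)).exists_leftInverse
  refine ((hr.of_le hk).comp x (hhφ x)).congr_of_eventuallyEq ?_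
  filter_upwards [hφ.continuousAt.eventually hrh] with y hy
  exact hy.symm

/-- The map itself serves as the `C¹` representative: every value is regular by equality of
dimensions and has exactly one preimage. -/
theorem degTwo_ne_zero_of_bijective [Nonempty N] (η : C(N, N))
    (h1 : ContMDiff (𝓡 c) (𝓡 c) 1 η) (hb : Function.Bijective η)
    (hd : ∀ x, Function.Injective (mfderiv (𝓡 c) (𝓡 c) η x)) : degTwo c η ≠ 0 := by
  obtain ⟨x₀⟩ := ‹Nonempty N›
  rw [degTwo, if_pos]
  · exact one_ne_zero
  · refine ⟨η, ContinuousMap.Homotopic.refl η, h1, η x₀, ?_, ?_⟩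
    · intro x _
      let T : EuclideanSpace ℝ (Fin c) →L[ℝ] EuclideanSpace ℝ (Fin c) :=
        mfderiv (𝓡 c) (𝓡 c) η x
      exact (LinearMap.injective_iff_surjective (f := T.toLinearMap)).1 (hd x)
    · have : η ⁻¹' {η x₀} = {x₀} := by
        ext y
        simp [hb.1.eq_iff]
      rw [this, ncard_singleton]
      exact odd_one

end Immersion

/-! ### Consequences of normal hyperbolicity -/

section Dynamics

variable {m : ℕ} {M : Type*} [TopologicalSpace M] [ChartedSpace (EuclideanSpace ℝ (Fin m)) M]

theorem diffeoIter_natCast (f : M ≃ₘ^1⟮𝓡 m, 𝓡 m⟯ M) (k : ℕ) : diffeoIter f k = f^[k] := by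
  rw [diffeoIter, zpow_natCast, ← Equiv.Perm.iterate_eq_pow]
  rfl

theorem diffeoIter_neg_natCast (f : M ≃ₘ^1⟮𝓡 m, 𝓡 m⟯ M) (k : ℕ) :
    diffeoIter f (-k) = f.symm^[k] := by
  rw [diffeoIter, zpow_neg, zpow_natCast, ← inv_pow, ← Equiv.Perm.iterate_eq_pow]
  rfl

theorem contMDiff_iterate {n : WithTop ℕ∞} {g : M → M} (hg : ContMDiff (𝓡 m) (𝓡 m) n g) (k : ℕ) :
    ContMDiff (𝓡 m) (𝓡 m) n g^[k] := by
  induction k with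
  | zero => exact contMDiff_id
  | succ k ih => exact ih.comp hg

theorem contMDiff_diffeoIter (f : M ≃ₘ^1⟮𝓡 m, 𝓡 m⟯ M) (i : ℤ) :
    ContMDiff (𝓡 m) (𝓡 m) 1 (diffeoIter f i) := by
  obtain ⟨k, rfl | rfl⟩ := i.eq_nat_or_neg
  · rw [diffeoIter_natCast]; exact contMDiff_iterate f.contMDiff k
  · rw [diffeoIter_neg_natCast]; exact contMDiff_iterate f.symm.contMDiff k

theorem mfderiv_iterate_mem {g : M → M} (hg : MDifferentiable (𝓡 m) (𝓡 m) g) {Λ : Set M}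
    (hΛ : MapsTo g Λ Λ) {E : ∀ θ : Λ, Submodule ℝ (TangentSpace (𝓡 m) (θ : M))}
    (hE : ∀ θ : Λ, ∀ x ∈ E θ, mfderiv (𝓡 m) (𝓡 m) g (θ : M) x ∈ E ⟨g θ, hΛ θ.2⟩) (k : ℕ) :
    ∀ θ : Λ, ∀ x ∈ E θ, mfderiv (𝓡 m) (𝓡 m) g^[k] (θ : M) x ∈ E ⟨g^[k] θ, hΛ.iterate k θ.2⟩ := by
  have hgk : ∀ k : ℕ, MDifferentiable (𝓡 m) (𝓡 m) g^[k] := fun k => by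
    induction k with
    | zero => exact mdifferentiable_id
    | succ k ih => exact ih.comp hg
  induction k with
  | zero =>
    intro θ x hx
    have : mfderiv (𝓡 m) (𝓡 m) g^[0] (θ : M) = ContinuousLinearMap.id ℝ _ := mfderiv_id
    rw [this]
    exact hx
  | succ k ih =>
    intro θ x hx
    have : mfderiv (𝓡 m) (𝓡 m) g^[k + 1] (θ : M) =
        (mfderiv (𝓡 m) (𝓡 m) g^[k] (g θ)).comp (mfderiv (𝓡 m) (𝓡 m) g (θ : M)) :=
      mfderiv_comp (θ : M) (hgk k _) (hg _)
    rw [this]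
    exact ih ⟨g θ, hΛ θ.2⟩ _ (hE θ x hx)

variable [IsManifold (𝓡 m) 1 M] [RiemannianBundle (fun p : M => TangentSpace (𝓡 m) p)]
  [IsContinuousRiemannianBundle (EuclideanSpace ℝ (Fin m)) (fun p : M => TangentSpace (𝓡 m) p)]

theorem continuous_norm_tangentBundle :
    Continuous fun v : TangentBundle (𝓡 m) M => ‖v.2‖ := by
  have h1 : Continuous fun v : TangentBundle (𝓡 m) M => inner ℝ v.2 v.2 :=
    Continuous.inner_bundle (F := EuclideanSpace ℝ (Fin m))
      (E := fun p : M => TangentSpace (𝓡 m) p) (b := fun v : TangentBundle (𝓡 m) M => v.1)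
      (v := fun v => v.2) (w := fun v => v.2) continuous_id continuous_id
  exact (Real.continuous_sqrt.comp h1).congr fun v => (norm_eq_sqrt_real_inner _).symm

/-- By continuity of the metric, norm-bounded vectors over a convergent base point lie in a compact
ball of a local trivialization. -/
theorem exists_tendsto_of_norm_le {α : Type*} {U : Ultrafilter α} {v : α → TangentBundle (𝓡 m) M}
    {p : M} (hp : Tendsto (fun a => (v a).1) U (𝓝 p)) {r : ℝ} (hr : ∀ᶠ a in U, ‖(v a).2‖ ≤ r) :
    ∃ ξ, Tendsto v U (𝓝 ξ) := by
  set e := trivializationAt (EuclideanSpace ℝ (Fin m)) (fun p : M => TangentSpace (𝓡 m) p) p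
  obtain ⟨C, hC, hCe⟩ := eventually_norm_trivializationAt_lt (EuclideanSpace ℝ (Fin m))
    (fun p : M => TangentSpace (𝓡 m) p) p
  have hbase : ∀ᶠ a in U, (v a).1 ∈ e.baseSet :=
    hp (e.open_baseSet.mem_nhds (FiberBundle.mem_baseSet_trivializationAt' p))
  have hb : ∀ᶠ a in U, (e (v a)).2 ∈ Metric.closedBall (0 : EuclideanSpace ℝ (Fin m)) (C * r) := by
    filter_upwards [hp.eventually hCe, hr, hbase] with a h1 h2 h3
    rw [mem_closedBall_zero_iff]
    have h4 : (e (v a)).2 = e.continuousLinearMapAt ℝ (v a).1 (v a).2 := by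
      rw [Trivialization.continuousLinearMapAt_apply, Trivialization.linearMapAt_apply, if_pos h3]
    rw [h4]
    exact ((e.continuousLinearMapAt ℝ (v a).1).le_opNorm _).trans
      (mul_le_mul h1.le h2 (norm_nonneg _) hC.le)
  obtain ⟨x, -, hx⟩ := (isCompact_closedBall (0 : EuclideanSpace ℝ (Fin m))
    (C * r)).ultrafilter_le_nhds (U.map fun a => (e (v a)).2) (le_principal_iff.2 hb)
  have h5 : Tendsto (fun a => ((v a).1, (e (v a)).2)) U (𝓝 (p, x)) := hp.prodMk_nhds hx
  have h6 : (p, x) ∈ e.target := by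
    rw [e.mem_target]; exact FiberBundle.mem_baseSet_trivializationAt' p
  refine ⟨e.toOpenPartialHomeomorph.symm (p, x),
    ((e.toOpenPartialHomeomorph.continuousAt_symm h6).tendsto.comp h5).congr' ?_⟩
  filter_upwards [hbase] with a ha
  have h7 : e (v a) = ((v a).1, (e (v a)).2) :=
    Prod.ext (e.coe_fst (e.mem_source.2 ha)) rfl
  simp only [Function.comp_apply]
  rw [← h7]
  exact e.toOpenPartialHomeomorph.left_inv (e.mem_source.2 ha)

/-- Each growth inequality compares continuous functions on `TM`, the norm being continuous and the
`g i` of class `C¹`. Their intersection over the closed set `Λ` is closed; this applies to all three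
invariant bundles. -/
theorem isClosed_of_mem_iff_norm_le [T2Space M] {Λ : Set M} (hΛ : IsClosed Λ) {ι : Type*}
    {E : ∀ θ : Λ, Submodule ℝ (TangentSpace (𝓡 m) (θ : M))} {g : ι → M → M}
    (hg : ∀ i, ContMDiff (𝓡 m) (𝓡 m) 1 (g i)) {I : Set ι} {a : ι → ℝ}
    (hE : ∀ (θ : Λ) (x : TangentSpace (𝓡 m) (θ : M)), x ∈ E θ ↔
      ∀ i ∈ I, ‖mfderiv (𝓡 m) (𝓡 m) (g i) (θ : M) x‖ ≤ a i * ‖x‖) :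
    IsClosed {v : TangentBundle (𝓡 m) M | ∃ hv : v.1 ∈ Λ, v.2 ∈ E ⟨v.1, hv⟩} := by
  have h1 : {v : TangentBundle (𝓡 m) M | ∃ hv : v.1 ∈ Λ, v.2 ∈ E ⟨v.1, hv⟩} =
      (fun v : TangentBundle (𝓡 m) M => v.1) ⁻¹' Λ ∩ ⋂ i ∈ I, {v : TangentBundle (𝓡 m) M |
        ‖(tangentMap (𝓡 m) (𝓡 m) (g i) v).2‖ ≤ a i * ‖v.2‖} := by
    ext v
    simp only [mem_ofPred_eq, mem_inter_iff, mem_preimage, mem_iInter]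
    exact ⟨fun ⟨hv, h⟩ => ⟨hv, (hE ⟨v.1, hv⟩ v.2).1 h⟩, fun ⟨hv, h⟩ =>
      ⟨hv, (hE ⟨v.1, hv⟩ v.2).2 h⟩⟩
  rw [h1]
  refine (hΛ.preimage (FiberBundle.continuous_proj (EuclideanSpace ℝ (Fin m))
    (TangentSpace (𝓡 m) : M → Type _))).inter (isClosed_biInter fun i _ => ?_)
  exact isClosed_le (continuous_norm_tangentBundle.comp ((hg i).continuous_tangentMap le_rfl))
    (continuous_const.mul continuous_norm_tangentBundle)

namespace IsNormallyHyperbolic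

variable {c u s : ℕ} {f : M ≃ₘ^1⟮𝓡 m, 𝓡 m⟯ M} {Λ : Set M}
    [ChartedSpace (EuclideanSpace ℝ (Fin c)) Λ]
    {Eu Es : ∀ θ : Λ, Submodule ℝ (TangentSpace (𝓡 m) (θ : M))} {C lam mu : ℝ}

theorem isClosed_u [T2Space M] (hf : IsNormallyHyperbolic c f Λ u s Eu Es C lam mu)
    (hΛ : IsClosed Λ) :
    IsClosed {v : TangentBundle (𝓡 m) M | ∃ hv : v.1 ∈ Λ, v.2 ∈ Eu ⟨v.1, hv⟩} :=
  isClosed_of_mem_iff_norm_le hΛ (contMDiff_diffeoIter f) (I := {i | i ≤ 0})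
    (a := fun i => C * lam ^ i.natAbs) hf.mem_u_iff

theorem isClosed_s [T2Space M] (hf : IsNormallyHyperbolic c f Λ u s Eu Es C lam mu)
    (hΛ : IsClosed Λ) :
    IsClosed {v : TangentBundle (𝓡 m) M | ∃ hv : v.1 ∈ Λ, v.2 ∈ Es ⟨v.1, hv⟩} :=
  isClosed_of_mem_iff_norm_le hΛ (contMDiff_diffeoIter f) (I := {i | 0 ≤ i})
    (a := fun i => C * lam ^ i.natAbs) hf.mem_s_iff

theorem isClosed_c [T2Space M] (hf : IsNormallyHyperbolic c f Λ u s Eu Es C lam mu)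
    (hΛ : IsClosed Λ) :
    IsClosed {v : TangentBundle (𝓡 m) M | ∃ hv : v.1 ∈ Λ, v.2 ∈ tangentAlong c Λ ⟨v.1, hv⟩} :=
  isClosed_of_mem_iff_norm_le hΛ (contMDiff_diffeoIter f) (I := univ)
    (a := fun i => C * mu ^ i.natAbs) fun θ x => (hf.mem_c_iff θ x).trans (by simp)

theorem mapsTo (hf : IsNormallyHyperbolic c f Λ u s Eu Es C lam mu) : MapsTo f Λ Λ :=
  mapsTo_iff_image_subset.2 hf.image_eq.subset

theorem norm_mfderiv_iterate_le (hf : IsNormallyHyperbolic c f Λ u s Eu Es C lam mu) (k : ℕ)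
    {θ : Λ} {y : TangentSpace (𝓡 m) (θ : M)} (hy : y ∈ Es θ) :
    ‖mfderiv (𝓡 m) (𝓡 m) f^[k] (θ : M) y‖ ≤ C * lam ^ k * ‖y‖ := by
  have h1 := (hf.mem_s_iff θ y).1 hy k (Int.natCast_nonneg k)
  rw [diffeoIter_natCast, Int.natAbs_natCast] at h1
  exact h1

theorem mfderiv_iterate_mem_u (hf : IsNormallyHyperbolic c f Λ u s Eu Es C lam mu) (k : ℕ) :
    ∀ θ : Λ, ∀ x ∈ Eu θ, mfderiv (𝓡 m) (𝓡 m) f^[k] (θ : M) x ∈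
      Eu ⟨f^[k] θ, hf.mapsTo.iterate k θ.2⟩ :=
  mfderiv_iterate_mem (f.contMDiff.mdifferentiable (by simp)) hf.mapsTo
    (fun θ _ hx => (hf.map_u θ).le (Submodule.mem_map_of_mem hx)) k

theorem mfderiv_iterate_mem_s (hf : IsNormallyHyperbolic c f Λ u s Eu Es C lam mu) (k : ℕ) :
    ∀ θ : Λ, ∀ x ∈ Es θ, mfderiv (𝓡 m) (𝓡 m) f^[k] (θ : M) x ∈
      Es ⟨f^[k] θ, hf.mapsTo.iterate k θ.2⟩ :=
  mfderiv_iterate_mem (f.contMDiff.mdifferentiable (by simp)) hf.mapsTo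
    (fun θ _ hx => (hf.map_s θ).le (Submodule.mem_map_of_mem hx)) k

theorem mfderiv_iterate_mem_c (hf : IsNormallyHyperbolic c f Λ u s Eu Es C lam mu) (k : ℕ) :
    ∀ θ : Λ, ∀ x ∈ tangentAlong c Λ θ, mfderiv (𝓡 m) (𝓡 m) f^[k] (θ : M) x ∈
      tangentAlong c Λ ⟨f^[k] θ, hf.mapsTo.iterate k θ.2⟩ :=
  mfderiv_iterate_mem (f.contMDiff.mdifferentiable (by simp)) hf.mapsTo
    (fun θ _ hx => (hf.map_c θ).le (Submodule.mem_map_of_mem hx)) k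

/-- Expansion is backward contraction: apply the bound on `Eu` for the iterate `-k` to the image
vector, which lies in `Eu` by invariance. -/
theorem norm_le_mfderiv_iterate (hf : IsNormallyHyperbolic c f Λ u s Eu Es C lam mu) (k : ℕ)
    {θ : Λ} {x : TangentSpace (𝓡 m) (θ : M)} (hx : x ∈ Eu θ) :
    ‖x‖ ≤ C * lam ^ k * ‖mfderiv (𝓡 m) (𝓡 m) f^[k] (θ : M) x‖ := by
  have h1 := (hf.mem_u_iff _ _).1 (hf.mfderiv_iterate_mem_u k θ x hx) (-k) (by simp)
  rw [diffeoIter_neg_natCast, Int.natAbs_neg, Int.natAbs_natCast] at h1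
  refine le_trans (le_of_eq ?_) h1
  have h2 : f.symm^[k] ∘ f^[k] = id :=
    funext ((show Function.LeftInverse f.symm f from f.symm_apply_apply).iterate k)
  have h3 : ∀ φ : M → M, φ = id → ‖mfderiv (𝓡 m) (𝓡 m) φ (θ : M) x‖ = ‖x‖ := by
    rintro φ rfl
    rw [mfderiv_id]
    rfl
  rw [← h3 _ h2, mfderiv_comp (θ : M)
    ((contMDiff_iterate f.symm.contMDiff k).mdifferentiable (by simp) _)
    ((contMDiff_iterate f.contMDiff k).mdifferentiable (by simp) _)]
  rfl

end IsNormallyHyperbolic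

end Dynamics

/-! ### Compactness of the disc bundle -/

section WhitneyNorm

variable {m u s : ℕ} {M : Type*} [TopologicalSpace M] [ChartedSpace (EuclideanSpace ℝ (Fin m)) M]
  [IsManifold (𝓡 m) 1 M]
  {Λ : Set M} {Eu Es : ∀ θ : Λ, Submodule ℝ (TangentSpace (𝓡 m) (θ : M))}

theorem continuous_whitneyMap {g : M → M} (hg1 : ContMDiff (𝓡 m) (𝓡 m) 1 g) (hg : MapsTo g Λ Λ)
    (hu : ∀ θ : Λ, ∀ x ∈ Eu θ, mfderiv (𝓡 m) (𝓡 m) g (θ : M) x ∈ Eu ⟨g θ, hg θ.2⟩)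
    (hs : ∀ θ : Λ, ∀ y ∈ Es θ, mfderiv (𝓡 m) (𝓡 m) g (θ : M) y ∈ Es ⟨g θ, hg θ.2⟩) :
    Continuous (whitneyMap (u := u) (s := s) g hg hu hs) := by
  have h1 := hg1.continuous_tangentMap le_rfl
  rw [isInducing_whitneyPair.continuous_iff]
  exact (h1.comp isInducing_whitneyPair.continuous.fst).prodMk
    (h1.comp isInducing_whitneyPair.continuous.snd)

variable [RiemannianBundle (fun p : M => TangentSpace (𝓡 m) p)]
  [IsContinuousRiemannianBundle (EuclideanSpace ℝ (Fin m)) (fun p : M => TangentSpace (𝓡 m) p)]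

theorem continuous_norm_whitney_fst : Continuous fun v : WhitneySum u s Eu Es => ‖v.2.1‖ :=
  continuous_norm_tangentBundle.comp isInducing_whitneyPair.continuous.fst

theorem continuous_norm_whitney_snd : Continuous fun v : WhitneySum u s Eu Es => ‖v.2.2‖ :=
  continuous_norm_tangentBundle.comp isInducing_whitneyPair.continuous.snd

theorem norm_whitneyScale_fst (a b : ℝ) (v : WhitneySum u s Eu Es) :
    ‖(whitneyScale a b v).2.1‖ = |a| * ‖v.2.1‖ :=
  norm_smul a (v.2.1 : TangentSpace (𝓡 m) (v.1 : M))

theorem norm_whitneyScale_snd (a b : ℝ) (v : WhitneySum u s Eu Es) :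
    ‖(whitneyScale a b v).2.2‖ = |b| * ‖v.2.2‖ :=
  norm_smul b (v.2.2 : TangentSpace (𝓡 m) (v.1 : M))

/-- Along an ultrafilter the base points converge because `Λ` is compact, and the bounded components
converge in `TM`. Closedness of the two families puts the limits in `Eu` and `Es`. -/
theorem isCompact_discBundle [T2Space M] [CompactSpace Λ]
    (hEu : IsClosed {v : TangentBundle (𝓡 m) M | ∃ hv : v.1 ∈ Λ, v.2 ∈ Eu ⟨v.1, hv⟩})
    (hEs : IsClosed {v : TangentBundle (𝓡 m) M | ∃ hv : v.1 ∈ Λ, v.2 ∈ Es ⟨v.1, hv⟩}) :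
    IsCompact (discBundle (EuclideanSpace ℝ (Fin u)) (SubFiber Eu)
      (EuclideanSpace ℝ (Fin s)) (SubFiber Es)) := by
  rw [isCompact_iff_ultrafilter_le_nhds]
  intro U hU
  have hU' : ∀ᶠ v : WhitneySum u s Eu Es in U, ‖v.2.1‖ ≤ 1 ∧ ‖v.2.2‖ ≤ 1 := le_principal_iff.1 hU
  obtain ⟨θ₀, -, hθ₀⟩ := isCompact_univ.ultrafilter_le_nhds
    (U.map fun v : WhitneySum u s Eu Es => v.1) (by simp)
  have hp : Tendsto (fun v : WhitneySum u s Eu Es => (v.1 : M)) U (𝓝 (θ₀ : M)) :=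
    (continuous_subtype_val.tendsto θ₀).comp hθ₀
  obtain ⟨ξ, hξ⟩ := exists_tendsto_of_norm_le (v := fun v => (whitneyPair v).1) hp
    (hU'.mono fun v hv => hv.1)
  obtain ⟨ζ, hζ⟩ := exists_tendsto_of_norm_le (v := fun v => (whitneyPair v).2) hp
    (hU'.mono fun v hv => hv.2)
  obtain ⟨h1, hξu⟩ := hEu.mem_of_tendsto hξ (Eventually.of_forall fun v => ⟨v.1.2, v.2.1.2⟩)
  obtain ⟨h2, hζs⟩ := hEs.mem_of_tendsto hζ (Eventually.of_forall fun v => ⟨v.1.2, v.2.2.2⟩)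
  have hcp := FiberBundle.continuous_proj (EuclideanSpace ℝ (Fin m))
    (TangentSpace (𝓡 m) : M → Type _)
  have h3 : ξ.1 = ζ.1 := (tendsto_nhds_unique ((hcp.tendsto ξ).comp hξ) hp).trans
    (tendsto_nhds_unique ((hcp.tendsto ζ).comp hζ) hp).symm
  obtain ⟨p, ξ⟩ := ξ
  obtain ⟨q, ζ⟩ := ζ
  obtain rfl : p = q := h3
  set v₀ : WhitneySum u s Eu Es := ⟨⟨p, h1⟩, (⟨ξ, hξu⟩, ⟨ζ, hζs⟩)⟩
  have h4 : (U : Filter (WhitneySum u s Eu Es)) ≤ 𝓝 v₀ :=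
    (isInducing_whitneyPair.tendsto_nhds_iff (f := id)).2 (hξ.prodMk_nhds hζ)
  exact ⟨v₀, ⟨le_of_tendsto ((continuous_norm_whitney_fst.tendsto v₀).mono_left h4)
      (hU'.mono fun v hv => hv.1),
    le_of_tendsto ((continuous_norm_whitney_snd.tendsto v₀).mono_left h4)
      (hU'.mono fun v hv => hv.2)⟩, h4⟩

end WhitneyNorm

/-! ### The covering relation for a small disc bundle -/

section Covering

variable {m c u s : ℕ} {M : Type*} [TopologicalSpace M]
  [ChartedSpace (EuclideanSpace ℝ (Fin m)) M] [IsManifold (𝓡 m) 1 M]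
  [RiemannianBundle (fun p : M => TangentSpace (𝓡 m) p)]
  [IsContinuousRiemannianBundle (EuclideanSpace ℝ (Fin m)) (fun p : M => TangentSpace (𝓡 m) p)]
  {Λ : Set M} [ChartedSpace (EuclideanSpace ℝ (Fin c)) Λ]
  {Eu Es : ∀ θ : Λ, Submodule ℝ (TangentSpace (𝓡 m) (θ : M))}

/-- If the rescalings of `g` in a tubular neighbourhood converge to the map induced by the
derivative of `g`, which expands the first summand and contracts the second, then a small disc
bundle covers itself. -/
theorem exists_neighbourhoodCovers
    (hcomp : IsCompact (discBundle (EuclideanSpace ℝ (Fin u)) (SubFiber Eu)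
      (EuclideanSpace ℝ (Fin s)) (SubFiber Es)))
    (hsc : Continuous fun q : ℝ × ℝ × WhitneySum u s Eu Es => whitneyScale q.1 q.2.1 q.2.2)
    {g : M → M} (hg1 : ContMDiff (𝓡 m) (𝓡 m) 1 g) (hg : MapsTo g Λ Λ)
    (hu : ∀ θ : Λ, ∀ x ∈ Eu θ, mfderiv (𝓡 m) (𝓡 m) g (θ : M) x ∈ Eu ⟨g θ, hg θ.2⟩)
    (hs : ∀ θ : Λ, ∀ y ∈ Es θ, mfderiv (𝓡 m) (𝓡 m) g (θ : M) y ∈ Es ⟨g θ, hg θ.2⟩)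
    (hux : ∀ θ : Λ, ∀ x ∈ Eu θ, ‖x‖ = 1 → 1 < ‖mfderiv (𝓡 m) (𝓡 m) g (θ : M) x‖)
    (hsx : ∀ θ : Λ, ∀ y ∈ Es θ, ‖y‖ ≤ 1 → ‖mfderiv (𝓡 m) (𝓡 m) g (θ : M) y‖ < 1)
    {η : C(Λ, Λ)} (hη : ∀ θ, η θ = ⟨g θ, hg θ.2⟩) (hdeg : degTwo c η ≠ 0)
    {e₀ : OpenPartialHomeomorph M (WhitneySum u s Eu Es)} (heΛ : Λ ⊆ e₀.source)
    (he0 : ∀ θ : Λ, e₀ θ = ⟨θ, (0, 0)⟩)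
    (hlim : ∀ (v₀ : WhitneySum u s Eu Es) (l : Filter (ℝ × WhitneySum u s Eu Es)),
      l ≤ 𝓝 (0, v₀) → (∀ᶠ q in l, q.1 ≠ 0) →
      Tendsto (fun q => whitneyScale q.1⁻¹ q.1⁻¹ (e₀ (g (e₀.symm (whitneyScale q.1 q.1 q.2)))))
        l (𝓝 (whitneyMap g hg hu hs v₀))) :
    ∃ D : Set M, NeighbourhoodCovers c Λ u s Eu Es g D := by
  classical
  obtain rfl : η = ⟨fun θ => ⟨g θ, hg θ.2⟩,
      (hg1.continuous.comp continuous_subtype_val).subtype_mk _⟩ := ContinuousMap.ext hη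
  set disc := discBundle (EuclideanSpace ℝ (Fin u)) (SubFiber Eu)
    (EuclideanSpace ℝ (Fin s)) (SubFiber Es) with hdisc
  set G := whitneyMap (u := u) (s := s) g hg hu hs with hG
  -- The rescaled maps, completed at scale zero by the bundle map of the derivative. The limit
  -- hypothesis is exactly continuity of `H` there.
  set H : ℝ × WhitneySum u s Eu Es → WhitneySum u s Eu Es := fun q => if q.1 = 0 then G q.2 else
    whitneyScale q.1⁻¹ q.1⁻¹ (e₀ (g (e₀.symm (whitneyScale q.1 q.1 q.2)))) with hH
  have hH0 : ∀ v, ContinuousAt H (0, v) := by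
    intro v
    have h1 : H (0, v) = G v := if_pos rfl
    rw [ContinuousAt, h1]
    refine Tendsto.if ?_ (hlim v _ inf_le_left (mem_inf_of_right (mem_principal_self _)))
    exact (((continuous_whitneyMap hg1 hg hu hs).comp continuous_snd).tendsto (0, v)).mono_left
      inf_le_left
  have hsc2 : Continuous fun q : ℝ × WhitneySum u s Eu Es => whitneyScale q.1 q.1 q.2 :=
    hsc.comp (continuous_fst.prodMk (continuous_fst.prodMk continuous_snd))
  -- all the conditions hold near the zero section
  have hev : ∀ᶠ τ : ℝ in 𝓝 0, ∀ v ∈ disc, whitneyScale τ τ v ∈ e₀.target ∧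
      g (e₀.symm (whitneyScale τ τ v)) ∈ e₀.source ∧ ‖(H (τ, v)).2.2‖ < 1 ∧
      (‖v.2.1‖ = 1 → 1 < ‖(H (τ, v)).2.1‖) := by
    refine hcomp.eventually_forall_of_forall_eventually fun v hv => ?_
    have hs0 : whitneyScale (0 : ℝ) 0 v = e₀ v.1 := by rw [whitneyScale_zero, he0]
    have hvs : (v.1 : M) ∈ e₀.source := heΛ v.1.2
    have h0 : ContinuousAt (fun q : ℝ × WhitneySum u s Eu Es => whitneyScale q.1 q.1 q.2) (0, v) :=
      hsc2.continuousAt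
    have h1 : ∀ᶠ q : ℝ × WhitneySum u s Eu Es in 𝓝 (0, v),
        whitneyScale q.1 q.1 q.2 ∈ e₀.target := by
      refine h0 (e₀.open_target.mem_nhds ?_)
      simp only [hs0]
      exact e₀.map_source hvs
    have h2 : ∀ᶠ q : ℝ × WhitneySum u s Eu Es in 𝓝 (0, v),
        g (e₀.symm (whitneyScale q.1 q.1 q.2)) ∈ e₀.source := by
      have h3 : ContinuousAt e₀.symm (whitneyScale (0 : ℝ) 0 v) := by
        rw [hs0]; exact e₀.continuousAt_symm (e₀.map_source hvs)
      have h4 : ContinuousAt (fun q : ℝ × WhitneySum u s Eu Es =>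
          g (e₀.symm (whitneyScale q.1 q.1 q.2))) (0, v) :=
        hg1.continuous.continuousAt.comp (ContinuousAt.comp (g := e₀.symm) h3 h0)
      refine h4 (e₀.open_source.mem_nhds ?_)
      simp only [hs0]
      rw [e₀.left_inv hvs]
      exact heΛ (hg v.1.2)
    have hHv : H (0, v) = G v := if_pos rfl
    have h5 : ∀ᶠ q in 𝓝 ((0 : ℝ), v), ‖(H q).2.2‖ < 1 := by
      have h6 := continuous_norm_whitney_snd.continuousAt.comp (hH0 v)
      refine h6.eventually_lt continuousAt_const ?_
      change ‖(H (0, v)).2.2‖ < 1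
      rw [hHv]
      exact hsx v.1 v.2.2 v.2.2.2 hv.2
    -- Near a vector whose unstable norm is not `1` the implication is vacuous.
    have h7 : ∀ᶠ q in 𝓝 ((0 : ℝ), v), ‖q.2.2.1‖ = 1 → 1 < ‖(H q).2.1‖ := by
      by_cases h8 : ‖v.2.1‖ = 1
      · have h6 := continuous_norm_whitney_fst.continuousAt.comp (hH0 v)
        have h9 := continuousAt_const.eventually_lt h6 (f := fun _ => (1 : ℝ)) (by
          change 1 < ‖(H (0, v)).2.1‖
          rw [hHv]
          exact hux v.1 v.2.1 v.2.1.2 h8)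
        filter_upwards [h9] with q hq _ using hq
      · have h6 : ContinuousAt (fun q : ℝ × WhitneySum u s Eu Es => ‖q.2.2.1‖) (0, v) :=
          (continuous_norm_whitney_fst.comp continuous_snd).continuousAt
        filter_upwards [h6.eventually_ne h8] with q hq h10 using (hq h10).elim
    filter_upwards [h1, h2, h5, h7] with q q1 q2 q3 q4 using ⟨q1, q2, q3, q4⟩
  obtain ⟨δ, hδ, hball⟩ := Metric.eventually_nhds_iff.1 hev
  -- Half of `δ`, so that the whole closed interval `[0, ε]` of scales is admissible: the homotopy
  -- runs through all of them.
  set ε : ℝ := δ / 2 with hε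
  have hε0 : 0 < ε := by positivity
  have hsmall : ∀ τ ∈ Icc 0 ε, ∀ v ∈ disc, whitneyScale τ τ v ∈ e₀.target ∧
      g (e₀.symm (whitneyScale τ τ v)) ∈ e₀.source ∧ ‖(H (τ, v)).2.2‖ < 1 ∧
      (‖v.2.1‖ = 1 → 1 < ‖(H (τ, v)).2.1‖) := fun τ hτ => hball (by
    rw [Real.dist_eq, sub_zero, abs_of_nonneg hτ.1]
    linarith [hτ.2])
  have hHc : ∀ τ ∈ Icc 0 ε, ∀ v ∈ disc, ContinuousAt H (τ, v) := by
    intro τ hτ v hv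
    by_cases h0 : τ = 0
    · rw [h0]; exact hH0 v
    obtain ⟨h1, h2, -⟩ := hsmall τ hτ v hv
    have h3 : ContinuousAt (fun q : ℝ × WhitneySum u s Eu Es =>
        e₀ (g (e₀.symm (whitneyScale q.1 q.1 q.2)))) (τ, v) :=
      ContinuousAt.comp (g := e₀) (e₀.continuousAt h2) (hg1.continuous.continuousAt.comp
        (ContinuousAt.comp (g := e₀.symm) (e₀.continuousAt_symm h1) hsc2.continuousAt))
    have h4 : ContinuousAt (fun q : ℝ × WhitneySum u s Eu Es => q.1⁻¹) (τ, v) :=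
      continuousAt_fst.inv₀ h0
    have h5 := ContinuousAt.comp (x := (τ, v)) (f := fun q : ℝ × WhitneySum u s Eu Es =>
      (q.1⁻¹, q.1⁻¹, e₀ (g (e₀.symm (whitneyScale q.1 q.1 q.2))))) hsc.continuousAt
      (h4.prodMk (h4.prodMk h3))
    refine h5.congr ?_
    have h6 : ∀ᶠ q : ℝ × WhitneySum u s Eu Es in 𝓝 (τ, v), q.1 ≠ 0 :=
      continuousAt_fst.eventually_ne h0
    filter_upwards [h6] with q hq using (if_neg hq).symm
  have hinv : ∀ a b : ℝ, a * b = 1 → ∀ v : WhitneySum u s Eu Es,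
      whitneyScale a a (whitneyScale b b v) = v := fun a b hab v => by
    rw [whitneyScale_whitneyScale, hab, whitneyScale_one]
  have hsc1 : ∀ a b : ℝ, Continuous fun v : WhitneySum u s Eu Es => whitneyScale a b v :=
    fun a b => hsc.comp (continuous_const.prodMk (continuous_const.prodMk continuous_id))
  let S : WhitneySum u s Eu Es ≃ₜ WhitneySum u s Eu Es :=
    { toFun := whitneyScale ε⁻¹ ε⁻¹
      invFun := whitneyScale ε ε
      left_inv := hinv _ _ (mul_inv_cancel₀ hε0.ne')
      right_inv := hinv _ _ (inv_mul_cancel₀ hε0.ne')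
      continuous_toFun := hsc1 _ _
      continuous_invFun := hsc1 _ _ }
  set e := e₀.transHomeomorph S with he
  have heε : ε ∈ Icc 0 ε := ⟨hε0.le, le_rfl⟩
  have hdt : disc ⊆ e.target := fun v hv => (hsmall ε heε v hv).1
  have heθ : ∀ θ : Λ, e θ = ⟨θ, (0, 0)⟩ := by
    intro θ
    change whitneyScale ε⁻¹ ε⁻¹ (e₀ θ) = _
    rw [he0, ← whitneyScale_zero (⟨θ, (0, 0)⟩ : WhitneySum u s Eu Es), whitneyScale_whitneyScale,
      mul_zero, whitneyScale_zero]
  have hF : ∀ v, e (g (e.symm v)) = H (ε, v) := fun v => (if_neg hε0.ne').symm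
  refine ⟨e.source ∩ e ⁻¹' disc, e, ?_, heΛ, inter_subset_left, heθ, ?_, ?_, ?_, ?_⟩
  · rw [mem_nhdsSet_iff_forall]
    intro p hp
    refine inter_mem (e.open_source.mem_nhds (heΛ hp)) ((e.continuousAt (heΛ hp)) ?_)
    have h1 : ∀ᶠ v : WhitneySum u s Eu Es in 𝓝 (e p), ‖v.2.1‖ < 1 :=
      continuous_norm_whitney_fst.continuousAt.eventually_lt continuousAt_const (by
        rw [heθ ⟨p, hp⟩]; simp)
    have h2 : ∀ᶠ v : WhitneySum u s Eu Es in 𝓝 (e p), ‖v.2.2‖ < 1 :=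
      continuous_norm_whitney_snd.continuousAt.eventually_lt continuousAt_const (by
        rw [heθ ⟨p, hp⟩]; simp)
    filter_upwards [h1, h2] with v q1 q2 using ⟨q1.le, q2.le⟩
  · rw [e.image_source_inter_eq']
    ext v
    refine ⟨fun hv => ?_, fun hv => ⟨hdt hv, ?_⟩⟩
    · have := hv.2
      rw [mem_preimage, mem_preimage, e.right_inv hv.1] at this
      exact this
    · rw [mem_preimage, mem_preimage, e.right_inv (hdt hv)]
      exact hv
  · rintro p ⟨hp, hpd⟩
    have h1 := (hsmall ε heε (e p) hpd).2.1
    have h2 : e₀.symm (whitneyScale ε ε (e p)) = p := e.left_inv hp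
    rw [h2] at h1
    exact h1
  · have h1 : ∀ v : disc, e (g (e.symm v.1)) = H (ε, v.1) := fun v => hF v
    refine Continuous.congr ?_ fun v => (h1 v).symm
    rw [continuous_iff_continuousAt]
    intro v
    exact ContinuousAt.comp (g := H) (hHc ε heε v.1 v.2)
      (continuous_const.prodMk continuous_subtype_val).continuousAt
  · have hτ : ∀ t : unitInterval, ε * (1 - t) ∈ Icc 0 ε := fun t =>
      ⟨mul_nonneg hε0.le (sub_nonneg.2 t.2.2), by
        have := t.2.1
        nlinarith⟩
    -- The scale slides from `ε` to `0`, turning the map into its linearization, while the factor `1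
    -- - t` collapses the stable component. The unstable component is not damped, so the exit
    -- condition persists, and damping can only help avoid the entry set.
    refine ⟨fun q => whitneyScale 1 (1 - q.1) (H (ε * (1 - q.1), q.2.1)), ?_, ?_, ?_, ?_, ⟨_, _⟩,
      hdeg, fun θ => (mfderiv (𝓡 m) (𝓡 m) g (θ : M)).toLinearMap.restrict (hu θ), ?_, ?_⟩
    · have h1 : Continuous fun q : unitInterval × disc => H (ε * (1 - q.1), q.2.1) := by
        rw [continuous_iff_continuousAt]
        intro q
        have h2 : Continuous fun q : unitInterval × disc =>
            (ε * (1 - (q.1 : ℝ)), (q.2.1 : WhitneySum u s Eu Es)) := by fun_prop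
        exact ContinuousAt.comp (g := H) (hHc _ (hτ q.1) q.2.1 q.2.2) h2.continuousAt
      have h3 : Continuous fun q : unitInterval × disc => (1 - (q.1 : ℝ)) := by fun_prop
      exact hsc.comp (continuous_const.prodMk (h3.prodMk h1))
    · intro v
      have h1 : 1 - ((0 : unitInterval) : ℝ) = 1 := sub_zero 1
      change whitneyScale 1 (1 - ((0 : unitInterval) : ℝ)) (H (ε * (1 - (0 : unitInterval)), v)) = _
      rw [h1, mul_one, whitneyScale_one]
      exact (hF v.1).symm
    · intro t v hv hd
      have h1 := (hsmall _ (hτ t) v.1 v.2).2.2.2 hv.1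
      have h2 := hd.1
      rw [norm_whitneyScale_fst, abs_one, one_mul] at h2
      exact absurd h1 (not_lt.2 h2)
    · intro t v hd
      have h1 := (hsmall _ (hτ t) v.1 v.2).2.2.1
      have h2 := hd.2
      rw [norm_whitneyScale_snd, abs_of_nonneg (sub_nonneg.2 t.2.2)] at h2
      have h3 := t.2.1
      have h4 := t.2.2
      nlinarith [norm_nonneg (H (ε * (1 - (t : ℝ)), v.1)).2.2]
    · intro θ x hx
      exact hux θ x x.2 hx
    · intro v
      have h1 : H (0, v.1) = G v.1 := if_pos rfl
      have h2 : 1 - ((1 : unitInterval) : ℝ) = 0 := sub_self 1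
      change whitneyScale 1 (1 - ((1 : unitInterval) : ℝ)) (H (ε * (1 - (1 : unitInterval)), v)) = _
      rw [h2, mul_zero, h1]
      simp only [whitneyScale, one_smul, zero_smul]
      rfl

end Covering

end

/-! ### Assembly of the theorem -/

theorem mainTheorem5 {m c u s : ℕ} {M : Type*} [TopologicalSpace M] [T2Space M]
    [SecondCountableTopology M] [ChartedSpace (EuclideanSpace ℝ (Fin m)) M]
    [IsManifold (𝓡 m) ∞ M]
    [RiemannianBundle (fun p : M => TangentSpace (𝓡 m) p)]
    [IsContinuousRiemannianBundle (EuclideanSpace ℝ (Fin m))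
      (fun p : M => TangentSpace (𝓡 m) p)]
    (f : M ≃ₘ^1⟮𝓡 m, 𝓡 m⟯ M)
    (Λ : Set M) [CompactSpace Λ] [ConnectedSpace Λ]
    [ChartedSpace (EuclideanSpace ℝ (Fin c)) Λ] [IsManifold (𝓡 c) ∞ Λ]
    (hΛ : Manifold.IsSmoothEmbedding (𝓡 c) (𝓡 m) ∞ (Subtype.val : Λ → M))
    (Eu Es : ∀ θ : Λ, Submodule ℝ (TangentSpace (𝓡 m) (θ : M))) (C lam mu : ℝ)
    (hf : IsNormallyHyperbolic c f Λ u s Eu Es C lam mu)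
    (k : ℕ) (hk : Real.logb lam (1 / C) < k) :
    ∃ D : Set M, NeighbourhoodCovers c Λ u s Eu Es (f^[k]) D := by
  have hΛc : IsCompact Λ := isCompact_iff_compactSpace.2 inferInstance
  have hM : IsManifold (𝓡 c) 2 Λ := IsManifold.of_le (n := ∞) (WithTop.coe_le_coe.2 (le_top : (2 : ℕ∞) ≤ ⊤))
  have hM1 : IsManifold (𝓡 c) 1 Λ := IsManifold.of_le (n := 2) (by norm_num)
  -- the constant of the iterate
  have hlam1 : lam < 1 := hf.lam_lt.trans hf.mu_inv_lt
  have hCk : C * lam ^ k < 1 := by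
    have h1 : Real.logb lam (1 / C) < Real.logb lam (lam ^ k) := by
      rwa [Real.logb_pow, Real.logb_self_eq_one_iff.2 ⟨hf.lam_pos.ne', hlam1.ne, by linarith [hf.lam_pos]⟩, mul_one]
    -- The base is less than `1`, so comparing logarithms reverses the inequality and gives `lam ^ k
    -- < 1 / C`.
    rw [Real.logb_lt_logb_iff_of_base_lt_one hf.lam_pos hlam1 (by have := hf.C_pos; positivity)
      (by have := hf.lam_pos; positivity), lt_div_iff₀ hf.C_pos] at h1
    rwa [mul_comm]
  have hCk0 : 0 < C * lam ^ k := mul_pos hf.C_pos (pow_pos hf.lam_pos k)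
  -- the embedding of `Λ`
  have hv : ContMDiff (𝓡 c) (𝓡 m) ∞ (Subtype.val : Λ → M) := hΛ.contMDiff
  have hv1 : ContMDiff (𝓡 c) (𝓡 m) 1 (Subtype.val : Λ → M) :=
    hv.of_le (by exact_mod_cast le_top)
  have hvi : ∀ θ, Function.Injective (mfderiv (𝓡 c) (𝓡 m) (Subtype.val : Λ → M) θ) := fun θ =>
    (hΛ.isImmersion.isImmersionAt θ).mfderiv_injective (by simp)
  obtain ⟨N, j, hj, hjinj, hji⟩ := exists_immersion_along_compact (m := m) hΛc
  have hj1 : ContMDiff (𝓡 m) 𝓘(ℝ, EuclideanSpace ℝ (Fin N)) 1 j :=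
    hj.of_le (by exact_mod_cast le_top)
  have hEu := hf.isClosed_u hΛc.isClosed
  have hEs := hf.isClosed_s hΛc.isClosed
  obtain ⟨Pu, Ps, Oc, hP⟩ := exists_adaptedProjections (c := c) hj1 (fun θ : Λ => hji θ θ.2) hv1
    hf.splitting (hf.isClosed_c hΛc.isClosed) hEu hEs
  obtain ⟨e, heΛ, hen, hec⟩ := exists_tubular_neighbourhood (u := u) (s := s) hP hj1
    ((hj.comp hv).of_le (WithTop.coe_le_coe.2 (le_top : (2 : ℕ∞) ≤ ⊤))) hjinj (hv1.mdifferentiable (by simp)) hvi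
  have he0 : ∀ θ : Λ, e θ = ⟨θ, (0, 0)⟩ := by
    intro θ
    refine whitneyCoord_injective hP.injective ?_
    have h1 : (e θ).1 = θ := (hen θ).eq_of_mem hjinj
    rw [hec, h1, sub_self, map_zero, map_zero, whitneyCoord_zero]
  -- the iterate
  have hg := hf.mapsTo.iterate k
  have hg1 : ContMDiff (𝓡 m) (𝓡 m) 1 f^[k] := contMDiff_iterate f.contMDiff k
  let η : C(Λ, Λ) := ⟨fun θ => ⟨f^[k] θ, hg θ.2⟩,
    (hg1.continuous.comp continuous_subtype_val).subtype_mk _⟩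
  -- Regularity for the manifold structure of `Λ` itself, deduced from that in `M` because the
  -- inclusion is an immersion.
  have hη1 : ContMDiff (𝓡 c) (𝓡 c) 1 η :=
    hΛ.isImmersion.contMDiff_of_comp (by exact_mod_cast le_top) η.continuous (hg1.comp hv1)
  have hηd : ∀ θ, Function.Injective (mfderiv (𝓡 c) (𝓡 c) η θ) := by
    intro θ
    have h1 : mfderiv (𝓡 c) (𝓡 m) (Subtype.val ∘ η) θ =
        (mfderiv (𝓡 c) (𝓡 m) Subtype.val (η θ)).comp (mfderiv (𝓡 c) (𝓡 c) η θ) :=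
      mfderiv_comp θ (hv1.mdifferentiable (by simp) _) (hη1.mdifferentiable (by simp) _)
    have h2 : mfderiv (𝓡 c) (𝓡 m) (Subtype.val ∘ η) θ =
        (mfderiv (𝓡 m) (𝓡 m) f^[k] (θ : M)).comp (mfderiv (𝓡 c) (𝓡 m) Subtype.val θ) :=
      mfderiv_comp θ (hg1.mdifferentiable (by simp) _) (hv1.mdifferentiable (by simp) _)
    have h3 : Function.Injective (mfderiv (𝓡 m) (𝓡 m) f^[k] (θ : M)) :=
      mfderiv_injective_of_leftInverse (hg1.mdifferentiable (by simp) _)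
        ((contMDiff_iterate f.symm.contMDiff k).mdifferentiable (by simp) _)
        (Filter.Eventually.of_forall
          ((show Function.LeftInverse f.symm f from f.symm_apply_apply).iterate k))
    refine Function.Injective.of_comp (f := mfderiv (𝓡 c) (𝓡 m) Subtype.val (η θ)) ?_
    have h4 := h3.comp (hvi θ)
    intro ξ ζ h
    refine h4 ?_
    exact (congrArg (fun T => T ξ) (h2.symm.trans h1)).trans
      (h.trans (congrArg (fun T => T ζ) (h1.symm.trans h2)))
  have hηb : Function.Bijective η := by
    refine ⟨fun θ θ' h => Subtype.ext (f.injective.iterate k (congrArg Subtype.val h)), fun θ => ?_⟩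
    obtain ⟨p, hp, hpθ⟩ := (show SurjOn f Λ Λ from hf.image_eq.superset).iterate k θ.2
    exact ⟨⟨p, hp⟩, Subtype.ext hpθ⟩
  refine exists_neighbourhoodCovers (isCompact_discBundle hEu hEs)
    (continuous_whitneyScale hj1 hP.injective) hg1 hg (hf.mfderiv_iterate_mem_u k)
    (hf.mfderiv_iterate_mem_s k) ?_ ?_ (η := η) (fun _ => rfl)
    (degTwo_ne_zero_of_bijective η hη1 hηb hηd) heΛ he0 ?_
  · intro θ x hx hx1
    have h1 := hf.norm_le_mfderiv_iterate k hx
    rw [hx1] at h1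
    by_contra h2
    have h3 := mul_le_mul_of_nonneg_left (not_lt.1 h2) hCk0.le
    linarith
  · intro θ y hy hy1
    have h1 := hf.norm_mfderiv_iterate_le k hy
    have h3 := mul_le_mul_of_nonneg_left hy1 hCk0.le
    linarith
  · intro v₀ l hl hl0
    exact hP.tendsto_whitneyScale hj1 hjinj hv1 hvi heΛ hen hec he0 hg1 hg
      (hf.mfderiv_iterate_mem_c k) (hf.mfderiv_iterate_mem_u k) (hf.mfderiv_iterate_mem_s k)
      ((continuous_fst.tendsto (0, v₀)).mono_left hl) hl0
      ((continuous_snd.tendsto (0, v₀)).mono_left hl)
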